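/- Consider $N$ spins, labelled by $\Lambda=\{1,\dots,N\}$, each with a $d$-dimensional Hilbert space ($d\ge 1$), and let $\|\cdot\|$ be the operator norm on $(\mathbb C^d)^{\otimes N}$. Let $k\ge 1$, $T>0$, $J>0$, and let $$H(t)=H_0+V(t),\qquad H_0=\sum_{|X|\le k}h_X,\qquad V(t)=\sum_{|X|\le k}v_X(t),\qquad V(t+T)=V(t),$$ where $X$ runs over subsets of $\Lambda$, $h_X$ and $v_X(t)$ act only on the spins in $X$, $H_0$ and $V(t)$ are Hermitian, each $v_X$ is integrable on $[0,T]$, and $$\sum_{X\ni i}\bigl(\|h_X\|+\|v_X(t)\|\bigr)\le J\qquad\text{for all } i\in\Lambda \text{ and all } t .$$ Put $\lambda=2kJ$, $V_0=\sum_{|X|\le k}\frac1T\int_0^T\|v_X(t)\|\,dt$, $n_0=\lfloor 1/(16\lambda T)\rfloor$ and $\overline\Omega_n=\frac{2V_0\lambda^n}{(n+1)^2}\,n!$. Let $U_{\rm F}=e^{-iH_{\rm F}T}=\mathcal T\bigl[e^{-i\int_0^TH(t)\,dt}\bigr]$ (time-ordered exponential) be the evolution operator over one period, which defines the Floquet Hamiltonian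 $H_{\rm F}$. Let $H_{\rm F}^{(n)}=\sum_{m=0}^nT^m\Omega_m$ be the truncated Floquet–Magnus expansion, with $$\Omega_n=\frac1{(n+1)^2}\sum_{\sigma}(-1)^{n-\theta(\sigma)}\frac{\theta(\sigma)!\,(n-\theta(\sigma))!}{n!}\,\frac1{i^nT^{n+1}}\int_0^T\!dt_{n+1}\cdots\int_0^{t_3}\!dt_2\int_0^{t_2}\!dt_1\,[H(t_{\sigma(n+1)}),[H(t_{\sigma(n)}),\dots,[H(t_{\sigma(2)}),H(t_{\sigma(1)})]\dots]],$$ where $\sigma$ runs over the permutations of $\{1,\dots,n+1\}$ and $\theta(\sigma)$ is the number of $i\in\{1,\dots,n\}$ with $\sigma(i+1)>\sigma(i)$. If $T\le 1/(4\lambda)$, then for every $n\le n_0$ $$\bigl\|e^{-iH_{\rm F}T}-e^{-iH_{\rm F}^{(n)}T}\bigr\|\le 6V_0T\,2^{-n_0}+\overline\Omega_{n+1}T^{n+2}.$$ Moreover, the Floquet–Magnus expansion is asymptotic: if $T$ and $H(t)$ are replaced by $sT$ and $H(t/s)$ with $s>0$, then for every fixed $n\ge 0$ the error $e^{-iH_{\rm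 F}T}-e^{-iH_{\rm F}^{(n)}T}$ of the rescaled system is $O\bigl((sT)^{n+2}\bigr)$ as $s\to0^+$. -/

import Mathlib

open scoped Matrix.Norms.L2Operator

noncomputable section

namespace FloquetMagnus

/-- Operators on the Hilbert space `(ℂ^d)^{⊗ N}` of `N` spins, written in the product basis, whose
elements are the configurations `Fin N → Fin d`.  The norm `‖·‖` on this type is the operator norm
with respect to the Hilbert space norm (the scope `Matrix.Norms.L2Operator`). -/
abbrev Op (N d : ℕ) : Type :=
  Matrix (Fin N → Fin d) (Fin N → Fin d) ℂ

/-- `A` acts on the spin subset `X` only: `A = a ⊗ 1` with `a` an operator on the spins of `X` and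
`1` the identity on the spins outside `X`. -/
def ActsOn {N d : ℕ} (X : Finset (Fin N)) (A : Op N d) : Prop :=
  ∃ a : Matrix (X → Fin d) (X → Fin d) ℂ, ∀ σ τ : Fin N → Fin d,
    ((∀ i, i ∉ X → σ i = τ i) → A σ τ = a (fun i => σ i) (fun i => τ i)) ∧
    ((¬ ∀ i, i ∉ X → σ i = τ i) → A σ τ = 0)

/-- The spin subsets `X` with `|X| ≤ k`. -/
def fewBody (N k : ℕ) : Finset (Finset (Fin N)) :=
  Finset.univ.filter fun X => X.card ≤ k

/-- The operator `∑_{|X| ≤ k} a_X`. -/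
def fewBodySum {N d : ℕ} (k : ℕ) (a : Finset (Fin N) → Op N d) : Op N d :=
  ∑ X ∈ fewBody N k, a X

/-- The driving Hamiltonian `V(t) = ∑_{|X| ≤ k} v_X(t)`. -/
def drive {N d : ℕ} (k : ℕ) (v : Finset (Fin N) → ℝ → Op N d) (t : ℝ) : Op N d :=
  fewBodySum k fun X => v X t

/-- The total Hamiltonian `H(t) = H_0 + V(t)`. -/
def hamiltonian {N d : ℕ} (k : ℕ) (h : Finset (Fin N) → Op N d)
    (v : Finset (Fin N) → ℝ → Op N d) (t : ℝ) : Op N d :=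
  fewBodySum k h + drive k v t

/-- `H_0 = ∑_{|X| ≤ k} h_X` and `V(t) = V(t + T) = ∑_{|X| ≤ k} v_X(t)` are few-body Hamiltonians
with local interaction strength `J`. -/
structure IsDrivenFewBody {N d : ℕ} (k : ℕ) (J T : ℝ) (h : Finset (Fin N) → Op N d)
    (v : Finset (Fin N) → ℝ → Op N d) : Prop where
  static_actsOn : ∀ X ∈ fewBody N k, ActsOn X (h X)
  drive_actsOn : ∀ X ∈ fewBody N k, ∀ t, ActsOn X (v X t)
  static_hermitian : (fewBodySum k h).IsHermitian
  drive_hermitian : ∀ t, (drive k v t).IsHermitian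
  drive_periodic : Function.Periodic (drive k v) T
  drive_integrable : ∀ X ∈ fewBody N k,
    IntervalIntegrable (v X) MeasureTheory.volume 0 T
  strength : ∀ (i : Fin N) (t : ℝ),
    ∑ X ∈ (fewBody N k).filter (fun X => i ∈ X), (‖h X‖ + ‖v X t‖) ≤ J

/-- `V_0 = ∑_{|X| ≤ k} (1/T) ∫_0^T ‖v_X(t)‖ dt`. -/
def driveStrength {N d : ℕ} (k : ℕ) (T : ℝ) (v : Finset (Fin N) → ℝ → Op N d) : ℝ :=
  ∑ X ∈ fewBody N k, (1 / T) * ∫ t in (0 : ℝ)..T, ‖v X t‖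

/-- `λ = 2kJ`. -/
def lam (k : ℕ) (J : ℝ) : ℝ := 2 * k * J

/-- `n_0 = ⌊1 / (16 λ T)⌋`. -/
def optimalOrder (k : ℕ) (J T : ℝ) : ℕ := ⌊1 / (16 * lam k J * T)⌋₊

/-- The constant `2 V_0 λ^n n! / (n+1)^2` (written `\overline{Ω}_n`). -/
def fmBound (V₀ lam : ℝ) (n : ℕ) : ℝ :=
  2 * V₀ * lam ^ n / ((n : ℝ) + 1) ^ 2 * (n.factorial : ℝ)

/-- The domain `0 ≤ t_1 ≤ t_2 ≤ ⋯ ≤ t_m ≤ T` of the iterated integral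
`∫_0^T dt_m ⋯ ∫_0^{t_3} dt_2 ∫_0^{t_2} dt_1`. -/
def orderedTimes (m : ℕ) (T : ℝ) : Set (Fin m → ℝ) :=
  {t | (∀ i, t i ∈ Set.Icc 0 T) ∧ Monotone t}

/-- The `m`-th term of the Dyson series of `H` on `[0, T]`:
`(-i)^m ∫_0^T dt_m ⋯ ∫_0^{t_2} dt_1  H(t_m) ⋯ H(t_2) H(t_1)`. -/
def dysonTerm {N d : ℕ} (H : ℝ → Op N d) (T : ℝ) (m : ℕ) : Op N d :=
  (-Complex.I) ^ m •
    ∫ t in orderedTimes m T, (List.ofFn fun i : Fin m => H (t i.rev)).prod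

/-- The time-ordered exponential `𝒯[exp(-i ∫_0^T H(t) dt)]`, that is, the time-evolution operator
over one period. -/
def timeOrderedExp {N d : ℕ} (H : ℝ → Op N d) (T : ℝ) : Op N d :=
  ∑' m, dysonTerm H T m

/-- The evolution operator `e^{-i A t}` of a time-independent Hamiltonian `A`. -/
def evolution {N d : ℕ} (A : Op N d) (t : ℝ) : Op N d :=
  NormedSpace.exp ((-Complex.I * (t : ℂ)) • A)

/-- `H_F` is a Floquet Hamiltonian of `H`: `e^{-i H_F T} = 𝒯[exp(-i ∫_0^T H(t) dt)]`. -/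
def IsFloquetHamiltonian {N d : ℕ} (H : ℝ → Op N d) (T : ℝ) (HF : Op N d) : Prop :=
  HF.IsHermitian ∧ evolution HF T = timeOrderedExp H T

/-- The multi-commutator `[A_{n+1}, [A_n, …, [A_2, A_1] … ]]` (the indices are shifted by one). -/
def multiCommutator {N d : ℕ} : (n : ℕ) → (Fin (n + 1) → Op N d) → Op N d
  | 0, A => A 0
  | n + 1, A => ⁅A (Fin.last (n + 1)), multiCommutator n fun i => A i.castSucc⁆

/-- `θ(σ)`, the number of `i` with `σ(i+1) > σ(i)`. -/
def ascents {n : ℕ} (σ : Equiv.Perm (Fin (n + 1))) : ℕ :=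
  (Finset.univ.filter fun i : Fin n => σ i.castSucc < σ i.succ).card

/-- The `n`-th term `Ω_n` of the Floquet–Magnus expansion of `H` with period `T`. -/
def fmTerm {N d : ℕ} (H : ℝ → Op N d) (T : ℝ) (n : ℕ) : Op N d :=
  (1 / ((n : ℂ) + 1) ^ 2) • ∑ σ : Equiv.Perm (Fin (n + 1)),
    ((-1 : ℂ) ^ (n - ascents σ) *
        (((ascents σ).factorial : ℂ) * ((n - ascents σ).factorial : ℂ) / (n.factorial : ℂ)) *
        (1 / (Complex.I ^ n * (T : ℂ) ^ (n + 1)))) •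
      ∫ t in orderedTimes (n + 1) T, multiCommutator n fun i => H (t (σ i))

/-- The truncated Floquet–Magnus expansion `H_F^{(n)} = ∑_{m=0}^n T^m Ω_m`. -/
def fmTruncated {N d : ℕ} (H : ℝ → Op N d) (T : ℝ) (n : ℕ) : Op N d :=
  ∑ m ∈ Finset.range (n + 1), (T : ℂ) ^ m • fmTerm H T m

end FloquetMagnus

end

/-! Put A(t) = -iH(t) and let U_ε be the time-ordered exponential of εA over [0,T], so that U_1 is
the evolution over one period. With y_m = -iT^{m+1}Ω_m and K(ε) = ∑_{m≤n} ε^{m+1} y_m, the truncated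
evolution is e^{K(1)}. The two are compared along ε ∈ [0,1]. The function e^{-K(ε)}U_ε - 1 vanishes
at ε = 0. Its derivative is e^{-K}(α - β)U_ε, where α and β are the left logarithmic derivatives (in
ε) of U_ε and of e^{K(ε)}. By unitarity the error is at most ∫_0^1 ‖α - β‖ dε.

Both α and β have the same Taylor polynomial ∑_{d≤n} ε^d ζ_d. The remainder of α solves a linear
equation with source ε^{n+1}[A, ζ_n]. The remainder of β comes from the commutators of total degree
above n that are dropped from the Taylor polynomial of e^{sK}K'e^{-sK}. Hence the error is (C₁ +
C₂)/(n + 2), by `norm_dysonSum_sub_exp_le`.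

The agreement of the Taylor polynomials says that the permutation formula for Ω_m really gives the
logarithm of U_ε. The factor θ!(n-θ)!/(n+1)! is a Beta integral of x^θ(1-x)^{n-θ}, so the
permutation sum is an average over x ∈ [0,1] of chains of nested commutators, weighted by x per
ascent and x - 1 per descent. For fixed x, the series Γ(x) of these chains satisfies (1 +
(1-x)(e^{ad Y} - 1))Γ(x) = z for a local logarithm Y of U_ε. Averaging over x applies ad Y/(e^{ad Y}
- 1) to z (`tsum_magnusTerm_eq`). For the source A this recovers Y'. For the source [A, X] it gives
[Y/ε, X], so that [y_m, X] is itself an average of nested commutators of the A(t) with X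
(`adL_magnusCoeff`).

The last identity makes the bounds local. An operator is kept as a family of terms indexed by spin
subsets, with the ℓ¹ norm. Commuting a family on at most kr spins with the few-body Hamiltonian
costs a factor λr and enlarges the supports by k. Thus nested commutators cost factorials times
powers of λT, without an additional factor N. Since the static part commutes with itself, one
innermost entry can always be taken from the drive, whence the prefactor V_0T.

At the order n_0, where λTn_0 ≤ 1/16, the factorials are beaten and the error is at most
V_0T·2^{-n_0}. For smaller n, the triangle inequality adds ∑_{n<m≤n_0} ‖y_m‖, a sum of bounds
decreasing by at least 16 at each step; it is dominated by the first omitted term. At a fixed order,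
the same error estimate has at least n + 1 powers of λT besides V_0T, and this is the asymptotic
statement. -/

open scoped Matrix.Norms.L2Operator

set_option linter.unusedSectionVars false

noncomputable section

namespace FloquetMagnus

open MeasureTheory Set Filter Topology Asymptotics

/-! ### Calculus of indefinite integrals of integrable, possibly discontinuous, functions -/

section Primitive

variable {E : Type*} [NormedAddCommGroup E] [NormedSpace ℝ E]
  {M : Type*} [NormedRing M] [NormedAlgebra ℝ M]

/-- On `[0, T]` the function `F` is the indefinite integral of the integrable function `f`. -/
structure IsPrimitive (T : ℝ) (F f : ℝ → E) : Prop where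
  integrable : IntervalIntegrable f volume 0 T
  eq_integral : ∀ t ∈ Icc 0 T, F t = F 0 + ∫ s in (0 : ℝ)..t, f s

lemma intervalIntegrable_sub {E : Type*} [NormedAddCommGroup E] {f : ℝ → E} {T t : ℝ}
    (hf : IntervalIntegrable f volume 0 T) (ht : t ∈ Icc 0 T) : IntervalIntegrable f volume 0 t :=
  hf.mono_set (by
    rw [uIcc_of_le ht.1, uIcc_of_le (ht.1.trans ht.2)]; exact Icc_subset_Icc_right ht.2)

lemma isPrimitive_integral {T : ℝ} {f : ℝ → E} (hf : IntervalIntegrable f volume 0 T) :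
    IsPrimitive T (fun t => ∫ s in (0 : ℝ)..t, f s) f :=
  ⟨hf, fun t _ => by simp⟩

lemma isPrimitive_const (T : ℝ) (c : E) : IsPrimitive T (fun _ => c) (fun _ => 0) :=
  ⟨by simp, fun t _ => by simp⟩

lemma IsPrimitive.continuousOn {T : ℝ} {F f : ℝ → E} (h : IsPrimitive T F f) (hT : 0 ≤ T) :
    ContinuousOn F (Icc 0 T) := by
  have h1 : ContinuousOn (fun x => ∫ t in (0 : ℝ)..x, f t) (uIcc 0 T) :=
    intervalIntegral.continuousOn_primitive_interval (by
      have := h.integrable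
      rw [intervalIntegrable_iff_integrableOn_Icc_of_le hT] at this
      rwa [uIcc_of_le hT])
  rw [uIcc_of_le hT] at h1
  exact (continuousOn_const.add h1).congr fun t ht => h.eq_integral t ht

lemma IsPrimitive.congr {T : ℝ} {F f F' f' : ℝ → E} (h : IsPrimitive T F f) (hT : 0 ≤ T)
    (hF : ∀ t ∈ Icc 0 T, F' t = F t) (hf : ∀ t ∈ Icc 0 T, f' t = f t) : IsPrimitive T F' f' := by
  refine ⟨h.integrable.congr fun t ht => ?_, fun t ht => ?_⟩
  · rw [uIoc_of_le hT] at ht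
    exact (hf t ⟨ht.1.le, ht.2⟩).symm
  · rw [hF t ht, hF 0 ⟨le_rfl, hT⟩, h.eq_integral t ht]
    congr 1
    refine intervalIntegral.integral_congr fun s hs => ?_
    rw [uIcc_of_le ht.1] at hs
    exact (hf s ⟨hs.1, hs.2.trans ht.2⟩).symm

lemma IsPrimitive.add {T : ℝ} {F f G g : ℝ → E} (hF : IsPrimitive T F f)
    (hG : IsPrimitive T G g) : IsPrimitive T (fun t => F t + G t) (fun t => f t + g t) := by
  refine ⟨hF.integrable.add hG.integrable, fun t ht => ?_⟩
  rw [hF.eq_integral t ht, hG.eq_integral t ht, intervalIntegral.integral_add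
    (intervalIntegrable_sub hF.integrable ht) (intervalIntegrable_sub hG.integrable ht)]
  abel

lemma IsPrimitive.sum {T : ℝ} {ι : Type*} (s : Finset ι) {F f : ι → ℝ → E}
    (hF : ∀ i ∈ s, IsPrimitive T (F i) (f i)) :
    IsPrimitive T (fun t => ∑ i ∈ s, F i t) (fun t => ∑ i ∈ s, f i t) := by
  classical
  induction s using Finset.induction_on with
  | empty => simpa using isPrimitive_const T (0 : E)
  | insert i s hi ih =>
    simp only [Finset.sum_insert hi]
    exact (hF i (Finset.mem_insert_self i s)).add
      (ih fun j hj => hF j (Finset.mem_insert_of_mem hj))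

lemma IsPrimitive.map [CompleteSpace E] {E' : Type*} [NormedAddCommGroup E'] [NormedSpace ℝ E']
    [CompleteSpace E'] {T : ℝ} {F f : ℝ → E} (hF : IsPrimitive T F f) (L : E →L[ℝ] E') :
    IsPrimitive T (fun t => L (F t)) (fun t => L (f t)) := by
  refine ⟨⟨L.integrable_comp hF.integrable.1, L.integrable_comp hF.integrable.2⟩, fun t ht => ?_⟩
  rw [hF.eq_integral t ht, map_add,
    L.intervalIntegral_comp_comm (intervalIntegrable_sub hF.integrable ht)]

lemma IsPrimitive.const_smul {T : ℝ} {F f : ℝ → E} (hF : IsPrimitive T F f) (c : ℝ) :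
    IsPrimitive T (fun t => c • F t) (fun t => c • f t) := by
  refine ⟨hF.integrable.smul c, fun t ht => ?_⟩
  rw [hF.eq_integral t ht, smul_add, intervalIntegral.integral_smul]

lemma IsPrimitive.eq_of_zero {T : ℝ} {F f G : ℝ → E} (hF : IsPrimitive T F f)
    (hG : IsPrimitive T G f) (h0 : F 0 = G 0) {t : ℝ} (ht : t ∈ Icc 0 T) : F t = G t := by
  rw [hF.eq_integral t ht, hG.eq_integral t ht, h0]

lemma IsPrimitive.norm_sub_le {T : ℝ} {F f : ℝ → E} (hF : IsPrimitive T F f) {b : ℝ → ℝ}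
    (hb : IntervalIntegrable b volume 0 T) (hfb : ∀ t ∈ Icc 0 T, ‖f t‖ ≤ b t) {t : ℝ}
    (ht : t ∈ Icc 0 T) : ‖F t - F 0‖ ≤ ∫ s in (0 : ℝ)..t, b s := by
  rw [hF.eq_integral t ht, add_sub_cancel_left]
  exact intervalIntegral.norm_integral_le_of_norm_le ht.1
    (Filter.Eventually.of_forall fun s hs => hfb s ⟨hs.1.le, hs.2.trans ht.2⟩)
    (intervalIntegrable_sub hb ht)

/-- Fubini on the square (0,t]², cut along its diagonal. The integrands are merely integrable, so
the product rule cannot be obtained from pointwise derivatives. -/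
lemma integral_mul_integral_eq [CompleteSpace M] {f g : ℝ → M} {t : ℝ} (ht : 0 ≤ t)
    (hf : IntervalIntegrable f volume 0 t) (hg : IntervalIntegrable g volume 0 t) :
    (∫ s in (0 : ℝ)..t, f s) * (∫ s in (0 : ℝ)..t, g s)
      = (∫ s in (0 : ℝ)..t, f s * ∫ r in (0 : ℝ)..s, g r)
        + ∫ s in (0 : ℝ)..t, (∫ r in (0 : ℝ)..s, f r) * g s := by
  set μ : Measure ℝ := volume.restrict (Ioc 0 t) with hμ
  have hf' : Integrable f μ := hf.1
  have hg' : Integrable g μ := hg.1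
  have hfg : Integrable (fun z : ℝ × ℝ => f z.1 * g z.2) (μ.prod μ) := hf'.mul_prod hg'
  have hm : MeasurableSet {z : ℝ × ℝ | z.2 ≤ z.1} := measurableSet_le measurable_snd measurable_fst
  have hm' : MeasurableSet {z : ℝ × ℝ | z.2 ≤ z.1}ᶜ := hm.compl
  have hsplit := integral_add_compl hm hfg
  have key : ∀ (k : ℝ → M) (S : Set ℝ) (s : ℝ), MeasurableSet S → S ∩ Ioc 0 t = Ioc 0 s →
      0 ≤ s → ∫ r, S.indicator k r ∂μ = ∫ r in (0 : ℝ)..s, k r := by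
    intro k S s hS hSt hs
    rw [integral_indicator hS, hμ, Measure.restrict_restrict hS, hSt,
      intervalIntegral.integral_of_le hs]
  have h1 : ∫ z in {z : ℝ × ℝ | z.2 ≤ z.1}, f z.1 * g z.2 ∂(μ.prod μ)
      = ∫ s in (0 : ℝ)..t, f s * ∫ r in (0 : ℝ)..s, g r := by
    rw [← integral_indicator hm, integral_prod _ (hfg.indicator hm),
      intervalIntegral.integral_of_le ht]
    refine setIntegral_congr_fun measurableSet_Ioc fun s hs => ?_
    rw [← key g (Iic s) s measurableSet_Iic (by ext r; simp; grind) hs.1.le,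
      ← integral_const_mul_of_integrable (hg'.indicator measurableSet_Iic)]
    refine integral_congr_ae (Filter.Eventually.of_forall fun r => ?_)
    by_cases h : r ≤ s <;> simp [indicator, h]
  have h2 : ∫ z in {z : ℝ × ℝ | z.2 ≤ z.1}ᶜ, f z.1 * g z.2 ∂(μ.prod μ)
      = ∫ s in (0 : ℝ)..t, (∫ r in (0 : ℝ)..s, f r) * g s := by
    rw [← integral_indicator hm', integral_prod_symm _ (hfg.indicator hm'),
      intervalIntegral.integral_of_le ht]
    refine setIntegral_congr_fun measurableSet_Ioc fun s hs => ?_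
    -- On this side the diagonal is excluded; `Iio` and `Iic` differ by a null set.
    have : ∫ r in (0 : ℝ)..s, f r = ∫ r, (Iio s).indicator f r ∂μ := by
      rw [← key f (Iic s) s measurableSet_Iic (by ext r; simp; grind) hs.1.le]
      refine integral_congr_ae (ae_restrict_of_ae ?_)
      exact (indicator_ae_eq_of_ae_eq_set Iio_ae_eq_Iic).symm
    rw [this, ← integral_mul_const_of_integrable (hf'.indicator measurableSet_Iio)]
    refine integral_congr_ae (Filter.Eventually.of_forall fun r => ?_)
    by_cases h : r < s <;> simp [indicator, h, not_le.2, not_lt.1]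
  rw [← h1, ← h2, hsplit, integral_prod _ hfg, intervalIntegral.integral_of_le ht,
    intervalIntegral.integral_of_le ht]
  simp_rw [integral_const_mul_of_integrable hg']
  rw [integral_mul_const_of_integrable hf']

/-- The product rule for indefinite integrals. -/
lemma IsPrimitive.mul [CompleteSpace M] {T : ℝ} (hT : 0 ≤ T) {F f G g : ℝ → M}
    (hF : IsPrimitive T F f) (hG : IsPrimitive T G g) :
    IsPrimitive T (fun t => F t * G t) (fun t => f t * G t + F t * g t) := by
  have cF := hF.continuousOn hT
  have cG := hG.continuousOn hT
  rw [← uIcc_of_le hT] at cF cG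
  have i1 := hF.integrable.mul_continuousOn cG
  have i2 := hG.integrable.continuousOn_mul cF
  refine ⟨i1.add i2, fun t ht => ?_⟩
  have hf := intervalIntegrable_sub hF.integrable ht
  have hg := intervalIntegrable_sub hG.integrable ht
  have pF : ContinuousOn (fun s => ∫ r in (0 : ℝ)..s, f r) (uIcc 0 t) := by
    rw [uIcc_of_le ht.1]
    exact ((isPrimitive_integral hf).continuousOn ht.1)
  have pG : ContinuousOn (fun s => ∫ r in (0 : ℝ)..s, g r) (uIcc 0 t) := by
    rw [uIcc_of_le ht.1]
    exact ((isPrimitive_integral hg).continuousOn ht.1)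
  have e1 : ∫ s in (0 : ℝ)..t, (f s * G s + F s * g s)
      = ∫ s in (0 : ℝ)..t, ((f s * G 0 + f s * ∫ r in (0 : ℝ)..s, g r)
          + (F 0 * g s + (∫ r in (0 : ℝ)..s, f r) * g s)) := by
    refine intervalIntegral.integral_congr fun s hs => ?_
    rw [uIcc_of_le ht.1] at hs
    rw [hG.eq_integral s ⟨hs.1, hs.2.trans ht.2⟩, hF.eq_integral s ⟨hs.1, hs.2.trans ht.2⟩]
    noncomm_ring
  have hc1 : IntervalIntegrable (fun s => f s * G 0) volume 0 t := hf.mul_const _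
  have hc2 : IntervalIntegrable (fun s => F 0 * g s) volume 0 t := hg.const_mul _
  rw [e1, intervalIntegral.integral_add (hc1.add (hf.mul_continuousOn pG))
      (hc2.add (hg.continuousOn_mul pF)),
    intervalIntegral.integral_add hc1 (hf.mul_continuousOn pG),
    intervalIntegral.integral_add hc2 (hg.continuousOn_mul pF),
    show ∫ s in (0 : ℝ)..t, f s * G 0 = (∫ s in (0 : ℝ)..t, f s) * G 0 from
      ((ContinuousLinearMap.mul ℝ M).flip (G 0)).intervalIntegral_comp_comm hf,
    show ∫ s in (0 : ℝ)..t, F 0 * g s = F 0 * (∫ s in (0 : ℝ)..t, g s) from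
      (ContinuousLinearMap.mul ℝ M (F 0)).intervalIntegral_comp_comm hg,
    hF.eq_integral t ht, hG.eq_integral t ht, add_mul, mul_add, mul_add,
    integral_mul_integral_eq ht.1 hf hg]
  abel

lemma integral_pow_primitive {T : ℝ} (hT : 0 ≤ T) {F f : ℝ → ℝ} (hF : IsPrimitive T F f)
    (n : ℕ) : IsPrimitive T (fun t => F t ^ (n + 1)) (fun t => (n + 1) * (f t * F t ^ n)) := by
  induction n with
  | zero => simpa using hF
  | succ n ih =>
    refine (ih.mul hT hF).congr hT (fun t _ => by ring) fun t _ => by push_cast; ring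

end Primitive

/-! ### Iterated integrals and linear Volterra equations -/

section Picard

variable {E : Type*} [NormedAddCommGroup E] [NormedSpace ℝ E]

/-- The iterated integrals `f₀ = f`, `f_{m+1}(t) = ∫_0^t a(s) f_m(s) ds`. -/
def picard (a : ℝ → E →L[ℝ] E) (f : ℝ → E) : ℕ → ℝ → E
  | 0 => f
  | m + 1 => fun t => ∫ s in (0 : ℝ)..t, a s (picard a f m s)

lemma intervalIntegrable_clm_apply {T : ℝ} (hT : 0 ≤ T) {a : ℝ → E →L[ℝ] E} {g : ℝ → E}
    (ha : IntervalIntegrable a volume 0 T) (hg : ContinuousOn g (Icc 0 T)) :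
    IntervalIntegrable (fun s => a s (g s)) volume 0 T := by
  rw [intervalIntegrable_iff_integrableOn_Icc_of_le hT] at ha ⊢
  obtain ⟨C, hC⟩ := (isCompact_Icc.image_of_continuousOn hg).isBounded.exists_norm_le
  refine (ha.norm.mul_const C).mono'
    ((ContinuousLinearMap.id ℝ (E →L[ℝ] E)).aestronglyMeasurable_comp₂ ha.aestronglyMeasurable
      (hg.aestronglyMeasurable measurableSet_Icc)) ?_
  refine (ae_restrict_mem measurableSet_Icc).mono fun s hs => ?_
  exact ((a s).le_opNorm _).trans
    (mul_le_mul_of_nonneg_left (hC _ (mem_image_of_mem g hs)) (norm_nonneg _))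

variable {T : ℝ} {a : ℝ → E →L[ℝ] E} {f : ℝ → E}

lemma picard_continuousOn (hT : 0 ≤ T) (ha : IntervalIntegrable a volume 0 T)
    (hf : ContinuousOn f (Icc 0 T)) (m : ℕ) : ContinuousOn (picard a f m) (Icc 0 T) := by
  induction m with
  | zero => exact hf
  | succ m ih =>
    exact (isPrimitive_integral (intervalIntegrable_clm_apply hT ha ih)).continuousOn hT

lemma picard_succ_isPrimitive (hT : 0 ≤ T) (ha : IntervalIntegrable a volume 0 T)
    (hf : ContinuousOn f (Icc 0 T)) (m : ℕ) :
    IsPrimitive T (picard a f (m + 1)) (fun s => a s (picard a f m s)) :=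
  isPrimitive_integral (intervalIntegrable_clm_apply hT ha (picard_continuousOn hT ha hf m))

/-- The integral of ‖a‖(∫‖a‖)^m/m! is the next term of the same shape. The factorial makes the
series in ε entire, so the value ε = 1 needs no smallness. -/
lemma picard_norm_le (hT : 0 ≤ T) (ha : IntervalIntegrable a volume 0 T)
    (hf : ContinuousOn f (Icc 0 T)) {C : ℝ} (hC : ∀ t ∈ Icc 0 T, ‖f t‖ ≤ C) (m : ℕ) {t : ℝ}
    (ht : t ∈ Icc 0 T) :
    ‖picard a f m t‖ ≤ C * ((∫ s in (0 : ℝ)..t, ‖a s‖) ^ m / m.factorial) := by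
  induction m generalizing t with
  | zero => simpa [picard] using hC t ht
  | succ m ih =>
    have hprim := integral_pow_primitive hT (isPrimitive_integral ha.norm) m
    have hp := picard_succ_isPrimitive hT ha hf m
    have h0 : picard a f (m + 1) 0 = 0 := by simp [picard]
    have hb := hp.norm_sub_le (b := fun s => C / (m + 1).factorial *
      ((m + 1) * (‖a s‖ * (∫ s in (0 : ℝ)..s, ‖a s‖) ^ m))) (hprim.integrable.const_mul _)
      (fun s hs => by
        refine ((a s).le_opNorm _).trans
          ((mul_le_mul_of_nonneg_left (ih hs) (norm_nonneg _)).trans (le_of_eq ?_))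
        rw [Nat.factorial_succ]; push_cast; field_simp) ht
    rw [h0, sub_zero, intervalIntegral.integral_const_mul] at hb
    refine hb.trans (le_of_eq ?_)
    have := hprim.eq_integral t ht
    simp only [intervalIntegral.integral_same, ne_eq, Nat.add_eq_zero_iff, one_ne_zero, and_false,
      not_false_eq_true, zero_pow, zero_add] at this
    rw [← this]; ring

lemma picard_norm_le_uniform (hT : 0 ≤ T) (ha : IntervalIntegrable a volume 0 T)
    (hf : ContinuousOn f (Icc 0 T)) :
    ∃ C, 0 ≤ C ∧ ∀ m, ∀ t ∈ Icc 0 T,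
      ‖picard a f m t‖ ≤ C * ((∫ s in (0 : ℝ)..T, ‖a s‖) ^ m / m.factorial) := by
  obtain ⟨C, hC⟩ := (isCompact_Icc.image_of_continuousOn hf).isBounded.exists_norm_le
  have hC' : ∀ t ∈ Icc 0 T, ‖f t‖ ≤ C := fun t ht => hC _ (mem_image_of_mem f ht)
  have h0 : 0 ≤ C := (norm_nonneg _).trans (hC' 0 ⟨le_rfl, hT⟩)
  refine ⟨C, h0, fun m t ht => (picard_norm_le hT ha hf hC' m ht).trans ?_⟩
  have : 0 ≤ ∫ s in (0 : ℝ)..t, ‖a s‖ :=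
    intervalIntegral.integral_nonneg ht.1 fun _ _ => norm_nonneg _
  have h2 : ∫ s in (0 : ℝ)..t, ‖a s‖ ≤ ∫ s in (0 : ℝ)..T, ‖a s‖ :=
    intervalIntegral.integral_mono_interval le_rfl ht.1 ht.2
      (Filter.Eventually.of_forall fun _ => norm_nonneg _) ha.norm
  gcongr

/-- For any `r > 0` the iterated integrals are `O(r^m)`, uniformly on `[0, T]`. -/
lemma picard_norm_le_geometric (hT : 0 ≤ T) (ha : IntervalIntegrable a volume 0 T)
    (hf : ContinuousOn f (Icc 0 T)) {r : ℝ} (hr : 0 < r) :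
    ∃ C, 0 ≤ C ∧ ∀ m, ∀ t ∈ Icc 0 T, ‖picard a f m t‖ ≤ C * r ^ m := by
  obtain ⟨C, h0, hC⟩ := picard_norm_le_uniform hT ha hf
  set Λ := ∫ s in (0 : ℝ)..T, ‖a s‖ with hΛ
  have hΛ0 : 0 ≤ Λ := intervalIntegral.integral_nonneg hT fun _ _ => norm_nonneg _
  refine ⟨C * Real.exp (Λ / r), by positivity, fun m t ht => (hC m t ht).trans ?_⟩
  have h1 : (Λ / r) ^ m / m.factorial ≤ Real.exp (Λ / r) :=
    Real.pow_div_factorial_le_exp _ (by positivity) m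
  rw [mul_assoc]
  refine mul_le_mul_of_nonneg_left ?_ h0
  calc Λ ^ m / m.factorial = (Λ / r) ^ m / m.factorial * r ^ m := by
        rw [div_pow]; field_simp
    _ ≤ _ := by gcongr

lemma summable_norm_of_geometric {c : ℕ → E} {C ε : ℝ}
    (hc : ∀ m, ‖c m‖ ≤ C * (1 / (|ε| + 1)) ^ m) : Summable fun m => ‖ε ^ m • c m‖ := by
  have h1 : |ε| / (|ε| + 1) < 1 := by rw [div_lt_one (by positivity)]; linarith
  refine Summable.of_nonneg_of_le (fun _ => norm_nonneg _) (fun m => ?_)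
    ((summable_geometric_of_lt_one (by positivity) h1).mul_left C)
  rw [norm_smul, norm_pow, Real.norm_eq_abs, div_pow]
  refine (mul_le_mul_of_nonneg_left (hc m) (by positivity)).trans (le_of_eq ?_)
  rw [one_div, inv_pow]; ring

lemma picard_summable (hT : 0 ≤ T) (ha : IntervalIntegrable a volume 0 T)
    (hf : ContinuousOn f (Icc 0 T)) (ε : ℝ) {t : ℝ} (ht : t ∈ Icc 0 T) :
    Summable fun m => ‖ε ^ m • picard a f m t‖ := by
  obtain ⟨C, -, hC⟩ := picard_norm_le_geometric hT ha hf (r := 1 / (|ε| + 1)) (by positivity)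
  exact summable_norm_of_geometric fun m => hC m t ht

/-- The sum `∑ ε^m f_m(t)` of the iterated integrals, the solution of
`S(t) = f(t) + ε ∫_0^t a(s) S(s) ds`. -/
def picardSum (a : ℝ → E →L[ℝ] E) (f : ℝ → E) (ε t : ℝ) : E := ∑' m, ε ^ m • picard a f m t

lemma picardSum_isPrimitive [CompleteSpace E] (hT : 0 ≤ T) (ha : IntervalIntegrable a volume 0 T)
    {f' : ℝ → E} (hf : IsPrimitive T f f') (ε : ℝ) :
    IsPrimitive T (picardSum a f ε) (fun s => f' s + ε • a s (picardSum a f ε s)) := by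
  have hc := hf.continuousOn hT
  obtain ⟨C, hC0, hC⟩ := picard_norm_le_geometric hT ha hc (r := 1 / (|ε| + 1)) (by positivity)
  have h1 : |ε| / (|ε| + 1) < 1 := by rw [div_lt_one (by positivity)]; linarith
  have hgs := summable_geometric_of_lt_one (by positivity) h1
  have hbd : ∀ m, ∀ t ∈ Icc 0 T, ‖ε ^ m • picard a f m t‖ ≤ C * (|ε| / (|ε| + 1)) ^ m := by
    intro m t ht
    rw [norm_smul, norm_pow, Real.norm_eq_abs, div_pow]
    refine (mul_le_mul_of_nonneg_left (hC m t ht) (by positivity)).trans (le_of_eq ?_)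
    rw [one_div, inv_pow]; ring
  have hsum : ∀ t ∈ Icc 0 T, HasSum (fun m => ε ^ m • picard a f m t) (picardSum a f ε t) :=
    fun t ht => (picard_summable hT ha hc ε ht).of_norm.hasSum
  have hcont : ContinuousOn (picardSum a f ε) (Icc 0 T) :=
    continuousOn_tsum (fun m => (picard_continuousOn hT ha hc m).const_smul _)
      (hgs.mul_left C) hbd
  have hint : ∀ t ∈ Icc 0 T, HasSum (fun m => ∫ s in (0 : ℝ)..t, a s (ε ^ m • picard a f m s))
      (∫ s in (0 : ℝ)..t, a s (picardSum a f ε s)) := by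
    intro t ht
    have hat := intervalIntegrable_sub ha ht
    have hsub : ∀ s ∈ uIoc 0 t, s ∈ Icc 0 T := fun s hs => by
      rw [uIoc_of_le ht.1] at hs; exact ⟨hs.1.le, hs.2.trans ht.2⟩
    refine intervalIntegral.hasSum_integral_of_dominated_convergence
      (fun m s => ‖a s‖ * (C * (|ε| / (|ε| + 1)) ^ m)) (fun m => ?_) (fun m => ?_) ?_ ?_ ?_
    · exact (intervalIntegrable_iff.1 (intervalIntegrable_sub (intervalIntegrable_clm_apply hT ha
        ((picard_continuousOn hT ha hc m).const_smul (ε ^ m))) ht)).aestronglyMeasurable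
    · exact Filter.Eventually.of_forall fun s hs => ((a s).le_opNorm _).trans
        (mul_le_mul_of_nonneg_left (hbd m s (hsub s hs)) (norm_nonneg _))
    · exact Filter.Eventually.of_forall fun s _ => (hgs.mul_left C).mul_left _
    · simp_rw [tsum_mul_left]
      exact hat.norm.mul_const _
    · exact Filter.Eventually.of_forall fun s hs => (a s).hasSum (hsum s (hsub s hs))
  have hi := intervalIntegrable_clm_apply hT ha hcont
  have hmain : ∀ t ∈ Icc 0 T,
      picardSum a f ε t = f t + ε • ∫ s in (0 : ℝ)..t, a s (picardSum a f ε s) := by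
    intro t ht
    have h2 := ((hint t ht).const_smul ε)
    have h3 : HasSum (fun m => ε ^ (m + 1) • picard a f (m + 1) t)
        (ε • ∫ s in (0 : ℝ)..t, a s (picardSum a f ε s)) := by
      convert h2 using 2 with m
      simp only [picard, map_smul, intervalIntegral.integral_smul]
      rw [smul_smul, pow_succ']
    have h4 : HasSum (fun m => ε ^ m • picard a f m t)
        (f t + ε • ∫ s in (0 : ℝ)..t, a s (picardSum a f ε s)) :=
      (hasSum_nat_add_iff' 1).1 (by simpa [picard] using h3)
    exact (hsum t ht).unique h4
  refine ⟨hf.integrable.add (hi.smul ε), fun t ht => ?_⟩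
  have hit : IntervalIntegrable (fun s => ε • a s (picardSum a f ε s)) volume 0 t :=
    (intervalIntegrable_sub hi ht).smul ε
  rw [hmain t ht, hmain 0 ⟨le_rfl, hT⟩, intervalIntegral.integral_add
    (intervalIntegrable_sub hf.integrable ht) hit,
    intervalIntegral.integral_smul, hf.eq_integral t ht]
  simp [add_assoc]

end Picard

/-! ### Recursions for the coefficients of U, U X U⁻¹ and (∂U/∂ε)U⁻¹ -/

section Algebra

variable {M : Type*} [NormedRing M] [NormedAlgebra ℝ M]

/-- The commutator `y ↦ x y - y x`. -/
def adL : M →L[ℝ] M →L[ℝ] M := ContinuousLinearMap.mul ℝ M - (ContinuousLinearMap.mul ℝ M).flip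

@[simp] lemma adL_apply (x y : M) : adL x y = x * y - y * x := rfl

/-- The Dyson coefficients: `D₀ = 1`, `D_{m+1}(t) = ∫_0^t A(s) D_m(s) ds`. -/
def dysonCoeff (A : ℝ → M) : ℕ → ℝ → M :=
  picard (fun s => ContinuousLinearMap.mul ℝ M (A s)) (fun _ => 1)

/-- The coefficients of `U(t) X U(t)⁻¹`, where `U` is the sum of the Dyson series. -/
def conjCoeff (A : ℝ → M) (X : M) : ℕ → ℝ → M :=
  picard (fun s => adL (A s)) (fun _ => X)

/-- The coefficients of `(∂U/∂ε) U⁻¹`, where `U` is the sum of the Dyson series. -/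
def logDerivCoeff (A : ℝ → M) : ℕ → ℝ → M :=
  picard (fun s => adL (A s)) (fun t => ∫ s in (0 : ℝ)..t, A s)

variable [CompleteSpace M] {T : ℝ} {A : ℝ → M}

lemma intervalIntegrable_mulL (hA : IntervalIntegrable A volume 0 T) :
    IntervalIntegrable (fun s => ContinuousLinearMap.mul ℝ M (A s)) volume 0 T :=
  ⟨(ContinuousLinearMap.mul ℝ M).integrable_comp hA.1,
    (ContinuousLinearMap.mul ℝ M).integrable_comp hA.2⟩

lemma intervalIntegrable_adL (hA : IntervalIntegrable A volume 0 T) :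
    IntervalIntegrable (fun s => adL (A s)) volume 0 T :=
  ⟨(adL (M := M)).integrable_comp hA.1, (adL (M := M)).integrable_comp hA.2⟩

lemma dysonCoeff_succ_isPrimitive (hT : 0 ≤ T) (hA : IntervalIntegrable A volume 0 T) (m : ℕ) :
    IsPrimitive T (dysonCoeff A (m + 1)) (fun s => A s * dysonCoeff A m s) :=
  picard_succ_isPrimitive hT (intervalIntegrable_mulL hA) continuousOn_const m

lemma conjCoeff_succ_isPrimitive (hT : 0 ≤ T) (hA : IntervalIntegrable A volume 0 T) (X : M)
    (m : ℕ) : IsPrimitive T (conjCoeff A X (m + 1)) (fun s => adL (A s) (conjCoeff A X m s)) :=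
  picard_succ_isPrimitive hT (intervalIntegrable_adL hA) continuousOn_const m

lemma logDerivCoeff_succ_isPrimitive (hT : 0 ≤ T) (hA : IntervalIntegrable A volume 0 T)
    (m : ℕ) :
    IsPrimitive T (logDerivCoeff A (m + 1)) (fun s => adL (A s) (logDerivCoeff A m s)) :=
  picard_succ_isPrimitive hT (intervalIntegrable_adL hA)
    ((isPrimitive_integral hA).continuousOn hT) m

lemma dysonCoeff_isPrimitive (hT : 0 ≤ T) (hA : IntervalIntegrable A volume 0 T) (m : ℕ) :
    IsPrimitive T (dysonCoeff A m)
      (fun s => match m with | 0 => 0 | m + 1 => A s * dysonCoeff A m s) := by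
  cases m with
  | zero => exact isPrimitive_const T 1
  | succ m => exact dysonCoeff_succ_isPrimitive hT hA m

lemma logDerivCoeff_isPrimitive (hT : 0 ≤ T) (hA : IntervalIntegrable A volume 0 T) (m : ℕ) :
    IsPrimitive T (logDerivCoeff A m)
      (fun s => match m with | 0 => A s | m + 1 => adL (A s) (logDerivCoeff A m s)) := by
  cases m with
  | zero => exact isPrimitive_integral hA
  | succ m => exact logDerivCoeff_succ_isPrimitive hT hA m

lemma conjCoeff_isPrimitive (hT : 0 ≤ T) (hA : IntervalIntegrable A volume 0 T) (X : M) (m : ℕ) :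
    IsPrimitive T (conjCoeff A X m)
      (fun s => match m with | 0 => 0 | m + 1 => adL (A s) (conjCoeff A X m s)) := by
  cases m with
  | zero => exact isPrimitive_const T X
  | succ m => exact conjCoeff_succ_isPrimitive hT hA X m

lemma dysonCoeff_succ_zero (m : ℕ) : dysonCoeff A (m + 1) 0 = 0 := by simp [dysonCoeff, picard]

lemma logDerivCoeff_zero (m : ℕ) : logDerivCoeff A m 0 = 0 := by
  cases m <;> simp [logDerivCoeff, picard]

lemma conjCoeff_succ_zero (X : M) (m : ℕ) : conjCoeff A X (m + 1) 0 = 0 := by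
  simp [conjCoeff, picard]

/-- Coefficientwise form of `∂U/∂ε = ((∂U/∂ε) U⁻¹) U`. -/
lemma sum_logDerivCoeff_mul_dysonCoeff (hT : 0 ≤ T) (hA : IntervalIntegrable A volume 0 T)
    (m : ℕ) {t : ℝ} (ht : t ∈ Icc 0 T) :
    ∑ p ∈ Finset.HasAntidiagonal.antidiagonal m, logDerivCoeff A p.1 t * dysonCoeff A p.2 t
      = ((m : ℝ) + 1) • dysonCoeff A (m + 1) t := by
  induction m generalizing t with
  | zero => simp [logDerivCoeff, dysonCoeff, picard]
  | succ m ih =>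
    have hL := IsPrimitive.sum (T := T) (Finset.HasAntidiagonal.antidiagonal (m + 1)) (fun p _ =>
      (logDerivCoeff_isPrimitive hT hA p.1).mul hT (dysonCoeff_isPrimitive hT hA p.2))
    have hR := (dysonCoeff_succ_isPrimitive hT hA (m + 1)).const_smul (((m + 1 : ℕ) : ℝ) + 1)
    -- Both sides vanish at time 0, so only the densities are compared. Since [A,ζ]D + ζAD = A(ζD),
    -- the inductive sum contributes (m+1)·A D_{m+1}; the density A of ζ_0 supplies one more A
    -- D_{m+1}.
    refine hL.eq_of_zero (hR.congr hT (fun _ _ => rfl) fun s hs => ?_) ?_ ht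
    · rw [Finset.sum_add_distrib, Finset.Nat.sum_antidiagonal_succ,
        Finset.Nat.sum_antidiagonal_succ']
      simp only [mul_zero, zero_add]
      rw [add_assoc, ← Finset.sum_add_distrib]
      have : ∀ p : ℕ × ℕ, adL (A s) (logDerivCoeff A p.1 s) * dysonCoeff A p.2 s
          + logDerivCoeff A p.1 s * (A s * dysonCoeff A p.2 s)
          = A s * (logDerivCoeff A p.1 s * dysonCoeff A p.2 s) := fun p => by
        simp only [adL_apply]; noncomm_ring
      simp_rw [this]
      rw [← Finset.mul_sum, ih hs, mul_smul_comm, add_smul, one_smul]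
      push_cast
      module
    · simp [logDerivCoeff_zero, dysonCoeff_succ_zero]

/-- Coefficientwise form of `(U X U⁻¹) U = U X`. -/
lemma sum_conjCoeff_mul_dysonCoeff (hT : 0 ≤ T) (hA : IntervalIntegrable A volume 0 T) (X : M)
    (m : ℕ) {t : ℝ} (ht : t ∈ Icc 0 T) :
    ∑ p ∈ Finset.HasAntidiagonal.antidiagonal m, conjCoeff A X p.1 t * dysonCoeff A p.2 t
      = dysonCoeff A m t * X := by
  induction m generalizing t with
  | zero => simp [conjCoeff, dysonCoeff, picard]
  | succ m ih =>
    have hL := IsPrimitive.sum (T := T) (Finset.HasAntidiagonal.antidiagonal (m + 1)) (fun p _ =>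
      (conjCoeff_isPrimitive hT hA X p.1).mul hT (dysonCoeff_isPrimitive hT hA p.2))
    have hR := (dysonCoeff_succ_isPrimitive hT hA m).map ((ContinuousLinearMap.mul ℝ M).flip X)
    refine hL.eq_of_zero (hR.congr hT (fun _ _ => rfl) fun s hs => ?_) ?_ ht
    · rw [Finset.sum_add_distrib, Finset.Nat.sum_antidiagonal_succ,
        Finset.Nat.sum_antidiagonal_succ']
      simp only [mul_zero, zero_add, zero_mul]
      rw [← Finset.sum_add_distrib]
      have : ∀ p : ℕ × ℕ, adL (A s) (conjCoeff A X p.1 s) * dysonCoeff A p.2 s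
          + conjCoeff A X p.1 s * (A s * dysonCoeff A p.2 s)
          = A s * (conjCoeff A X p.1 s * dysonCoeff A p.2 s) := fun p => by
        simp only [adL_apply]; noncomm_ring
      simp_rw [this]
      rw [← Finset.mul_sum, ih hs]
      simp [mul_assoc]
    · rw [Finset.Nat.sum_antidiagonal_succ]
      simp [conjCoeff_succ_zero, dysonCoeff_succ_zero]

end Algebra

/-! ### Derivatives of the exponential and its conjugations -/

section Exponential

variable {M : Type*} [NormedRing M] [NormedAlgebra ℝ M] [CompleteSpace M]

lemma continuous_exp_real : Continuous (NormedSpace.exp : M → M) :=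
  continuous_iff_continuousAt.2 fun x => (NormedSpace.exp_analytic (𝕂 := ℝ) x).continuousAt

lemma exp_mul_exp_neg (x : M) : NormedSpace.exp x * NormedSpace.exp (-x) = 1 := by
  let _ : NormedAlgebra ℚ M := NormedAlgebra.restrictScalars ℚ ℝ M
  rw [← NormedSpace.exp_add_of_commute (Commute.refl x).neg_right, add_neg_cancel,
    NormedSpace.exp_zero]

/-- Duhamel's formula. -/
lemma exp_sub_exp_eq_integral (K L : M) :
    NormedSpace.exp L - NormedSpace.exp K
      = ∫ s in (0 : ℝ)..1, NormedSpace.exp (s • L) * (L - K) * NormedSpace.exp ((1 - s) • K) := by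
  have hd : ∀ s : ℝ, HasDerivAt
      (fun s : ℝ => NormedSpace.exp (s • L) * NormedSpace.exp ((1 - s) • K))
      (NormedSpace.exp (s • L) * (L - K) * NormedSpace.exp ((1 - s) • K)) s := by
    intro s
    have h1 := hasDerivAt_exp_smul_const (𝕂 := ℝ) L s
    have h2 := (hasDerivAt_exp_smul_const' (𝕂 := ℝ) K (1 - s)).scomp s
      ((hasDerivAt_id s).const_sub 1)
    refine (h1.mul h2).congr_deriv ?_
    simp only [neg_smul, one_smul, Function.comp_apply]
    noncomm_ring
  rw [intervalIntegral.integral_eq_sub_of_hasDerivAt (fun s _ => hd s)]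
  · simp
  · refine Continuous.intervalIntegrable ?_ _ _
    have := continuous_exp_real (M := M)
    fun_prop

/-- The derivative of `exp` along a path. -/
lemma hasDerivAt_exp_path {Y : ℝ → M} {Y' : M} {t : ℝ} (hY : HasDerivAt Y Y' t) :
    HasDerivAt (fun r => NormedSpace.exp (Y r))
      ((∫ s in (0 : ℝ)..1, NormedSpace.exp (s • Y t) * Y' * NormedSpace.exp (-(s • Y t)))
        * NormedSpace.exp (Y t)) t := by
  have hE := continuous_exp_real (M := M)
  set K := Y t
  have hline : HasDerivAt (fun r : ℝ => NormedSpace.exp (K + r • Y'))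
      (∫ s in (0 : ℝ)..1, NormedSpace.exp (s • K) * Y' * NormedSpace.exp ((1 - s) • K)) 0 := by
    rw [hasDerivAt_iff_tendsto_slope]
    have hc : Continuous fun r : ℝ => ∫ s in (0 : ℝ)..1,
        NormedSpace.exp (s • (K + r • Y')) * Y' * NormedSpace.exp ((1 - s) • K) := by
      refine intervalIntegral.continuous_parametric_intervalIntegral_of_continuous
        (f := fun (r s : ℝ) => NormedSpace.exp (s • (K + r • Y')) * Y'
          * NormedSpace.exp ((1 - s) • K)) ?_ continuous_const
      unfold Function.uncurry
      fun_prop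
    have h0 := (hc.tendsto 0).mono_left (nhdsWithin_le_nhds (s := {0}ᶜ))
    simp only [zero_smul, add_zero] at h0
    refine h0.congr' ?_
    filter_upwards [self_mem_nhdsWithin] with r hr
    have hr' : r ≠ 0 := hr
    rw [slope_def_module, sub_zero, zero_smul, add_zero, exp_sub_exp_eq_integral,
      ← intervalIntegral.integral_smul]
    refine intervalIntegral.integral_congr fun s _ => ?_
    simp only [add_sub_cancel_left, mul_smul_comm, smul_mul_assoc]
    rw [smul_smul, inv_mul_cancel₀ hr', one_smul]
  have hdiff : DifferentiableAt ℝ (NormedSpace.exp : M → M) K :=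
    (NormedSpace.exp_analytic (𝕂 := ℝ) K).differentiableAt
  have hpath : HasDerivAt (fun r : ℝ => K + r • Y') Y' 0 := by
    simpa using ((hasDerivAt_id (0 : ℝ)).smul_const Y').const_add K
  have h1 : HasDerivAt (fun r : ℝ => NormedSpace.exp (K + r • Y'))
      (fderiv ℝ (NormedSpace.exp : M → M) K Y') 0 := by
    have : HasFDerivAt (NormedSpace.exp : M → M) (fderiv ℝ (NormedSpace.exp : M → M) K)
        (K + (0 : ℝ) • Y') := by simpa using hdiff.hasFDerivAt
    exact this.comp_hasDerivAt (0 : ℝ) hpath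
  have h2 := hdiff.hasFDerivAt.comp_hasDerivAt t hY
  -- Duhamel's formula identifies the Fréchet derivative in the direction Y' along a straight line;
  -- the chain rule carries the same value to an arbitrary path.
  rw [h1.unique hline] at h2
  refine h2.congr_deriv ?_
  refine Eq.trans ?_ (((ContinuousLinearMap.mul ℝ M).flip
    (NormedSpace.exp K)).intervalIntegral_comp_comm ?_)
  · refine intervalIntegral.integral_congr fun s _ => ?_
    simp only [ContinuousLinearMap.flip_apply, ContinuousLinearMap.mul_apply', mul_assoc]
    congr 2
    let _ : NormedAlgebra ℚ M := NormedAlgebra.restrictScalars ℚ ℝ M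
    rw [← NormedSpace.exp_add_of_commute ((Commute.refl K).smul_left s).neg_left]
    congr 1
    module
  · refine Continuous.intervalIntegrable ?_ _ _
    fun_prop

/-- Comparison of `e^{sK} D e^{-sK}` with an approximate solution `P` of `P' = [K, P]`. -/
lemma norm_conj_exp_sub_le {K D : M} {P P' : ℝ → M} {c R : ℝ} (hc0 : 0 ≤ c)
    (hc : ∀ s ∈ Icc (-1 : ℝ) 1, ∀ X : M,
      ‖NormedSpace.exp (s • K) * X * NormedSpace.exp (-(s • K))‖ ≤ c * ‖X‖)
    (hP : ∀ s, HasDerivAt P (P' s) s) (hR : ∀ s ∈ Icc (0 : ℝ) 1, ‖P' s - adL K (P s)‖ ≤ R)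
    {s : ℝ} (hs : s ∈ Icc (0 : ℝ) 1) :
    ‖NormedSpace.exp (s • K) * D * NormedSpace.exp (-(s • K)) - P s‖
      ≤ c * (‖D - P 0‖ + c * R) := by
  -- Undoing the conjugation leaves only the residual P' - [K,P] as derivative, so φ is constant up
  -- to cR. Conjugating back costs one more factor c.
  set φ : ℝ → M := fun s => NormedSpace.exp (s • (-K)) * P s * NormedSpace.exp (s • K) with hφ
  have hd : ∀ s, HasDerivAt φ
      (NormedSpace.exp (s • (-K)) * (P' s - adL K (P s)) * NormedSpace.exp (s • K)) s := by
    intro s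
    have h1 := hasDerivAt_exp_smul_const (𝕂 := ℝ) (-K) s
    have h2 := hasDerivAt_exp_smul_const' (𝕂 := ℝ) K s
    refine ((h1.mul (hP s)).mul h2).congr_deriv ?_
    rw [adL_apply, Pi.mul_apply]
    noncomm_ring
  have hR0 : 0 ≤ R := (norm_nonneg _).trans (hR 0 (by simp))
  have hb : ∀ s ∈ Icc (0 : ℝ) 1,
      ‖NormedSpace.exp (s • (-K)) * (P' s - adL K (P s)) * NormedSpace.exp (s • K)‖
        ≤ c * R := by
    intro s hs
    have := hc (-s) ⟨by linarith [hs.2], by linarith [hs.1]⟩ (P' s - adL K (P s))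
    rw [neg_smul, neg_neg] at this
    rw [smul_neg]
    exact this.trans (mul_le_mul_of_nonneg_left (hR s hs) hc0)
  have hmv : ‖φ s - φ 0‖ ≤ c * R := by
    have := (convex_Icc (0 : ℝ) 1).norm_image_sub_le_of_norm_hasDerivWithin_le
      (fun x _ => (hd x).hasDerivWithinAt) hb (left_mem_Icc.2 zero_le_one) hs
    refine this.trans ?_
    rw [sub_zero, Real.norm_eq_abs, abs_of_nonneg hs.1]
    exact mul_le_of_le_one_right (mul_nonneg hc0 hR0) hs.2
  have hφ0 : φ 0 = P 0 := by simp [hφ]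
  have hrepr : NormedSpace.exp (s • K) * D * NormedSpace.exp (-(s • K)) - P s
      = NormedSpace.exp (s • K) * (D - φ s) * NormedSpace.exp (-(s • K)) := by
    have e1 := exp_mul_exp_neg (s • K)
    simp only [hφ, smul_neg]
    set a := NormedSpace.exp (s • K)
    set b := NormedSpace.exp (-(s • K))
    calc a * D * b - P s = a * D * b - (a * b) * P s * (a * b) := by rw [e1]; simp
      _ = _ := by noncomm_ring
  rw [hrepr]
  refine (hc s ⟨by linarith [hs.1], hs.2⟩ _).trans (mul_le_mul_of_nonneg_left ?_ hc0)
  calc ‖D - φ s‖ = ‖(D - P 0) - (φ s - φ 0)‖ := by rw [hφ0]; congr 1; abel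
    _ ≤ _ := (norm_sub_le _ _).trans (by linarith)

lemma commute_ringInverse_left {R : Type*} [Ring R] {a b : R} (h : Commute a b) :
    Commute (Ring.inverse a) b := by
  by_cases ha : IsUnit a
  · obtain ⟨u, rfl⟩ := ha
    rw [Ring.inverse_unit]
    exact h.units_inv_left
  · rw [Ring.inverse_non_unit _ ha]
    exact Commute.zero_left b

lemma continuousOn_integrable_prod {E : Type*} [NormedAddCommGroup E] {f : ℝ → ℝ → E}
    (hf : ContinuousOn (Function.uncurry f) (Icc 0 1 ×ˢ Icc 0 1)) :
    Integrable (Function.uncurry f)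
      ((volume.restrict (Ioc 0 1)).prod (volume.restrict (Ioc 0 1))) := by
  rw [Measure.prod_restrict]
  exact (hf.integrableOn_compact (isCompact_Icc.prod isCompact_Icc)).mono_set
    (prod_mono Ioc_subset_Icc_self Ioc_subset_Icc_self)

/-- The power series `log (1 + w) / w` at `w = e^z - 1` and `(e^z - 1) / z` are inverse to each
other; both are written as integrals. -/
lemma integral_inverse_mul_integral_exp (z : M)
    (hu : ∀ r ∈ Icc (0 : ℝ) 1, ∀ y ∈ Icc (0 : ℝ) 1,
      IsUnit (1 + y • (NormedSpace.exp (r • z) - 1))) :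
    ∫ y in (0 : ℝ)..1, Ring.inverse (1 + y • (NormedSpace.exp z - 1))
      * (∫ s in (0 : ℝ)..1, NormedSpace.exp (s • z)) = 1 := by
  have hE := continuous_exp_real (M := M)
  set e : ℝ → M := fun r => NormedSpace.exp (r • z) with he
  set S : ℝ → M := fun r => ∫ s in (0 : ℝ)..r, e s with hS
  set I : ℝ → ℝ → M := fun r y => Ring.inverse (1 + y • (e r - 1)) with hI
  have hec : Continuous e := by fun_prop
  have hde : ∀ r, HasDerivAt e (z * e r) r := fun r => hasDerivAt_exp_smul_const' (𝕂 := ℝ) z r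
  have hdS : ∀ r, HasDerivAt S (e r) r := fun r =>
    intervalIntegral.integral_hasDerivAt_right (hec.intervalIntegrable _ _)
      (hec.stronglyMeasurableAtFilter _ _) hec.continuousAt
  have hzS : ∀ r, z * S r = e r - 1 := by
    intro r
    have h1 : ∫ s in (0 : ℝ)..r, z * e s = e r - e 0 :=
      intervalIntegral.integral_eq_sub_of_hasDerivAt (fun s _ => hde s)
        ((continuous_const.mul hec).intervalIntegrable _ _)
    have h2 : ∫ s in (0 : ℝ)..r, z * e s = z * S r :=
      (ContinuousLinearMap.mul ℝ M z).intervalIntegral_comp_comm (hec.intervalIntegrable _ _)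
    rw [← h2, h1]; simp [he]
  have cze : ∀ r, Commute z (e r) := fun r => by
    let _ : NormedAlgebra ℚ M := NormedAlgebra.restrictScalars ℚ ℝ M
    exact ((Commute.refl z).smul_right r).exp_right
  have cee : ∀ r s, Commute (e r) (e s) := fun r s => by
    let _ : NormedAlgebra ℚ M := NormedAlgebra.restrictScalars ℚ ℝ M
    exact (((Commute.refl z).smul_right s).smul_left r).exp
  have cIx : ∀ r y x, Commute (e r) x → Commute (I r y) x := fun r y x h =>
    commute_ringInverse_left
      (((Commute.one_left x).add_left ((h.sub_left (Commute.one_left x)).smul_left y)))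
  have cSe : ∀ r s, Commute (e s) (S r) := by
    intro r s
    have h1 := (ContinuousLinearMap.mul ℝ M (e s)).intervalIntegral_comp_comm
      (hec.intervalIntegrable (μ := volume) 0 r)
    have h2 := ((ContinuousLinearMap.mul ℝ M).flip (e s)).intervalIntegral_comp_comm
      (hec.intervalIntegrable (μ := volume) 0 r)
    change e s * S r = S r * e s
    refine h1.symm.trans (Eq.trans ?_ h2)
    exact intervalIntegral.integral_congr fun x _ => (cee s x)
  have hIu : ∀ r ∈ Icc (0 : ℝ) 1, ∀ y ∈ Icc (0 : ℝ) 1, I r y * (1 + y • (e r - 1)) = 1 :=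
    fun r hr y hy => Ring.inverse_mul_cancel _ (hu r hr y hy)
  have hdI : ∀ r ∈ Icc (0 : ℝ) 1, ∀ y ∈ Icc (0 : ℝ) 1, ∀ {g : ℝ → M} {g' : M} {x : ℝ},
      HasDerivAt g g' x → g x = 1 + y • (e r - 1) →
      HasDerivAt (fun x => Ring.inverse (g x)) (-(I r y * g' * I r y)) x := by
    intro r hr y hy g g' x hg hgx
    obtain ⟨u, hu'⟩ := hu r hr y hy
    have h1 := (hasFDerivAt_ringInverse (𝕜 := ℝ) u)
    rw [hu', ← hgx] at h1
    have h2 := h1.comp_hasDerivAt x hg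
    refine h2.congr_deriv ?_
    have hIr : I r y = ↑u⁻¹ := by
      change Ring.inverse (1 + y • (e r - 1)) = _
      rw [show 1 + y • (e r - 1) = (u : M) from hu'.symm, Ring.inverse_unit]
    simp [hIr]
  -- The double integral of I² e over the unit square is evaluated twice: in r the integrand is the
  -- derivative of I·S, in y it is the derivative of (yI)·e. The first order of integration gives
  -- the left-hand side of the claim, the second gives 1. No logarithm series is needed.
  have hcont : ContinuousOn (Function.uncurry I) (Icc 0 1 ×ˢ Icc 0 1) := by
    intro p hp
    obtain ⟨u, hu'⟩ := hu p.1 hp.1 p.2 hp.2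
    have h1 : ContinuousAt Ring.inverse (1 + p.2 • (e p.1 - 1)) := by
      rw [← hu']; exact NormedRing.inverse_continuousAt u
    have h2 : Continuous fun p : ℝ × ℝ => 1 + p.2 • (e p.1 - 1) := by fun_prop
    exact (ContinuousAt.comp (f := fun p : ℝ × ℝ => 1 + p.2 • (e p.1 - 1)) h1
      h2.continuousAt).continuousWithinAt
  have hcont' : ContinuousOn (Function.uncurry fun r y => I r y * I r y * e r)
      (Icc 0 1 ×ˢ Icc 0 1) :=
    (hcont.mul hcont).mul (hec.comp continuous_fst).continuousOn
  have hleft : ∀ y ∈ Icc (0 : ℝ) 1, ∫ r in (0 : ℝ)..1, I r y * I r y * e r = I 1 y * S 1 := by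
    intro y hy
    have hd : ∀ r ∈ uIcc (0 : ℝ) 1, HasDerivAt (fun r => I r y * S r) (I r y * I r y * e r) r := by
      intro r hr
      rw [uIcc_of_le zero_le_one] at hr
      have h1 := (hdI r hr y hy ((((hde r).sub_const 1).const_smul y).const_add 1) rfl).mul (hdS r)
      refine h1.congr_deriv ?_
      have hzI := (cIx r y z (cze r).symm).eq
      have h3 : I r y * e r = I r y * (I r y * (1 + y • (e r - 1))) * e r := by
        rw [hIu r hr y hy, mul_one]
      have h4 : I r y * (y • (z * e r)) * I r y * S r = y • (I r y * I r y * (e r - 1) * e r) := by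
        have hIe := (cIx r y (e r) (Commute.refl _)).eq
        have hIS := (cIx r y (S r) (cSe r r)).eq
        have hSe := (cSe r r).eq
        rw [mul_smul_comm, smul_mul_assoc, smul_mul_assoc, ← hzS r]
        congr 1
        calc I r y * (z * e r) * I r y * S r = I r y * z * (e r * I r y) * S r := by noncomm_ring
          _ = I r y * (z * I r y) * (e r * S r) := by rw [← hIe]; noncomm_ring
          _ = _ := by rw [← hzI, hSe]; noncomm_ring
      change -(I r y * (y • (z * e r)) * I r y) * S r + I r y * e r = _
      rw [neg_mul, h4, h3, mul_add, mul_one, mul_smul_comm, mul_add, add_mul, mul_smul_comm,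
        smul_mul_assoc]
      simp only [mul_assoc]
      abel
    rw [intervalIntegral.integral_eq_sub_of_hasDerivAt hd]
    · simp [hS]
    · refine ContinuousOn.intervalIntegrable ?_
      rw [uIcc_of_le zero_le_one]
      exact hcont'.comp (f := fun r : ℝ => (r, y)) (by fun_prop) fun r hr => ⟨hr, hy⟩
  have hright : ∀ r ∈ Icc (0 : ℝ) 1, ∫ y in (0 : ℝ)..1, I r y * I r y * e r = 1 := by
    intro r hr
    have hd : ∀ y ∈ uIcc (0 : ℝ) 1,
        HasDerivAt (fun y => (y • I r y) * e r) (I r y * I r y * e r) y := by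
      intro y hy
      rw [uIcc_of_le zero_le_one] at hy
      have h1 := ((hasDerivAt_id y).smul (hdI r hr y hy
        (((hasDerivAt_id y).smul_const (e r - 1)).const_add 1) rfl)).mul_const (e r)
      refine h1.congr_deriv ?_
      have h3 : I r y = I r y * (I r y * (1 + y • (e r - 1))) := by
        rw [hIu r hr y hy, mul_one]
      have hIe : I r y * (e r - 1) = (e r - 1) * I r y :=
        (cIx r y _ ((Commute.refl _).sub_right (Commute.one_right _))).eq
      congr 1
      change y • -(I r y * ((1 : ℝ) • (e r - 1)) * I r y) + (1 : ℝ) • I r y = _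
      rw [one_smul, one_smul]
      conv_lhs => arg 2; rw [h3]
      rw [mul_add, mul_one, mul_smul_comm, mul_add, mul_smul_comm, mul_assoc (I r y) (e r - 1),
        ← hIe, smul_neg]
      abel
    rw [intervalIntegral.integral_eq_sub_of_hasDerivAt hd]
    · have := hIu r hr 1 (by simp)
      simp only [one_smul, add_sub_cancel] at this
      simp [this]
    · refine ContinuousOn.intervalIntegrable ?_
      rw [uIcc_of_le zero_le_one]
      exact hcont'.comp (f := fun y : ℝ => (r, y)) (by fun_prop) fun y hy => ⟨hr, hy⟩
  have hswap := integral_integral_swap (continuousOn_integrable_prod hcont')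
  have e1 : ∫ r in Ioc (0 : ℝ) 1, ∫ y in Ioc (0 : ℝ) 1, I r y * I r y * e r = 1 := by
    rw [setIntegral_congr_fun (g := fun _ => (1 : M)) measurableSet_Ioc fun r hr => ?_]
    · simp
    · rw [← hright r (Ioc_subset_Icc_self hr), intervalIntegral.integral_of_le zero_le_one]
  rw [e1] at hswap
  refine Eq.trans ?_ hswap.symm
  rw [intervalIntegral.integral_of_le zero_le_one]
  refine setIntegral_congr_fun measurableSet_Ioc fun y hy => ?_
  rw [← intervalIntegral.integral_of_le zero_le_one, hleft y (Ioc_subset_Icc_self hy)]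
  simp [hI, hS, he]

end Exponential

/-! ### Power series in ε: differentiation, remainders and uniqueness of coefficients -/

section PowerSeries

variable {E : Type*} [NormedAddCommGroup E] [NormedSpace ℝ E]

lemma summable_pow_smul {c : ℕ → E} {C R ε : ℝ} (hR : 0 ≤ R) (hc : ∀ m, ‖c m‖ ≤ C * R ^ m)
    (hε : |ε| * R < 1) : Summable fun m => ‖ε ^ m • c m‖ := by
  refine Summable.of_nonneg_of_le (fun _ => norm_nonneg _) (fun m => ?_)
    ((summable_geometric_of_lt_one (by positivity) hε).mul_left C)
  rw [norm_smul, norm_pow, Real.norm_eq_abs, mul_pow]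
  exact (mul_le_mul_of_nonneg_left (hc m) (by positivity)).trans (le_of_eq (by ring))

lemma hasDerivAt_tsum_pow_smul [CompleteSpace E] {c : ℕ → E} {C R ε : ℝ} (hR : 0 < R)
    (hc : ∀ m, ‖c m‖ ≤ C * R ^ m) (hε : |ε| * R < 1) :
    HasDerivAt (fun ε : ℝ => ∑' m, ε ^ m • c m)
      (∑' m : ℕ, ε ^ m • (((m : ℝ) + 1) • c (m + 1))) ε := by
  obtain ⟨ρ, hρ1, hρ2⟩ := exists_between ((lt_div_iff₀ hR).2 hε)
  have hρ0 : 0 < ρ := (abs_nonneg ε).trans_lt hρ1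
  have hρR : ρ * R < 1 := (lt_div_iff₀ hR).1 hρ2
  have hC : 0 ≤ C := by simpa using (norm_nonneg _).trans (hc 0)
  have hu : Summable fun m : ℕ => C * R * ((m : ℝ) * (ρ * R) ^ (m - 1)) := by
    refine Summable.mul_left _ ?_
    rw [← summable_nat_add_iff 1]
    simp only [Nat.add_sub_cancel, Nat.cast_add, Nat.cast_one]
    have h1 := summable_pow_mul_geometric_of_norm_lt_one 1 (r := ρ * R)
      (by rw [Real.norm_eq_abs, abs_of_pos (by positivity)]; exact hρR)
    have h2 := summable_geometric_of_lt_one (by positivity) hρR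
    exact (h1.add h2).congr fun m => by ring
  have key := hasDerivAt_tsum_of_isPreconnected (g := fun m (x : ℝ) => x ^ m • c m)
    (g' := fun m (x : ℝ) => ((m : ℝ) * x ^ (m - 1)) • c m) hu (Metric.isOpen_ball (x := (0 : ℝ))
      (ε := ρ)) (convex_ball _ _).isPreconnected
    (fun m x _ => (hasDerivAt_pow m x).smul_const (c m)) (fun m x hx => ?_)
    (Metric.mem_ball_self hρ0) (y := ε) (summable_of_ne_finset_zero (s := {0}) fun m hm => ?_) ?_
  · convert key using 1
    have hs : Summable fun m : ℕ => ((m : ℝ) * ε ^ (m - 1)) • c m := by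
      refine Summable.of_norm_bounded hu fun m => ?_
      rw [norm_smul, norm_mul, norm_pow, Real.norm_natCast, Real.norm_eq_abs]
      cases m with
      | zero => simp
      | succ m =>
        simp only [Nat.add_sub_cancel]
        calc _ ≤ ((m + 1 : ℕ) : ℝ) * ρ ^ m * (C * R ^ (m + 1)) := by
              have := hc (m + 1); gcongr
          _ = _ := by ring
    rw [hs.tsum_eq_zero_add]
    simp only [Nat.cast_zero, zero_mul, zero_smul, zero_add, Nat.add_sub_cancel, Nat.cast_add,
      Nat.cast_one]
    exact tsum_congr fun m => by rw [smul_smul, mul_comm]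
  · rw [mem_ball_zero_iff, Real.norm_eq_abs] at hx
    rw [norm_smul, norm_mul, norm_pow, Real.norm_natCast, Real.norm_eq_abs]
    cases m with
    | zero => simp
    | succ m =>
      simp only [Nat.add_sub_cancel]
      calc _ ≤ ((m + 1 : ℕ) : ℝ) * ρ ^ m * (C * R ^ (m + 1)) := by
            have := hc (m + 1); gcongr
        _ = _ := by ring
  · simp only [Finset.mem_singleton] at hm
    simp [hm]
  · rwa [mem_ball_zero_iff, Real.norm_eq_abs]

/-- The remainder of a convergent power series. -/
lemma tsum_sub_sum_isBigO [CompleteSpace E] {c : ℕ → E} {C R : ℝ} (hR : 0 < R)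
    (hc : ∀ m, ‖c m‖ ≤ C * R ^ m) (n : ℕ) :
    (fun ε : ℝ => (∑' m, ε ^ m • c m) - ∑ m ∈ Finset.range n, ε ^ m • c m)
      =O[𝓝 0] fun ε : ℝ => ε ^ n := by
  have hC : 0 ≤ C := by simpa using (norm_nonneg _).trans (hc 0)
  refine IsBigO.of_bound (C * R ^ n * 2) ?_
  have hball : ∀ᶠ ε : ℝ in 𝓝 0, |ε| * R < 1 / 2 := by
    have : Tendsto (fun ε : ℝ => |ε| * R) (𝓝 0) (𝓝 0) := by
      have h : Continuous fun ε : ℝ => |ε| * R := by fun_prop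
      simpa using h.tendsto 0
    exact this.eventually (gt_mem_nhds (by norm_num))
  filter_upwards [hball] with ε hε
  have hs := summable_pow_smul hR.le hc (hε.trans (by norm_num))
  rw [← hs.of_norm.sum_add_tsum_nat_add n, add_sub_cancel_left]
  have hg := summable_geometric_of_lt_one (r := |ε| * R) (by positivity) (by linarith)
  refine (tsum_of_norm_bounded (hg.hasSum.mul_left (C * R ^ n * |ε| ^ n)) fun m => ?_).trans ?_
  · rw [norm_smul, norm_pow, Real.norm_eq_abs, mul_pow]
    calc _ ≤ |ε| ^ (m + n) * (C * R ^ (m + n)) := by have := hc (m + n); gcongr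
      _ = _ := by ring
  · rw [tsum_geometric_of_lt_one (by positivity) (by linarith), norm_pow, Real.norm_eq_abs]
    have : (1 - |ε| * R)⁻¹ ≤ 2 := by
      rw [inv_le_comm₀ (by linarith) (by norm_num)]; linarith
    calc _ ≤ C * R ^ n * |ε| ^ n * 2 := by gcongr
      _ = _ := by ring

/-- A polynomial of degree less than `n` that is `O(ε^n)` has no coefficients. -/
lemma coeff_eq_zero_of_isBigO {c : ℕ → E} {n : ℕ}
    (h : (fun ε : ℝ => ∑ m ∈ Finset.range n, ε ^ m • c m) =O[𝓝[>] 0] fun ε : ℝ => ε ^ n) :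
    ∀ m < n, c m = 0 := by
  induction n generalizing c with
  | zero => intro m hm; omega
  | succ n ih =>
    have hc0 : c 0 = 0 := by
      have h1 : Tendsto (fun ε : ℝ => ∑ m ∈ Finset.range (n + 1), ε ^ m • c m) (𝓝[>] 0)
          (𝓝 (c 0)) := by
        have : Continuous fun ε : ℝ => ∑ m ∈ Finset.range (n + 1), ε ^ m • c m := by fun_prop
        have h2 := (this.tendsto 0).mono_left (nhdsWithin_le_nhds (s := Ioi (0 : ℝ)))
        simpa [Finset.sum_range_succ', zero_pow] using h2
      have h3 : Tendsto (fun ε : ℝ => ε ^ (n + 1)) (𝓝[>] 0) (𝓝 0) := by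
        have := ((continuous_pow (M := ℝ) (n + 1)).tendsto 0).mono_left
          (nhdsWithin_le_nhds (s := Ioi (0 : ℝ)))
        simpa using this
      exact tendsto_nhds_unique h1 (h.trans_tendsto h3)
    have h' : (fun ε : ℝ => ∑ m ∈ Finset.range n, ε ^ m • c (m + 1)) =O[𝓝[>] 0]
        fun ε : ℝ => ε ^ n := by
      obtain ⟨K, hK⟩ := h.bound
      refine IsBigO.of_bound K ?_
      filter_upwards [hK, self_mem_nhdsWithin] with ε hε hpos
      have hpos : (0 : ℝ) < ε := hpos
      rw [Finset.sum_range_succ', hc0, smul_zero, add_zero] at hε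
      have e1 : ∑ m ∈ Finset.range n, ε ^ (m + 1) • c (m + 1)
          = ε • ∑ m ∈ Finset.range n, ε ^ m • c (m + 1) := by
        rw [Finset.smul_sum]
        exact Finset.sum_congr rfl fun m _ => by rw [smul_smul, pow_succ']
      rw [e1, norm_smul, pow_succ', norm_mul, mul_left_comm] at hε
      exact le_of_mul_le_mul_left hε (norm_pos_iff.2 hpos.ne')
    intro m hm
    cases m with
    | zero => exact hc0
    | succ m => exact ih h' m (by omega)

/-- Two power series with the same sum near zero have the same coefficients. -/
lemma coeff_eq_of_tsum_eq [CompleteSpace E] {b c : ℕ → E} {B C R : ℝ} (hR : 0 < R)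
    (hb : ∀ m, ‖b m‖ ≤ B * R ^ m) (hc : ∀ m, ‖c m‖ ≤ C * R ^ m)
    (h : ∀ᶠ ε : ℝ in 𝓝[>] 0, ∑' m, ε ^ m • b m = ∑' m, ε ^ m • c m) : b = c := by
  funext m
  rw [← sub_eq_zero]
  refine coeff_eq_zero_of_isBigO (c := fun m => b m - c m) (n := m + 1) ?_ m (by omega)
  have h1 := (tsum_sub_sum_isBigO hR hb (m + 1)).mono (nhdsWithin_le_nhds (s := Ioi (0 : ℝ)))
  have h2 := (tsum_sub_sum_isBigO hR hc (m + 1)).mono (nhdsWithin_le_nhds (s := Ioi (0 : ℝ)))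
  refine (h2.sub h1).congr' ?_ EventuallyEq.rfl
  filter_upwards [h] with ε hε
  simp only [smul_sub, Finset.sum_sub_distrib, hε]
  abel

end PowerSeries

/-! ### A local logarithm by the inverse function theorem -/

section LocalLogarithm

variable {M : Type*} [NormedRing M] [NormedAlgebra ℝ M] [CompleteSpace M]

/-- A `C¹` path through `1` has a differentiable logarithm near its start. -/
lemma exists_local_log {U : ℝ → M} (hU : ContDiff ℝ 1 U) (hU0 : U 0 = 1) :
    ∃ Y : ℝ → M, Y 0 = 0 ∧ ∀ᶠ ε in 𝓝 (0 : ℝ),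
      NormedSpace.exp (Y ε) = U ε ∧ DifferentiableAt ℝ Y ε := by
  have hcd : ContDiffAt ℝ 1 (NormedSpace.exp : M → M) 0 :=
    (NormedSpace.exp_analytic (𝕂 := ℝ) (0 : M)).contDiffAt
  have hf' : HasFDerivAt (NormedSpace.exp : M → M)
      ((ContinuousLinearEquiv.refl ℝ M : M ≃L[ℝ] M) : M →L[ℝ] M) 0 :=
    hasFDerivAt_exp_zero (𝕂 := ℝ)
  have hst := hcd.hasStrictFDerivAt' hf' one_ne_zero
  set g := hcd.localInverse hf' one_ne_zero with hg
  have hgc : ContDiffAt ℝ 1 g 1 := by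
    simpa using hcd.to_localInverse hf' one_ne_zero
  have hg1 : g 1 = 0 := by simpa using hcd.localInverse_apply_image hf' one_ne_zero
  have hri : ∀ᶠ y in 𝓝 (1 : M), NormedSpace.exp (g y) = y := by
    have h := hst.eventually_right_inverse
    rwa [NormedSpace.exp_zero] at h
  have hgd : ∀ᶠ y in 𝓝 (1 : M), DifferentiableAt ℝ g y :=
    (hgc.eventually (by simp)).mono fun y hy => hy.differentiableAt one_ne_zero
  have hUt : Tendsto U (𝓝 0) (𝓝 1) := by
    simpa [hU0] using hU.continuous.tendsto 0
  refine ⟨fun ε => g (U ε), by simp [hU0, hg1], ?_⟩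
  filter_upwards [hUt.eventually hri, hUt.eventually hgd] with ε h1 h2
  exact ⟨h1, h2.comp ε (hU.differentiable one_ne_zero ε)⟩

end LocalLogarithm

/-! ### Weighted nested products integrated over the cube -/

section Cube

variable {E : Type*} [NormedAddCommGroup E] [NormedSpace ℝ E]

/-- The nested product `a(t_n) ⋯ a(t_1) e(t_0)`. -/
def word (a : ℝ → E →L[ℝ] E) (e : ℝ → E) : (n : ℕ) → (Fin (n + 1) → ℝ) → E
  | 0, t => e (t 0)
  | n + 1, t => a (t (Fin.last (n + 1))) (word a e n fun i => t i.castSucc)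

/-- The uniform measure on the cube `[0, T]^n`. -/
abbrev cubeMeasure (n : ℕ) (T : ℝ) : Measure (Fin n → ℝ) :=
  Measure.pi fun _ => volume.restrict (Icc 0 T)

lemma cubeMeasure_eq (n : ℕ) (T : ℝ) :
    cubeMeasure n T = volume.restrict (univ.pi fun _ : Fin n => Icc 0 T) :=
  (Measure.restrict_pi_pi (fun _ => volume) _).symm

lemma measurePreserving_cube (n : ℕ) (T : ℝ) :
    MeasurePreserving (MeasurableEquiv.piFinSuccAbove (fun _ : Fin (n + 1) => ℝ) (Fin.last n))
      (cubeMeasure (n + 1) T) ((volume.restrict (Icc 0 T)).prod (cubeMeasure n T)) :=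
  measurePreserving_piFinSuccAbove (fun _ : Fin (n + 1) => volume.restrict (Icc 0 T)) (Fin.last n)

lemma piFinSuccAbove_last (n : ℕ) (t : Fin (n + 1) → ℝ) :
    MeasurableEquiv.piFinSuccAbove (fun _ : Fin (n + 1) => ℝ) (Fin.last n) t
      = (t (Fin.last n), fun i => t i.castSucc) := by
  simp [MeasurableEquiv.piFinSuccAbove, Fin.insertNthEquiv]
  rfl

lemma integral_cube_succ (n : ℕ) (T : ℝ) (g : ℝ → (Fin n → ℝ) → E) :
    ∫ t, g (t (Fin.last n)) (fun i => t i.castSucc) ∂(cubeMeasure (n + 1) T)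
      = ∫ p, g p.1 p.2 ∂((volume.restrict (Icc 0 T)).prod (cubeMeasure n T)) := by
  rw [← (measurePreserving_cube n T).integral_comp']
  simp only [piFinSuccAbove_last]

lemma integrable_cube_succ (n : ℕ) (T : ℝ) {g : ℝ → (Fin n → ℝ) → E}
    (hg : Integrable (fun p : ℝ × (Fin n → ℝ) => g p.1 p.2)
      ((volume.restrict (Icc 0 T)).prod (cubeMeasure n T))) :
    Integrable (fun t => g (t (Fin.last n)) (fun i => t i.castSucc)) (cubeMeasure (n + 1) T) := by
  have := (measurePreserving_cube n T).integrable_comp_of_integrable hg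
  simpa only [Function.comp_def, piFinSuccAbove_last] using this

lemma integral_cube_one (T : ℝ) (g : ℝ → E) :
    ∫ t, g (t 0) ∂(cubeMeasure 1 T) = ∫ s in Icc 0 T, g s :=
  (measurePreserving_funUnique (volume.restrict (Icc 0 T)) (Fin 1)).integral_comp' g

lemma integrable_cube_one (T : ℝ) {g : ℝ → E} (hg : IntegrableOn g (Icc 0 T)) :
    Integrable (fun t => g (t 0)) (cubeMeasure 1 T) :=
  (measurePreserving_funUnique (volume.restrict (Icc 0 T)) (Fin 1)).integrable_comp_of_integrable hg

variable {a : ℝ → E →L[ℝ] E} {e : ℝ → E} {T : ℝ}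

lemma integrable_clm_apply_prod {β : Type*} [MeasurableSpace β] {μ : Measure ℝ} {ν : Measure β}
    {g : β → E} (ha : Integrable a μ) (hg : Integrable g ν) :
    Integrable (fun p : ℝ × β => a p.1 (g p.2)) (μ.prod ν) :=
  ha.op_fst_snd (op := fun (L : E →L[ℝ] E) x => L x)
    (by unfold Function.uncurry; fun_prop) ⟨1, fun x y => by simpa using x.le_opNorm y⟩ hg

lemma word_integrable (ha : IntegrableOn a (Icc 0 T)) (he : IntegrableOn e (Icc 0 T)) (n : ℕ) :
    Integrable (word a e n) (cubeMeasure (n + 1) T) := by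
  induction n with
  | zero => exact integrable_cube_one T he
  | succ n ih =>
    exact integrable_cube_succ (n + 1) T (g := fun s t => a s (word a e n t))
      (integrable_clm_apply_prod ha ih)

/-- The weight of one step of a chain of times: `x` for an ascent and `x - 1` for a descent. -/
def stepWeight (x r s : ℝ) : ℝ := if r ≤ s then x else x - 1

/-- The weight `x ^ (number of ascents) * (x - 1) ^ (number of descents)` of a chain of times. -/
def chainWeight (x : ℝ) (n : ℕ) (t : Fin (n + 1) → ℝ) : ℝ :=
  ∏ i : Fin n, stepWeight x (t i.castSucc) (t i.succ)

lemma chainWeight_succ (x : ℝ) (n : ℕ) (t : Fin (n + 2) → ℝ) :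
    chainWeight x (n + 1) t = chainWeight x n (fun i => t i.castSucc)
      * stepWeight x (t (Fin.last n).castSucc) (t (Fin.last (n + 1))) := by
  simp only [chainWeight]
  rw [Fin.prod_univ_castSucc]
  rfl

lemma measurable_stepWeight (x : ℝ) : Measurable fun p : ℝ × ℝ => stepWeight x p.1 p.2 :=
  Measurable.ite (measurableSet_le measurable_fst measurable_snd) measurable_const measurable_const

lemma measurable_chainWeight (x : ℝ) (n : ℕ) : Measurable (chainWeight x n) :=
  Finset.measurable_prod _ fun i _ => (measurable_stepWeight x).comp
    (g := fun p : ℝ × ℝ => stepWeight x p.1 p.2)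
    (f := fun t : Fin (n + 1) → ℝ => (t i.castSucc, t i.succ))
    ((measurable_pi_apply _).prodMk (measurable_pi_apply _))

lemma abs_stepWeight_le {x : ℝ} (hx : x ∈ Icc (0 : ℝ) 1) (r s : ℝ) : |stepWeight x r s| ≤ 1 := by
  unfold stepWeight
  split_ifs <;> rw [abs_le] <;> constructor <;> linarith [hx.1, hx.2]

lemma abs_chainWeight_le {x : ℝ} (hx : x ∈ Icc (0 : ℝ) 1) (n : ℕ) (t : Fin (n + 1) → ℝ) :
    |chainWeight x n t| ≤ 1 := by
  rw [chainWeight, Finset.abs_prod]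
  exact Finset.prod_le_one (fun _ _ => abs_nonneg _) fun i _ => abs_stepWeight_le hx _ _

/-- `K_0(t) = ∫_0^t e`, `K_{n+1}(t) = ∫_0^t a(s) ((x - 1) K_n(T) + K_n(s)) ds`. -/
def chain (a : ℝ → E →L[ℝ] E) (e : ℝ → E) (x T : ℝ) : ℕ → ℝ → E
  | 0 => fun t => ∫ s in (0 : ℝ)..t, e s
  | n + 1 => fun t => ∫ s in (0 : ℝ)..t, a s ((x - 1) • chain a e x T n T + chain a e x T n s)

/-- The integrand in the definition of `chain`. -/
def chainDensity (a : ℝ → E →L[ℝ] E) (e : ℝ → E) (x T : ℝ) : ℕ → ℝ → E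
  | 0 => e
  | n + 1 => fun s => a s ((x - 1) • chain a e x T n T + chain a e x T n s)

lemma chain_eq_integral (x : ℝ) (n : ℕ) (t : ℝ) :
    chain a e x T n t = ∫ s in (0 : ℝ)..t, chainDensity a e x T n s := by
  cases n <;> rfl

lemma chain_isPrimitive (hT : 0 ≤ T) (ha : IntervalIntegrable a volume 0 T)
    (he : IntervalIntegrable e volume 0 T) (x : ℝ) (n : ℕ) :
    IsPrimitive T (chain a e x T n) (chainDensity a e x T n) := by
  induction n with
  | zero => exact isPrimitive_integral he
  | succ n ih =>
    exact isPrimitive_integral (intervalIntegrable_clm_apply hT ha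
      (continuousOn_const.add (ih.continuousOn hT)))

lemma chain_norm_le (hT : 0 ≤ T) (ha : IntervalIntegrable a volume 0 T)
    (he : IntervalIntegrable e volume 0 T) {x : ℝ} (hx : x ∈ Icc (0 : ℝ) 1) (n : ℕ) {t : ℝ}
    (ht : t ∈ Icc 0 T) :
    ‖chain a e x T n t‖
      ≤ (∫ s in (0 : ℝ)..T, ‖e s‖) * (2 * ∫ s in (0 : ℝ)..T, ‖a s‖) ^ n := by
  have hmono : ∀ {b : ℝ → ℝ}, (∀ s, 0 ≤ b s) → IntervalIntegrable b volume 0 T → ∀ t ∈ Icc 0 T,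
      ∫ s in (0 : ℝ)..t, b s ≤ ∫ s in (0 : ℝ)..T, b s := fun hb hi t ht =>
    intervalIntegral.integral_mono_interval le_rfl ht.1 ht.2 (Eventually.of_forall hb) hi
  induction n generalizing t with
  | zero =>
    have := (chain_isPrimitive hT ha he x 0).norm_sub_le he.norm (fun s _ => le_rfl) ht
    simp only [chain, intervalIntegral.integral_same, sub_zero, pow_zero, mul_one] at this ⊢
    exact this.trans (hmono (fun _ => norm_nonneg _) he.norm t ht)
  | succ n ih =>
    set B := (∫ s in (0 : ℝ)..T, ‖e s‖) * (2 * ∫ s in (0 : ℝ)..T, ‖a s‖) ^ n with hB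
    have h := (chain_isPrimitive hT ha he x (n + 1)).norm_sub_le (b := fun s => ‖a s‖ * (2 * B))
      (ha.norm.mul_const _) (fun s hs => by
        refine ((a s).le_opNorm _).trans (mul_le_mul_of_nonneg_left ?_ (norm_nonneg _))
        refine (norm_add_le _ _).trans ?_
        rw [norm_smul, Real.norm_eq_abs]
        have h1 : |x - 1| ≤ 1 := by rw [abs_le]; constructor <;> linarith [hx.1, hx.2]
        have h2 := ih (t := T) ⟨hT, le_rfl⟩
        have h3 := ih hs
        have h4 := mul_le_mul h1 h2 (norm_nonneg _) zero_le_one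
        linarith) ht
    have h0 : chain a e x T (n + 1) 0 = 0 := by simp [chain]
    rw [h0, sub_zero] at h
    have hB0 : 0 ≤ B := (norm_nonneg _).trans (ih ht)
    refine h.trans ((hmono (fun s => by positivity) (ha.norm.mul_const _) t ht).trans (le_of_eq ?_))
    rw [intervalIntegral.integral_mul_const, hB]
    ring

/-- The weight is (x - 1) plus the indicator of r ≤ s. This splits one step of the cube integral
into a value at T and a value at s, which is the shape of the recursion for `chain`. -/
lemma integral_stepWeight_smul {g : ℝ → E} (hg : IntegrableOn g (Icc 0 T)) (x : ℝ) {s : ℝ}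
    (hs : s ∈ Icc 0 T) :
    ∫ r in Icc 0 T, stepWeight x r s • g r
      = (x - 1) • (∫ r in (0 : ℝ)..T, g r) + ∫ r in (0 : ℝ)..s, g r := by
  have h1 : ∀ r, stepWeight x r s • g r = (x - 1) • g r + (Iic s).indicator g r := by
    intro r
    by_cases h : r ≤ s
    · simp only [stepWeight, h, if_true, indicator, mem_Iic]; module
    · simp only [stepWeight, h, if_false, indicator, mem_Iic]; module
  have hgx : IntegrableOn (fun r => (x - 1) • g r) (Icc 0 T) := hg.smul (x - 1)
  simp_rw [h1]
  rw [integral_add hgx (hg.indicator measurableSet_Iic), integral_smul,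
    integral_indicator measurableSet_Iic, Measure.restrict_restrict measurableSet_Iic,
    intervalIntegral.integral_of_le (hs.1.trans hs.2), intervalIntegral.integral_of_le hs.1,
    integral_Icc_eq_integral_Ioc, ← integral_Icc_eq_integral_Ioc (x := 0) (y := s)]
  congr 3
  ext r
  simp only [mem_inter_iff, mem_Iic, mem_Icc]
  constructor
  · rintro ⟨h2, h3, -⟩; exact ⟨h3, h2⟩
  · rintro ⟨h2, h3⟩; exact ⟨h3, h2, h3.trans hs.2⟩

/-- The integral of `a(t_n) ⋯ a(t_1) e(t_0)` over the cube, weighted by `chainWeight`. -/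
lemma integral_chainWeight_smul_word [CompleteSpace E] (hT : 0 ≤ T)
    (ha : IntervalIntegrable a volume 0 T) (he : IntervalIntegrable e volume 0 T) {x : ℝ}
    (hx : x ∈ Icc (0 : ℝ) 1) (n : ℕ) {h : ℝ → ℝ} (hm : Measurable h) (hb : ∀ s, |h s| ≤ 1) :
    ∫ t, (h (t (Fin.last n)) * chainWeight x n t) • word a e n t ∂(cubeMeasure (n + 1) T)
      = ∫ s in Icc 0 T, h s • chainDensity a e x T n s := by
  have ha' := (intervalIntegrable_iff_integrableOn_Icc_of_le hT).1 ha
  have he' := (intervalIntegrable_iff_integrableOn_Icc_of_le hT).1 he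
  induction n generalizing h with
  | zero =>
    simp only [chainWeight, Finset.univ_eq_empty, Finset.prod_empty, mul_one]
    exact integral_cube_one T (fun s => h s • e s)
  | succ n ih =>
    have hw := word_integrable ha' he' n
    have hprod := integrable_clm_apply_prod ha' hw
    set G : ℝ → (Fin (n + 1) → ℝ) → E := fun s t =>
      (h s * (chainWeight x n t * stepWeight x (t (Fin.last n)) s)) • a s (word a e n t) with hG
    have hGi : Integrable (fun p : ℝ × (Fin (n + 1) → ℝ) => G p.1 p.2)
        ((volume.restrict (Icc 0 T)).prod (cubeMeasure (n + 1) T)) := by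
      refine hprod.bdd_smul 1 ?_ (Eventually.of_forall fun p => ?_)
      · refine Measurable.aestronglyMeasurable ?_
        refine (hm.comp measurable_fst).mul (((measurable_chainWeight x n).comp
          measurable_snd).mul ((measurable_stepWeight x).comp (Measurable.prodMk ?_
            measurable_fst)))
        exact (measurable_pi_apply _).comp measurable_snd
      · rw [Real.norm_eq_abs, abs_mul, abs_mul]
        exact mul_le_one₀ (hb _) (by positivity)
          (mul_le_one₀ (abs_chainWeight_le hx n _) (abs_nonneg _) (abs_stepWeight_le hx _ _))
    have e1 : ∀ t : Fin (n + 2) → ℝ,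
        (h (t (Fin.last (n + 1))) * chainWeight x (n + 1) t) • word a e (n + 1) t
          = G (t (Fin.last (n + 1))) (fun i => t i.castSucc) := by
      intro t
      rw [chainWeight_succ]
      rfl
    simp_rw [e1]
    rw [integral_cube_succ (n + 1) T G, integral_prod _ hGi]
    refine setIntegral_congr_fun measurableSet_Icc fun s hs => ?_
    have e2 : ∀ t, G s t = h s • a s ((stepWeight x (t (Fin.last n)) s * chainWeight x n t)
        • word a e n t) := fun t => by
      rw [hG]
      simp only [map_smul, smul_smul]
      ring_nf
    have hwi : Integrable (fun t => (stepWeight x (t (Fin.last n)) s * chainWeight x n t)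
        • word a e n t) (cubeMeasure (n + 1) T) := by
      refine hw.bdd_smul 1 ?_ (Eventually.of_forall fun t => ?_)
      · exact (((measurable_stepWeight x).comp ((measurable_pi_apply _).prodMk
          measurable_const)).mul (measurable_chainWeight x n)).aestronglyMeasurable
      · rw [Real.norm_eq_abs, abs_mul]
        exact mul_le_one₀ (abs_stepWeight_le hx _ _) (abs_nonneg _) (abs_chainWeight_le hx n _)
    -- The induction keeps a general bounded factor h of the last time so that it can now be the
    -- weight of the step from that time to s.
    simp_rw [e2]
    rw [integral_smul, (a s).integral_comp_comm hwi,
      ih (h := fun r => stepWeight x r s)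
        ((measurable_stepWeight x).comp (measurable_id.prodMk measurable_const))
        (fun r => abs_stepWeight_le hx r s),
      integral_stepWeight_smul ((intervalIntegrable_iff_integrableOn_Icc_of_le hT).1
        (chain_isPrimitive hT ha he x n).integrable) x hs,
      ← chain_eq_integral, ← chain_eq_integral]
    rfl

end Cube

/-! ### From the cube to sums over permutations of ordered times -/

section Symmetrization

variable {E : Type*} [NormedAddCommGroup E] [NormedSpace ℝ E]

lemma measurableSet_orderedTimes (n : ℕ) (T : ℝ) : MeasurableSet (orderedTimes n T) := by
  have : orderedTimes n T = (⋂ i, {t : Fin n → ℝ | t i ∈ Icc 0 T}) ∩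
      ⋂ i, ⋂ j, {t : Fin n → ℝ | i ≤ j → t i ≤ t j} := by
    ext t; simp [orderedTimes, Monotone]
  rw [this]
  refine (MeasurableSet.iInter fun i => measurable_pi_apply i measurableSet_Icc).inter
    (MeasurableSet.iInter fun i => MeasurableSet.iInter fun j => ?_)
  by_cases hij : i ≤ j
  · simpa [hij] using measurableSet_le (measurable_pi_apply i) (measurable_pi_apply j)
  · simp [hij]

/-- Each coincidence t_i = t_j is a proper subspace, hence null. Away from coincidences the sorting
permutation is unique and weak order is strict order. -/
lemma ae_injective (n : ℕ) : ∀ᵐ t : Fin n → ℝ, Function.Injective t := by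
  have h : ∀ i j : Fin n, i ≠ j → ∀ᵐ t : Fin n → ℝ, t i ≠ t j := by
    intro i j hij
    set L : (Fin n → ℝ) →ₗ[ℝ] ℝ := 
      (LinearMap.proj i : (Fin n → ℝ) →ₗ[ℝ] ℝ) - (LinearMap.proj j : (Fin n → ℝ) →ₗ[ℝ] ℝ)
    have hL : LinearMap.ker L ≠ ⊤ := by
      intro h
      have h1 : L (Pi.single i 1) = 0 := LinearMap.mem_ker.1 (h ▸ Submodule.mem_top)
      simp [L, hij] at h1
    have := Measure.addHaar_submodule volume (LinearMap.ker L) hL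
    rw [ae_iff]
    convert this using 2
    ext t
    simp [L, sub_eq_zero]
  have h' : ∀ᵐ t : Fin n → ℝ, ∀ i j : Fin n, i ≠ j → t i ≠ t j := by
    rw [ae_all_iff]; intro i
    rw [ae_all_iff]; intro j
    by_cases hij : i = j
    · simp [hij]
    · simpa [hij] using h i j hij
  filter_upwards [h'] with t ht i j hij
  by_contra hne
  exact ht i j hne hij

lemma measurePreserving_comp_perm {n : ℕ} (σ : Equiv.Perm (Fin n)) :
    MeasurePreserving (MeasurableEquiv.piCongrLeft (fun _ : Fin n => ℝ) σ) volume volume :=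
  volume_measurePreserving_piCongrLeft (fun _ : Fin n => ℝ) σ

lemma piCongrLeft_eq_comp {n : ℕ} (σ : Equiv.Perm (Fin n)) (t : Fin n → ℝ) :
    MeasurableEquiv.piCongrLeft (fun _ : Fin n => ℝ) σ t = fun i => t (σ.symm i) := by
  funext i
  obtain ⟨j, rfl⟩ := σ.surjective i
  simp [MeasurableEquiv.piCongrLeft]

lemma setIntegral_orderedTimes_comp {n : ℕ} (T : ℝ) (σ : Equiv.Perm (Fin n))
    (G : (Fin n → ℝ) → E) :
    ∫ t in orderedTimes n T, G (fun i => t (σ i))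
      = ∫ t, ((fun t : Fin n → ℝ => fun i => t (σ.symm i)) ⁻¹' orderedTimes n T).indicator G t := by
  rw [← integral_indicator (measurableSet_orderedTimes n T),
    ← (measurePreserving_comp_perm σ).integral_comp']
  refine integral_congr_ae (Eventually.of_forall fun t => ?_)
  beta_reduce
  rw [piCongrLeft_eq_comp]
  simp only [indicator, Equiv.symm_apply_apply]
  rfl

/-- A point of the cube with distinct coordinates is put in increasing order by exactly one
permutation, so exactly one summand survives. -/
lemma sum_indicator_orderedTimes {n : ℕ} (T : ℝ) (G : (Fin n → ℝ) → E) {t : Fin n → ℝ}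
    (ht : Function.Injective t) :
    ∑ σ : Equiv.Perm (Fin n),
      ((fun t : Fin n → ℝ => fun i => t (σ.symm i)) ⁻¹' orderedTimes n T).indicator G t
      = (univ.pi fun _ : Fin n => Icc 0 T).indicator G t := by
  by_cases hc : t ∈ univ.pi fun _ : Fin n => Icc 0 T
  · rw [indicator_of_mem hc, Finset.sum_eq_single (Tuple.sort t).symm]
    · rw [indicator_of_mem]
      exact ⟨fun i => hc _ (mem_univ _), Tuple.monotone_sort t⟩
    · intro σ _ hσ
      rw [indicator_of_notMem]
      intro h
      have h1 := Tuple.unique_monotone (f := t) (σ := σ.symm) (τ := Tuple.sort t) h.2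
        (Tuple.monotone_sort t)
      have h2 : σ.symm = Tuple.sort t := Equiv.ext fun i => ht (congrFun h1 i)
      exact hσ (by rw [← h2]; rfl)
    · simp
  · rw [indicator_of_notMem hc]
    refine Finset.sum_eq_zero fun σ _ => indicator_of_notMem (fun h => hc fun i _ => ?_) _
    simpa using h.1 (σ i)

/-- Integration over the cube as a sum of integrals over the ordered times. -/
lemma sum_setIntegral_orderedTimes {n : ℕ} {T : ℝ} {G : (Fin n → ℝ) → E}
    (hG : Integrable G (cubeMeasure n T)) :
    ∑ σ : Equiv.Perm (Fin n), ∫ t in orderedTimes n T, G (fun i => t (σ i))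
      = ∫ t, G t ∂(cubeMeasure n T) := by
  have hcube : MeasurableSet (univ.pi fun _ : Fin n => Icc (0 : ℝ) T) :=
    MeasurableSet.univ_pi fun _ => measurableSet_Icc
  have hperm : ∀ σ : Equiv.Perm (Fin n),
      MeasurableSet ((fun t : Fin n → ℝ => fun i => t (σ.symm i)) ⁻¹' orderedTimes n T) := fun σ =>
    (measurable_pi_lambda _ fun i => measurable_pi_apply _) (measurableSet_orderedTimes n T)
  rw [cubeMeasure_eq] at hG ⊢
  simp_rw [setIntegral_orderedTimes_comp]
  rw [← integral_finsetSum _ fun σ _ => ?_]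
  · rw [← integral_indicator hcube]
    refine integral_congr_ae ?_
    filter_upwards [ae_injective n] with t ht
    exact sum_indicator_orderedTimes T G ht
  · rw [integrable_indicator_iff (hperm σ)]
    refine IntegrableOn.mono_set hG fun t ht i _ => ?_
    simpa using ht.1 (σ i)

/-- Along strictly increasing times, the chain t(σ i) rises exactly where σ does; the weight is
therefore constant on each simplex of the cube. -/
lemma chainWeight_comp_perm {n : ℕ} (x : ℝ) (σ : Equiv.Perm (Fin (n + 1))) {t : Fin (n + 1) → ℝ}
    (ht : StrictMono t) :
    chainWeight x n (fun i => t (σ i)) = x ^ ascents σ * (x - 1) ^ (n - ascents σ) := by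
  have h1 : ∀ i : Fin n, t (σ i.castSucc) ≤ t (σ i.succ) ↔ σ i.castSucc < σ i.succ := by
    intro i
    rw [ht.le_iff_le]
    refine ⟨fun h => lt_of_le_of_ne h fun h' => ?_, le_of_lt⟩
    exact absurd (σ.injective h') (Fin.castSucc_lt_succ (i := i)).ne
  simp only [chainWeight, stepWeight, h1]
  rw [Finset.prod_ite, Finset.prod_const, Finset.prod_const]
  congr 2
  have := Finset.card_filter_add_card_filter_not (s := (Finset.univ : Finset (Fin n)))
    (fun i : Fin n => σ i.castSucc < σ i.succ)
  rw [Finset.card_univ, Fintype.card_fin] at this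
  rw [ascents]
  omega

lemma ascents_le {n : ℕ} (σ : Equiv.Perm (Fin (n + 1))) : ascents σ ≤ n := by
  refine (Finset.card_filter_le _ _).trans ?_
  simp

variable {a : ℝ → E →L[ℝ] E} {e : ℝ → E} {T : ℝ}

lemma chain_eq_sum_perm [CompleteSpace E] (hT : 0 ≤ T)
    (ha : IntervalIntegrable a volume 0 T) (he : IntervalIntegrable e volume 0 T) {x : ℝ}
    (hx : x ∈ Icc (0 : ℝ) 1) (n : ℕ) :
    chain a e x T n T = ∑ σ : Equiv.Perm (Fin (n + 1)), (x ^ ascents σ * (x - 1) ^ (n - ascents σ))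
      • ∫ t in orderedTimes (n + 1) T, word a e n (fun i => t (σ i)) := by
  have ha' := (intervalIntegrable_iff_integrableOn_Icc_of_le hT).1 ha
  have he' := (intervalIntegrable_iff_integrableOn_Icc_of_le hT).1 he
  have h1 := integral_chainWeight_smul_word hT ha he hx n (h := fun _ => 1) measurable_const
    (by simp)
  simp only [one_mul, one_smul] at h1
  rw [integral_Icc_eq_integral_Ioc, ← intervalIntegral.integral_of_le hT,
    ← chain_eq_integral] at h1
  have hint : Integrable (fun t => chainWeight x n t • word a e n t) (cubeMeasure (n + 1) T) :=
    (word_integrable ha' he' n).bdd_smul 1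
      (measurable_chainWeight x n).aestronglyMeasurable
      (Eventually.of_forall fun t => abs_chainWeight_le hx n t)
  rw [← h1, ← sum_setIntegral_orderedTimes hint]
  refine Finset.sum_congr rfl fun σ _ => ?_
  rw [← integral_smul]
  refine setIntegral_congr_ae (measurableSet_orderedTimes _ _) ?_
  filter_upwards [ae_injective (n + 1)] with t ht hmem
  rw [chainWeight_comp_perm x σ (hmem.2.strictMono_of_injective ht)]

/-- The `n`-th term of the Magnus expansion, with values in a module. -/
def magnusTerm (a : ℝ → E →L[ℝ] E) (e : ℝ → E) (T : ℝ) (n : ℕ) : E :=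
  (1 / ((n : ℝ) + 1) ^ 2) • ∑ σ : Equiv.Perm (Fin (n + 1)),
    ((-1 : ℝ) ^ (n - ascents σ) *
        (((ascents σ).factorial : ℝ) * ((n - ascents σ).factorial : ℝ) / (n.factorial : ℝ))) •
      ∫ t in orderedTimes (n + 1) T, word a e n (fun i => t (σ i))

lemma integral_pow_mul_sub_one_pow (p q : ℕ) :
    ∫ x in (0 : ℝ)..1, x ^ p * (x - 1) ^ q
      = (-1) ^ q * ((p.factorial : ℝ) * q.factorial / (p + q + 1).factorial) := by
  induction q generalizing p with
  | zero =>
    have : ((p + 0 + 1).factorial : ℝ) = (p + 1) * p.factorial := by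
      rw [add_zero, Nat.factorial_succ]; push_cast; ring
    simp only [pow_zero, mul_one, integral_pow, this]
    have := Nat.factorial_pos p
    field_simp
    simp
  | succ q ih =>
    have hp : ∀ x : ℝ, HasDerivAt (fun x : ℝ => x ^ (p + 1) / (p + 1)) (x ^ p) x := fun x => by
      have := (hasDerivAt_pow (p + 1) x).div_const ((p : ℝ) + 1)
      refine this.congr_deriv ?_
      push_cast
      field_simp
    have hq : ∀ x : ℝ, HasDerivAt (fun x : ℝ => (x - 1) ^ (q + 1)) ((q + 1) * (x - 1) ^ q) x :=
      fun x => (((hasDerivAt_id x).sub_const 1).pow (q + 1)).congr_deriv (by simp)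
    have := intervalIntegral.integral_mul_deriv_eq_deriv_mul (a := 0) (b := 1)
      (fun x _ => hq x) (fun x _ => hp x)
      (Continuous.intervalIntegrable (by fun_prop) _ _)
      (Continuous.intervalIntegrable (by fun_prop) _ _)
    have e1 : ∫ x in (0 : ℝ)..1, x ^ p * (x - 1) ^ (q + 1)
        = ∫ x in (0 : ℝ)..1, (x - 1) ^ (q + 1) * x ^ p := by
      congr 1; funext x; ring
    have e2 : ∫ x in (0 : ℝ)..1, ((q : ℝ) + 1) * (x - 1) ^ q * (x ^ (p + 1) / (p + 1))
        = ((q : ℝ) + 1) / (p + 1) * ∫ x in (0 : ℝ)..1, x ^ (p + 1) * (x - 1) ^ q := by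
      rw [← intervalIntegral.integral_const_mul]
      congr 1; funext x; ring
    rw [e1, this, e2, ih (p + 1)]
    simp only [sub_self, ne_eq, Nat.add_eq_zero_iff, one_ne_zero, and_false, not_false_eq_true,
      zero_pow, zero_mul, zero_sub, zero_div, mul_zero]
    rw [show p + 1 + q + 1 = p + (q + 1) + 1 by ring, Nat.factorial_succ p, Nat.factorial_succ q]
    push_cast
    field_simp
    ring

/-- The Magnus weights are Beta integrals: (n+1)·(n+1)⁻²·θ!(n-θ)!/n! equals θ!(n-θ)!/(n+1)!, the
integral of x^θ(1-x)^{n-θ}. The sign (-1)^{n-θ} is absorbed in (x-1)^{n-θ}. -/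
lemma smul_magnusTerm_eq_integral [CompleteSpace E] (hT : 0 ≤ T)
    (ha : IntervalIntegrable a volume 0 T) (he : IntervalIntegrable e volume 0 T) (n : ℕ) :
    ((n : ℝ) + 1) • magnusTerm a e T n = ∫ x in (0 : ℝ)..1, chain a e x T n T := by
  have h1 : ∫ x in (0 : ℝ)..1, chain a e x T n T
      = ∫ x in (0 : ℝ)..1, ∑ σ : Equiv.Perm (Fin (n + 1)),
        (x ^ ascents σ * (x - 1) ^ (n - ascents σ))
          • ∫ t in orderedTimes (n + 1) T, word a e n (fun i => t (σ i)) := by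
    refine intervalIntegral.integral_congr fun x hx => ?_
    rw [uIcc_of_le zero_le_one] at hx
    exact chain_eq_sum_perm hT ha he hx n
  rw [h1, intervalIntegral.integral_finsetSum]
  · rw [magnusTerm, smul_smul, Finset.smul_sum]
    refine Finset.sum_congr rfl fun σ _ => ?_
    rw [intervalIntegral.integral_smul_const, integral_pow_mul_sub_one_pow, smul_smul]
    congr 1
    have hσ := ascents_le σ
    rw [show ascents σ + (n - ascents σ) + 1 = n + 1 by omega, Nat.factorial_succ]
    push_cast
    field_simp
  · intro σ _
    exact Continuous.intervalIntegrable (by fun_prop) _ _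

end Symmetrization

/-! ### Inverting (e^{ad Y} - 1)/ad Y by averaging over x -/

section MagnusIdentity

variable {M : Type*} [NormedRing M] [NormedAlgebra ℝ M] [CompleteSpace M]

lemma tsum_pow_smul_mul_tsum_pow_smul {b c : ℕ → M} {ε : ℝ}
    (hb : Summable fun m => ‖ε ^ m • b m‖) (hc : Summable fun m => ‖ε ^ m • c m‖) :
    (∑' m, ε ^ m • b m) * (∑' m, ε ^ m • c m)
      = ∑' m, ε ^ m • ∑ p ∈ Finset.HasAntidiagonal.antidiagonal m, b p.1 * c p.2 := by
  rw [tsum_mul_tsum_eq_tsum_sum_antidiagonal_of_summable_norm hb hc]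
  refine tsum_congr fun m => ?_
  rw [Finset.smul_sum]
  refine Finset.sum_congr rfl fun p hp => ?_
  rw [Finset.HasAntidiagonal.mem_antidiagonal] at hp
  rw [smul_mul_smul_comm, ← pow_add, hp]

/-- The conjugation flow generated by a commutator. -/
lemma exp_smul_adL_apply (Y X : M) (s : ℝ) :
    NormedSpace.exp (s • adL Y) X = NormedSpace.exp (s • Y) * X * NormedSpace.exp (-(s • Y)) := by
  set φ : ℝ → M := fun s => NormedSpace.exp (s • -(adL Y))
    (NormedSpace.exp (s • Y) * X * NormedSpace.exp (s • -Y)) with hφ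
  have hd : ∀ s, HasDerivAt φ 0 s := by
    intro s
    have h1 := hasDerivAt_exp_smul_const (𝕂 := ℝ) (-(adL Y)) s
    have h2 := ((hasDerivAt_exp_smul_const' (𝕂 := ℝ) Y s).mul_const X).mul
      (hasDerivAt_exp_smul_const (𝕂 := ℝ) (-Y) s)
    refine (h1.clm_apply h2).congr_deriv ?_
    rw [mul_apply_eq_comp, ← map_add]
    convert map_zero (NormedSpace.exp (s • -(adL Y)))
    simp only [neg_apply, adL_apply, Pi.mul_apply]
    noncomm_ring
  have hconst : φ s = φ 0 := is_const_of_deriv_eq_zero (fun s => (hd s).differentiableAt)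
    (fun s => (hd s).deriv) s 0
  have h0 : φ 0 = X := by simp [hφ]
  have h3 : NormedSpace.exp (s • adL Y) (φ s)
      = NormedSpace.exp (s • Y) * X * NormedSpace.exp (-(s • Y)) := by
    simp only [hφ, smul_neg]
    rw [← mul_apply_eq_comp, exp_mul_exp_neg]
    rfl
  rw [← h3, hconst, h0]

/-- If `z = ∫_0^1 e^{sY} v e^{-sY} ds` then `∫_0^1 (1 + y (e^{ad Y} - 1))⁻¹ z dy = v`. -/
lemma integral_inverse_apply {Y v z : M} {Γ : ℝ → M}
    (hu : ∀ r ∈ Icc (0 : ℝ) 1, ∀ y ∈ Icc (0 : ℝ) 1,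
      IsUnit (1 + y • (NormedSpace.exp (r • adL Y) - 1)))
    (hz : z = ∫ s in (0 : ℝ)..1, NormedSpace.exp (s • Y) * v * NormedSpace.exp (-(s • Y)))
    (hΓ : ∀ x ∈ Icc (0 : ℝ) 1, (x • Γ x - z) * NormedSpace.exp Y
      = (x - 1) • (NormedSpace.exp Y * Γ x)) :
    ∫ x in (0 : ℝ)..1, Γ x = v := by
  set F : M →L[ℝ] M := ∫ s in (0 : ℝ)..1, NormedSpace.exp (s • adL Y) with hF
  have hec : Continuous fun s : ℝ => NormedSpace.exp (s • adL Y) := by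
    have := continuous_exp_real (M := M →L[ℝ] M)
    fun_prop
  have hFv : F v = z := by
    have h1 := (ContinuousLinearMap.apply ℝ M v).intervalIntegral_comp_comm
      (hec.intervalIntegrable (μ := volume) 0 1)
    rw [hz]
    refine h1.symm.trans (intervalIntegral.integral_congr fun s _ => ?_)
    exact exp_smul_adL_apply Y v s
  have hone := integral_inverse_mul_integral_exp (adL Y) hu
  set W : ℝ → M →L[ℝ] M := fun y => Ring.inverse (1 + y • (NormedSpace.exp (adL Y) - 1)) with hW
  have hu1 : ∀ y ∈ Icc (0 : ℝ) 1, IsUnit (1 + y • (NormedSpace.exp (adL Y) - 1)) := fun y hy => by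
    simpa using hu 1 (by simp) y hy
  have hΓW : ∀ x ∈ Icc (0 : ℝ) 1, Γ x = W (1 - x) z := by
    intro x hx
    have hy : 1 - x ∈ Icc (0 : ℝ) 1 := ⟨by linarith [hx.2], by linarith [hx.1]⟩
    -- Multiplying `hΓ` on the right by e^{-Y} gives z = xΓ + (1 - x)e^{ad Y}Γ.
    have h1 : (1 + (1 - x) • (NormedSpace.exp (adL Y) - 1) : M →L[ℝ] M) (Γ x) = z := by
      have h2 : NormedSpace.exp (adL Y) (Γ x)
          = NormedSpace.exp Y * Γ x * NormedSpace.exp (-Y) := by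
        simpa using exp_smul_adL_apply Y (Γ x) 1
      have h3 := congrArg (fun m => m * NormedSpace.exp (-Y)) (hΓ x hx)
      simp only [mul_assoc, exp_mul_exp_neg, mul_one, smul_mul_assoc] at h3
      rw [add_apply, smul_apply,
        sub_apply, one_apply_eq_self, h2, mul_assoc, smul_sub,
        sub_smul, sub_smul, one_smul]
      rw [sub_smul, one_smul] at h3
      have h4 : z = x • Γ x - (x • (NormedSpace.exp Y * (Γ x * NormedSpace.exp (-Y)))
        - NormedSpace.exp Y * (Γ x * NormedSpace.exp (-Y))) := by rw [← h3]; abel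
      rw [h4]
      module
    rw [← h1, ← mul_apply_eq_comp, hW]
    simp only
    rw [Ring.inverse_mul_cancel _ (hu1 _ hy)]
    rfl
  have hWc : ContinuousOn W (Icc 0 1) := by
    intro y hy
    obtain ⟨u, hu'⟩ := hu1 y hy
    have h1 : ContinuousAt Ring.inverse (1 + y • (NormedSpace.exp (adL Y) - 1)) := by
      rw [← hu']; exact NormedRing.inverse_continuousAt u
    have h2 : Continuous fun y : ℝ => 1 + y • (NormedSpace.exp (adL Y) - 1) := by fun_prop
    exact (ContinuousAt.comp (f := fun y : ℝ => 1 + y • (NormedSpace.exp (adL Y) - 1)) h1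
      h2.continuousAt).continuousWithinAt
  have hWi : IntervalIntegrable (fun y => W y * F) volume 0 1 := by
    refine ContinuousOn.intervalIntegrable ?_
    rw [uIcc_of_le zero_le_one]
    exact hWc.mul continuousOn_const
  calc ∫ x in (0 : ℝ)..1, Γ x = ∫ x in (0 : ℝ)..1, W (1 - x) z :=
        intervalIntegral.integral_congr fun x hx => by
          rw [uIcc_of_le zero_le_one] at hx
          exact hΓW x hx
    _ = ∫ y in (0 : ℝ)..1, W y z := by
        rw [intervalIntegral.integral_comp_sub_left (fun y => W y z)]
        simp
    _ = ∫ y in (0 : ℝ)..1, (W y * F) v := by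
        refine intervalIntegral.integral_congr fun y _ => ?_
        simp [hFv]
    _ = (∫ y in (0 : ℝ)..1, W y * F) v :=
        (ContinuousLinearMap.apply ℝ M v).intervalIntegral_comp_comm hWi
    _ = v := by rw [hone]; rfl

/-- For small Y the operator e^{r ad Y} - 1 has norm below 1, uniformly in r ∈ [0,1], and a Neumann
series inverts the rest. -/
lemma eventually_isUnit_exp_adL :
    ∀ᶠ Y : M in 𝓝 0, ∀ r ∈ Icc (0 : ℝ) 1, ∀ y ∈ Icc (0 : ℝ) 1,
      IsUnit (1 + y • (NormedSpace.exp (r • adL Y) - 1)) := by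
  have h1 : Tendsto (fun z : M →L[ℝ] M => NormedSpace.exp z - 1) (𝓝 0) (𝓝 0) := by
    have h : Continuous fun z : M →L[ℝ] M => NormedSpace.exp z - 1 :=
      (continuous_exp_real (M := M →L[ℝ] M)).sub continuous_const
    simpa using h.tendsto 0
  obtain ⟨δ, hδ, hball⟩ := Metric.eventually_nhds_iff_ball.1
    (h1.eventually (Metric.ball_mem_nhds 0 one_pos))
  have h2 : Tendsto (fun Y : M => adL Y) (𝓝 0) (𝓝 0) := by
    simpa using (adL (M := M)).continuous.tendsto 0
  filter_upwards [h2.eventually (Metric.ball_mem_nhds 0 hδ)] with Y hY r hr y hy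
  have h3 : r • adL Y ∈ Metric.ball (0 : M →L[ℝ] M) δ := by
    rw [dist_zero_right] at hY
    rw [mem_ball_zero_iff, norm_smul, Real.norm_eq_abs, abs_of_nonneg hr.1]
    exact (mul_le_of_le_one_left (norm_nonneg _) hr.2).trans_lt hY
  have h4 := hball _ h3
  rw [dist_zero_right] at h4
  have h5 : ‖-(y • (NormedSpace.exp (r • adL Y) - 1))‖ < 1 := by
    rw [norm_neg, norm_smul, Real.norm_eq_abs, abs_of_nonneg hy.1]
    exact (mul_le_of_le_one_left (norm_nonneg _) hy.2).trans_lt h4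
  have h6 := isUnit_one_sub_of_norm_lt_one h5
  rwa [sub_neg_eq_add] at h6

variable {T : ℝ} {A : ℝ → M}

/-- The sum of the Dyson series at time `t`, with the generator scaled by `ε`. -/
def dysonSum (A : ℝ → M) (ε t : ℝ) : M := ∑' m, ε ^ m • dysonCoeff A m t

/-- The logarithmic derivative of `dysonSum` in `ε`. -/
def logDerivSum (A : ℝ → M) (ε t : ℝ) : M := ∑' m, ε ^ m • logDerivCoeff A m t

lemma dysonCoeff_geometric (hT : 0 ≤ T) (hA : IntervalIntegrable A volume 0 T) {r : ℝ}
    (hr : 0 < r) : ∃ C, 0 ≤ C ∧ ∀ m, ∀ t ∈ Icc 0 T, ‖dysonCoeff A m t‖ ≤ C * r ^ m :=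
  picard_norm_le_geometric hT (intervalIntegrable_mulL hA) continuousOn_const hr

lemma logDerivCoeff_geometric (hT : 0 ≤ T) (hA : IntervalIntegrable A volume 0 T) {r : ℝ}
    (hr : 0 < r) : ∃ C, 0 ≤ C ∧ ∀ m, ∀ t ∈ Icc 0 T, ‖logDerivCoeff A m t‖ ≤ C * r ^ m :=
  picard_norm_le_geometric hT (intervalIntegrable_adL hA)
    ((isPrimitive_integral hA).continuousOn hT) hr

lemma dysonCoeff_summable (hT : 0 ≤ T) (hA : IntervalIntegrable A volume 0 T) (ε : ℝ) {t : ℝ}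
    (ht : t ∈ Icc 0 T) : Summable fun m => ‖ε ^ m • dysonCoeff A m t‖ :=
  picard_summable hT (intervalIntegrable_mulL hA) continuousOn_const ε ht

lemma logDerivCoeff_summable (hT : 0 ≤ T) (hA : IntervalIntegrable A volume 0 T) (ε : ℝ) {t : ℝ}
    (ht : t ∈ Icc 0 T) : Summable fun m => ‖ε ^ m • logDerivCoeff A m t‖ :=
  picard_summable hT (intervalIntegrable_adL hA) ((isPrimitive_integral hA).continuousOn hT) ε ht

lemma abs_mul_inv_lt_one (ε : ℝ) : |ε| * (1 / (|ε| + 1)) < 1 := by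
  rw [mul_one_div, div_lt_one (by positivity)]; linarith

lemma hasDerivAt_dysonSum (hT : 0 ≤ T) (hA : IntervalIntegrable A volume 0 T) (ε : ℝ) :
    HasDerivAt (fun ε => dysonSum A ε T) (logDerivSum A ε T * dysonSum A ε T) ε := by
  have hTT : T ∈ Icc 0 T := ⟨hT, le_rfl⟩
  obtain ⟨C, -, hC⟩ := dysonCoeff_geometric hT hA (r := 1 / (|ε| + 1)) (by positivity)
  refine (hasDerivAt_tsum_pow_smul (by positivity) (fun m => hC m T hTT)
    (abs_mul_inv_lt_one ε)).congr_deriv ?_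
  rw [logDerivSum, dysonSum, tsum_pow_smul_mul_tsum_pow_smul (logDerivCoeff_summable hT hA ε hTT)
    (dysonCoeff_summable hT hA ε hTT)]
  exact tsum_congr fun m => by rw [sum_logDerivCoeff_mul_dysonCoeff hT hA m hTT]

lemma continuous_logDerivSum (hT : 0 ≤ T) (hA : IntervalIntegrable A volume 0 T) :
    Continuous fun ε => logDerivSum A ε T := by
  refine continuous_iff_continuousAt.2 fun ε => ?_
  obtain ⟨C, -, hC⟩ := logDerivCoeff_geometric hT hA (r := 1 / (|ε| + 1)) (by positivity)
  exact (hasDerivAt_tsum_pow_smul (by positivity) (fun m => hC m T ⟨hT, le_rfl⟩)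
    (abs_mul_inv_lt_one ε)).continuousAt

lemma contDiff_dysonSum (hT : 0 ≤ T) (hA : IntervalIntegrable A volume 0 T) :
    ContDiff ℝ 1 fun ε => dysonSum A ε T := by
  rw [contDiff_one_iff_deriv]
  refine ⟨fun ε => (hasDerivAt_dysonSum hT hA ε).differentiableAt, ?_⟩
  have h1 : deriv (fun ε => dysonSum A ε T) = fun ε => logDerivSum A ε T * dysonSum A ε T :=
    funext fun ε => (hasDerivAt_dysonSum hT hA ε).deriv
  have h2 : Continuous fun ε => dysonSum A ε T :=
    continuous_iff_continuousAt.2 fun ε => (hasDerivAt_dysonSum hT hA ε).continuousAt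
  rw [h1]
  exact (continuous_logDerivSum hT hA).mul h2

lemma tsum_zero_pow_smul {E : Type*} [NormedAddCommGroup E] [NormedSpace ℝ E] (c : ℕ → E) :
    ∑' m, (0 : ℝ) ^ m • c m = c 0 := by
  rw [tsum_eq_single 0 fun m hm => by simp [hm]]
  simp

lemma dysonSum_zero (t : ℝ) : dysonSum A 0 t = 1 := by
  rw [dysonSum, tsum_zero_pow_smul]
  rfl

/-- The sources `z_k` of the chain recursion for the source function `e`. -/
def sourceCoeff (A e : ℝ → M) : ℕ → ℝ → M :=
  picard (fun s => adL (A s)) (fun t => ∫ s in (0 : ℝ)..t, e s)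

/-- The combination N(t) = (x-1)Γ(T) + Γ(t) - z(t) solves N' = ε[A,N], because the source e cancels,
and N(0) = (x-1)Γ(T). Therefore N U = U N(0). This is that identity coefficient by coefficient; at t
= T it reads (xΓ - z)U = (x-1)UΓ. -/
lemma sum_chain_mul_dysonCoeff (hT : 0 ≤ T) (hA : IntervalIntegrable A volume 0 T) {e : ℝ → M}
    (he : IntervalIntegrable e volume 0 T) (x : ℝ) (m : ℕ) {t : ℝ} (ht : t ∈ Icc 0 T) :
    ∑ p ∈ Finset.HasAntidiagonal.antidiagonal m,
      ((x - 1) • chain (fun s => adL (A s)) e x T p.1 T + chain (fun s => adL (A s)) e x T p.1 t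
        - sourceCoeff A e p.1 t) * dysonCoeff A p.2 t
      = (x - 1) • ∑ p ∈ Finset.HasAntidiagonal.antidiagonal m,
        dysonCoeff A p.1 t * chain (fun s => adL (A s)) e x T p.2 T := by
  set K := chain (fun s => adL (A s)) e x T with hK
  set z := sourceCoeff A e with hz
  set N : ℕ → ℝ → M := fun k t => (x - 1) • K k T + K k t - z k t with hN
  have hAd := intervalIntegrable_adL hA
  have hz0 : ∀ k, z k 0 = 0 := fun k => by cases k <;> simp [hz, sourceCoeff, picard]
  have hK0 : ∀ k, K k 0 = 0 := fun k => by cases k <;> simp [hK, chain]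
  have hNp : ∀ k, IsPrimitive T (N k)
      (fun s => match k with | 0 => 0 | k + 1 => adL (A s) (N k s)) := by
    intro k
    have hzp : IsPrimitive T (z k)
        (fun s => match k with | 0 => e s | k + 1 => adL (A s) (z k s)) := by
      cases k with
      | zero => exact isPrimitive_integral he
      | succ k =>
        exact picard_succ_isPrimitive hT hAd ((isPrimitive_integral he).continuousOn hT) k
    have hKp := chain_isPrimitive hT hAd he x k
    refine (((isPrimitive_const T ((x - 1) • K k T)).add hKp).add
      (hzp.const_smul (-1))).congr hT (fun s _ => ?_) (fun s _ => ?_)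
    · simp only [hN, neg_smul, one_smul, sub_eq_add_neg]
      rfl
    · cases k with
      | zero => simp [chainDensity]
      | succ k =>
        simp only [chainDensity, hN, map_sub]
        simp only [neg_smul, one_smul, zero_add, sub_eq_add_neg]
        rfl
  change ∑ p ∈ Finset.HasAntidiagonal.antidiagonal m, N p.1 t * dysonCoeff A p.2 t = _
  have hRp : ∀ m, IsPrimitive T (fun t => (x - 1) • ∑ p ∈ Finset.HasAntidiagonal.antidiagonal m,
      dysonCoeff A p.1 t * K p.2 T) (fun t => (x - 1) • ∑ p ∈ Finset.HasAntidiagonal.antidiagonal m,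
      (match p.1 with | 0 => 0 | k + 1 => A t * dysonCoeff A k t) * K p.2 T) := fun m =>
    (IsPrimitive.sum _ fun p _ => (dysonCoeff_isPrimitive hT hA p.1).map
      ((ContinuousLinearMap.mul ℝ M).flip (K p.2 T))).const_smul (x - 1)
  induction m generalizing t with
  | zero =>
    have h1 := (hNp 0).eq_integral t ht
    simp only [intervalIntegral.integral_zero, add_zero] at h1
    have h2 : N 0 0 = (x - 1) • K 0 T := by simp [hN, hz0, hK0]
    rw [h2] at h1
    rw [Finset.Nat.antidiagonal_zero, Finset.sum_singleton, Finset.sum_singleton]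
    rw [h1]
    simp [dysonCoeff, picard]
  | succ m ih =>
    have hL := IsPrimitive.sum (T := T) (Finset.HasAntidiagonal.antidiagonal (m + 1)) (fun p _ =>
      (hNp p.1).mul hT (dysonCoeff_isPrimitive hT hA p.2))
    refine hL.eq_of_zero ((hRp (m + 1)).congr hT (fun _ _ => rfl) fun s hs => ?_) ?_ ht
    · rw [Finset.sum_add_distrib, Finset.Nat.sum_antidiagonal_succ,
        Finset.Nat.sum_antidiagonal_succ', Finset.Nat.sum_antidiagonal_succ]
      simp only [mul_zero, zero_add, zero_mul]
      rw [← Finset.sum_add_distrib]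
      have : ∀ p : ℕ × ℕ, adL (A s) (N p.1 s) * dysonCoeff A p.2 s
          + N p.1 s * (A s * dysonCoeff A p.2 s)
          = A s * (N p.1 s * dysonCoeff A p.2 s) := fun p => by
        simp only [adL_apply]; noncomm_ring
      simp_rw [this]
      rw [← Finset.mul_sum, ih hs, mul_smul_comm, Finset.mul_sum]
      simp only [mul_assoc]
    · rw [Finset.Nat.sum_antidiagonal_succ', Finset.Nat.sum_antidiagonal_succ]
      simp [hN, hz0, hK0, dysonCoeff, picard]

end MagnusIdentity

/-! ### The Magnus series is the logarithm -/

section MagnusSeries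

variable {M : Type*} [NormedRing M] [NormedAlgebra ℝ M] [CompleteSpace M] {T : ℝ} {A e : ℝ → M}

/-- A bound for the growth rate of the chain and Magnus coefficients. -/
def magnusRate (A : ℝ → M) (T : ℝ) : ℝ := 2 * (∫ s in (0 : ℝ)..T, ‖adL (A s)‖) + 1

lemma magnusRate_pos (hT : 0 ≤ T) : 0 < magnusRate A T := by
  have : 0 ≤ ∫ s in (0 : ℝ)..T, ‖adL (A s)‖ :=
    intervalIntegral.integral_nonneg hT fun _ _ => norm_nonneg _
  unfold magnusRate
  linarith

lemma chain_norm_le_rate (hT : 0 ≤ T) (hA : IntervalIntegrable A volume 0 T)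
    (he : IntervalIntegrable e volume 0 T) {x : ℝ} (hx : x ∈ Icc (0 : ℝ) 1) (n : ℕ) :
    ‖chain (fun s => adL (A s)) e x T n T‖
      ≤ (∫ s in (0 : ℝ)..T, ‖e s‖) * magnusRate A T ^ n := by
  refine (chain_norm_le hT (intervalIntegrable_adL hA) he hx n ⟨hT, le_rfl⟩).trans ?_
  have h1 : 0 ≤ ∫ s in (0 : ℝ)..T, ‖adL (A s)‖ :=
    intervalIntegral.integral_nonneg hT fun _ _ => norm_nonneg _
  have h2 : 0 ≤ ∫ s in (0 : ℝ)..T, ‖e s‖ :=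
    intervalIntegral.integral_nonneg hT fun _ _ => norm_nonneg _
  refine mul_le_mul_of_nonneg_left (pow_le_pow_left₀ (by positivity) ?_ n) h2
  unfold magnusRate
  linarith

lemma magnusTerm_norm_le_rate (hT : 0 ≤ T) (hA : IntervalIntegrable A volume 0 T)
    (he : IntervalIntegrable e volume 0 T) (n : ℕ) :
    ‖((n : ℝ) + 1) • magnusTerm (fun s => adL (A s)) e T n‖
      ≤ (∫ s in (0 : ℝ)..T, ‖e s‖) * magnusRate A T ^ n := by
  rw [smul_magnusTerm_eq_integral hT (intervalIntegrable_adL hA) he]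
  have := intervalIntegral.norm_integral_le_of_norm_le_const
    (f := fun x => chain (fun s => adL (A s)) e x T n T) (a := 0) (b := 1) fun x hx => by
      rw [uIoc_of_le zero_le_one] at hx
      exact chain_norm_le_rate hT hA he (Ioc_subset_Icc_self hx) n
  simpa using this

lemma chain_continuousOn (hT : 0 ≤ T) (hA : IntervalIntegrable A volume 0 T)
    (he : IntervalIntegrable e volume 0 T) (n : ℕ) :
    ContinuousOn (fun x => chain (fun s => adL (A s)) e x T n T) (Icc 0 1) := by
  refine ContinuousOn.congr (f := fun x : ℝ => ∑ σ : Equiv.Perm (Fin (n + 1)),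
    (x ^ ascents σ * (x - 1) ^ (n - ascents σ))
      • ∫ t in orderedTimes (n + 1) T, word (fun s => adL (A s)) e n (fun i => t (σ i))) ?_
    fun x hx => chain_eq_sum_perm hT (intervalIntegrable_adL hA) he hx n
  fun_prop

/-- Summing the chain relation at t = T gives the equation for Γ(x) required by
`integral_inverse_apply`, and integrating the series in x turns chains into Magnus terms. The source
e is left free: e = A yields the logarithm, e = [A,X] its commutators. -/
lemma tsum_magnusTerm_eq (hT : 0 ≤ T) (hA : IntervalIntegrable A volume 0 T)
    (he : IntervalIntegrable e volume 0 T) {ε : ℝ} (hε : |ε| * magnusRate A T < 1) {Y v : M}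
    (hY : NormedSpace.exp Y = dysonSum A ε T)
    (hu : ∀ r ∈ Icc (0 : ℝ) 1, ∀ y ∈ Icc (0 : ℝ) 1,
      IsUnit (1 + y • (NormedSpace.exp (r • adL Y) - 1)))
    (hz : ∑' k, ε ^ k • sourceCoeff A e k T
      = ∫ s in (0 : ℝ)..1, NormedSpace.exp (s • Y) * v * NormedSpace.exp (-(s • Y))) :
    ∑' k : ℕ, ε ^ k • (((k : ℝ) + 1) • magnusTerm (fun s => adL (A s)) e T k) = v := by
  have hTT : T ∈ Icc 0 T := ⟨hT, le_rfl⟩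
  have hAd := intervalIntegrable_adL hA
  set I := ∫ s in (0 : ℝ)..T, ‖e s‖
  set R := magnusRate A T
  have hR : 0 < R := magnusRate_pos hT
  set Γ : ℕ → ℝ → M := fun k x => chain (fun s => adL (A s)) e x T k T with hΓ
  have hΓs : ∀ x ∈ Icc (0 : ℝ) 1, Summable fun k => ‖ε ^ k • Γ k x‖ := fun x hx =>
    summable_pow_smul hR.le (fun k => chain_norm_le_rate hT hA he hx k) hε
  have hzs : Summable fun k => ‖ε ^ k • sourceCoeff A e k T‖ :=
    picard_summable hT hAd ((isPrimitive_integral he).continuousOn hT) ε hTT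
  have hDs := dysonCoeff_summable hT hA ε hTT
  have hsum : HasSum (fun k => ∫ x in (0 : ℝ)..1, ε ^ k • Γ k x)
      (∫ x in (0 : ℝ)..1, ∑' k, ε ^ k • Γ k x) := by
    refine intervalIntegral.hasSum_integral_of_dominated_convergence
      (fun k _ => I * (|ε| * R) ^ k) (fun k => ?_) (fun k => ?_) ?_ ?_ ?_
    · rw [uIoc_of_le zero_le_one]
      exact (((chain_continuousOn hT hA he k).mono Ioc_subset_Icc_self).const_smul
        (ε ^ k)).aestronglyMeasurable measurableSet_Ioc
    · refine Eventually.of_forall fun x hx => ?_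
      rw [uIoc_of_le zero_le_one] at hx
      rw [norm_smul, norm_pow, Real.norm_eq_abs, mul_pow]
      have := chain_norm_le_rate hT hA he (Ioc_subset_Icc_self hx) k
      calc |ε| ^ k * ‖Γ k x‖ ≤ |ε| ^ k * (I * R ^ k) := by gcongr
        _ = _ := by ring
    · exact Eventually.of_forall fun _ _ =>
        (summable_geometric_of_lt_one (by positivity) hε).mul_left I
    · exact intervalIntegrable_const
    · refine Eventually.of_forall fun x hx => ?_
      rw [uIoc_of_le zero_le_one] at hx
      exact (hΓs x (Ioc_subset_Icc_self hx)).of_norm.hasSum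
  have h1 : ∑' k : ℕ, ε ^ k • (((k : ℝ) + 1) • magnusTerm (fun s => adL (A s)) e T k)
      = ∫ x in (0 : ℝ)..1, ∑' k, ε ^ k • Γ k x := by
    rw [← hsum.tsum_eq]
    refine tsum_congr fun k => ?_
    rw [intervalIntegral.integral_smul, smul_magnusTerm_eq_integral hT hAd he]
  rw [h1]
  refine integral_inverse_apply hu hz fun x hx => ?_
  have hsx := hΓs x hx
  have hxz : Summable fun k => ‖ε ^ k • (x • Γ k x - sourceCoeff A e k T)‖ := by
    refine Summable.of_nonneg_of_le (fun _ => norm_nonneg _) (fun k => ?_)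
      ((hsx.mul_left |x|).add hzs)
    rw [smul_sub, smul_comm]
    refine (norm_sub_le _ _).trans ?_
    rw [norm_smul, Real.norm_eq_abs]
  have h2 : x • (∑' k, ε ^ k • Γ k x) - ∑' k, ε ^ k • sourceCoeff A e k T
      = ∑' k, ε ^ k • (x • Γ k x - sourceCoeff A e k T) := by
    rw [← tsum_const_smul'' x, ← (hsx.of_norm.const_smul x).tsum_sub hzs.of_norm]
    refine tsum_congr fun k => ?_
    rw [smul_sub, smul_comm]
  rw [h2, hY, dysonSum, tsum_pow_smul_mul_tsum_pow_smul hxz hDs,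
    tsum_pow_smul_mul_tsum_pow_smul hDs hsx, ← tsum_const_smul'' (x - 1)]
  refine tsum_congr fun m => ?_
  rw [smul_comm, ← sum_chain_mul_dysonCoeff hT hA he x m hTT]
  congr 1
  refine Finset.sum_congr rfl fun p _ => ?_
  congr 2
  module

/-- The Magnus coefficients `Y_{n+1} = y_n` of the time-ordered exponential of `A`. -/
def magnusCoeff (A : ℝ → M) (T : ℝ) (n : ℕ) : M := magnusTerm (fun s => adL (A s)) A T n

lemma magnusCoeff_norm_le_rate (hT : 0 ≤ T) (hA : IntervalIntegrable A volume 0 T) (n : ℕ) :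
    ‖magnusCoeff A T n‖ ≤ (∫ s in (0 : ℝ)..T, ‖A s‖) * magnusRate A T ^ n := by
  refine le_trans ?_ (magnusTerm_norm_le_rate hT hA hA n)
  rw [norm_smul, Real.norm_eq_abs, abs_of_pos (by positivity)]
  exact le_mul_of_one_le_left (norm_nonneg _) (by linarith [(Nat.cast_nonneg n : (0 : ℝ) ≤ n)])

/-- The Magnus series is the logarithm of the time-ordered exponential near `ε = 0`. -/
lemma exists_log_eq_magnus (hT : 0 ≤ T) (hA : IntervalIntegrable A volume 0 T) :
    ∃ Y : ℝ → M, Tendsto Y (𝓝 0) (𝓝 0) ∧ ∀ᶠ ε in 𝓝 (0 : ℝ),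
      |ε| * magnusRate A T < 1 ∧
      NormedSpace.exp (Y ε) = dysonSum A ε T ∧
      (∀ r ∈ Icc (0 : ℝ) 1, ∀ y ∈ Icc (0 : ℝ) 1,
        IsUnit (1 + y • (NormedSpace.exp (r • adL (Y ε)) - 1))) ∧
      HasDerivAt Y (∑' k : ℕ, ε ^ k • (((k : ℝ) + 1) • magnusCoeff A T k)) ε ∧
      logDerivSum A ε T = (∫ s in (0 : ℝ)..1, NormedSpace.exp (s • Y ε)
        * (∑' k : ℕ, ε ^ k • (((k : ℝ) + 1) • magnusCoeff A T k))
        * NormedSpace.exp (-(s • Y ε))) ∧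
      Y ε = ε • ∑' k : ℕ, ε ^ k • magnusCoeff A T k := by
  obtain ⟨Y, hY0, hY⟩ := exists_local_log (contDiff_dysonSum hT hA) (dysonSum_zero T)
  have hYc : Tendsto Y (𝓝 0) (𝓝 0) := by
    have := hY.self_of_nhds.2.continuousAt.tendsto
    rwa [hY0] at this
  have hsmall : ∀ᶠ ε : ℝ in 𝓝 0, |ε| * magnusRate A T < 1 := by
    have h : Continuous fun ε : ℝ => |ε| * magnusRate A T := by fun_prop
    have h' := h.tendsto 0
    simp only [abs_zero, zero_mul] at h'
    exact h'.eventually (gt_mem_nhds one_pos)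
  have hmain : ∀ᶠ ε in 𝓝 (0 : ℝ), |ε| * magnusRate A T < 1 ∧
      NormedSpace.exp (Y ε) = dysonSum A ε T ∧
      (∀ r ∈ Icc (0 : ℝ) 1, ∀ y ∈ Icc (0 : ℝ) 1,
        IsUnit (1 + y • (NormedSpace.exp (r • adL (Y ε)) - 1))) ∧
      HasDerivAt Y (∑' k : ℕ, ε ^ k • (((k : ℝ) + 1) • magnusCoeff A T k)) ε ∧
      logDerivSum A ε T = (∫ s in (0 : ℝ)..1, NormedSpace.exp (s • Y ε)
        * (∑' k : ℕ, ε ^ k • (((k : ℝ) + 1) • magnusCoeff A T k))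
        * NormedSpace.exp (-(s • Y ε))) := by
    filter_upwards [hY.eventually_nhds, hsmall, hYc.eventually eventually_isUnit_exp_adL]
      with ε hε hεs hu
    obtain ⟨hexp, hdiff⟩ := hε.self_of_nhds
    have hd := hdiff.hasDerivAt
    -- The derivative of e^{Y} = U_ε is computed in two ways; their equality is the hypothesis of
    -- `tsum_magnusTerm_eq` with v = Y'.
    have h1 := hasDerivAt_exp_path hd
    have h2 : HasDerivAt (fun r => NormedSpace.exp (Y r))
        (logDerivSum A ε T * dysonSum A ε T) ε :=
      (hasDerivAt_dysonSum hT hA ε).congr_of_eventuallyEq (hε.mono fun _ h => h.1)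
    have h3 := h1.unique h2
    rw [← hexp] at h3
    have h4 : logDerivSum A ε T = ∫ s in (0 : ℝ)..1, NormedSpace.exp (s • Y ε)
        * deriv Y ε * NormedSpace.exp (-(s • Y ε)) := by
      have h5 := congrArg (fun m => m * NormedSpace.exp (-(Y ε))) h3
      simpa only [mul_assoc, exp_mul_exp_neg, mul_one] using h5.symm
    have h6 := tsum_magnusTerm_eq hT hA hA hεs hexp hu h4
    have h7 : ∑' k : ℕ, ε ^ k • (((k : ℝ) + 1) • magnusCoeff A T k) = deriv Y ε := h6
    rw [h7]
    exact ⟨hεs, hexp, hu, hd, h4⟩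
  refine ⟨Y, hYc, ?_⟩
  set R := magnusRate A T with hRdef
  have hR : 0 < R := magnusRate_pos hT
  have hI : 0 ≤ ∫ s in (0 : ℝ)..T, ‖A s‖ :=
    intervalIntegral.integral_nonneg hT fun _ _ => norm_nonneg _
  -- The index is shifted because y_k multiplies ε^{k+1}. The resulting series has the derivative
  -- already found for Y and vanishes with it at 0.
  set c : ℕ → M := fun m => match m with | 0 => 0 | k + 1 => magnusCoeff A T k with hc
  have hcb : ∀ m, ‖c m‖ ≤ (∫ s in (0 : ℝ)..T, ‖A s‖) / R * R ^ m := by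
    intro m
    cases m with
    | zero => simp only [hc, norm_zero]; positivity
    | succ k =>
      refine (magnusCoeff_norm_le_rate hT hA k).trans (le_of_eq ?_)
      field_simp
      ring
  have hG : ∀ ε : ℝ, |ε| * R < 1 → HasDerivAt (fun ε : ℝ => ∑' m, ε ^ m • c m)
      (∑' k : ℕ, ε ^ k • (((k : ℝ) + 1) • magnusCoeff A T k)) ε := fun ε hε =>
    hasDerivAt_tsum_pow_smul hR hcb hε
  obtain ⟨δ, hδ, hball⟩ := Metric.eventually_nhds_iff_ball.1 hmain
  filter_upwards [Metric.ball_mem_nhds 0 hδ] with ε hε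
  obtain ⟨h1, h2, h3, h4, h5⟩ := hball ε hε
  refine ⟨h1, h2, h3, h4, h5, ?_⟩
  have h6 : EqOn Y (fun ε : ℝ => ∑' m, ε ^ m • c m) (Metric.ball 0 δ) := by
    refine Metric.isOpen_ball.eqOn_of_deriv_eq (convex_ball 0 δ).isPreconnected
      (fun x hx => (hball x hx).2.2.2.1.differentiableAt.differentiableWithinAt)
      (fun x hx => (hG x (hball x hx).1).differentiableAt.differentiableWithinAt)
      (fun x hx => ?_) (Metric.mem_ball_self hδ) ?_
    · rw [(hball x hx).2.2.2.1.deriv, (hG x (hball x hx).1).deriv]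
    · simp only [hY0, tsum_zero_pow_smul]; rfl
  rw [h6 hε]
  simp only
  rw [(summable_pow_smul hR.le hcb h1).of_norm.tsum_eq_zero_add]
  simp only [hc, smul_zero, zero_add]
  rw [← tsum_const_smul'' ε]
  exact tsum_congr fun k => by rw [pow_succ', mul_smul]

end MagnusSeries

/-! ### Commutators with Magnus coefficients -/

section MagnusCommutator

variable {M : Type*} [NormedRing M] [NormedAlgebra ℝ M] [CompleteSpace M] {T : ℝ} {A e : ℝ → M}

lemma sourceCoeff_adL_eq_conjCoeff (A : ℝ → M) (X : M) (k : ℕ) :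
    sourceCoeff A (fun s => adL (A s) X) k = conjCoeff A X (k + 1) := by
  induction k with
  | zero => rfl
  | succ k ih =>
    funext t
    change ∫ s in (0 : ℝ)..t, adL (A s) (sourceCoeff A (fun s => adL (A s) X) k s)
      = ∫ s in (0 : ℝ)..t, adL (A s) (conjCoeff A X (k + 1) s)
    rw [ih]

lemma exp_conj_sub_eq_integral (Y X : M) :
    NormedSpace.exp Y * X * NormedSpace.exp (-Y) - X
      = ∫ s in (0 : ℝ)..1, NormedSpace.exp (s • Y) * adL Y X * NormedSpace.exp (-(s • Y)) := by
  have hd : ∀ s : ℝ, HasDerivAt (fun s : ℝ => NormedSpace.exp (s • Y) * X * NormedSpace.exp (s • -Y))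
      (NormedSpace.exp (s • Y) * adL Y X * NormedSpace.exp (-(s • Y))) s := by
    intro s
    refine (((hasDerivAt_exp_smul_const (𝕂 := ℝ) Y s).mul_const X).mul
      (hasDerivAt_exp_smul_const' (𝕂 := ℝ) (-Y) s)).congr_deriv ?_
    simp only [adL_apply, smul_neg]
    noncomm_ring
  have hc : Continuous fun s : ℝ => NormedSpace.exp (s • Y) * adL Y X * NormedSpace.exp (-(s • Y)) := by
    have := continuous_exp_real (M := M)
    fun_prop
  rw [intervalIntegral.integral_eq_sub_of_hasDerivAt (fun s _ => hd s)
    (hc.intervalIntegrable 0 1)]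
  simp

lemma tsum_conjCoeff (hT : 0 ≤ T) (hA : IntervalIntegrable A volume 0 T) (X Y : M) {ε : ℝ}
    (hY : NormedSpace.exp Y = dysonSum A ε T) :
    ∑' k, ε ^ k • conjCoeff A X k T = NormedSpace.exp Y * X * NormedSpace.exp (-Y) := by
  have hTT : T ∈ Icc 0 T := ⟨hT, le_rfl⟩
  have h1 : (∑' k, ε ^ k • conjCoeff A X k T) * dysonSum A ε T = dysonSum A ε T * X := by
    rw [dysonSum, tsum_pow_smul_mul_tsum_pow_smul (b := fun k => conjCoeff A X k T)
      (picard_summable hT (intervalIntegrable_adL hA) continuousOn_const ε hTT)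
      (dysonCoeff_summable hT hA ε hTT),
      ← (dysonCoeff_summable hT hA ε hTT).of_norm.tsum_mul_right]
    refine tsum_congr fun m => ?_
    rw [sum_conjCoeff_mul_dysonCoeff hT hA X m hTT, smul_mul_assoc]
  rw [← hY] at h1
  rw [← h1, mul_assoc, exp_mul_exp_neg, mul_one]

/-- The commutator with a Magnus coefficient is again a Magnus term. -/
theorem adL_magnusCoeff (hT : 0 ≤ T) (hA : IntervalIntegrable A volume 0 T) (X : M) (m : ℕ) :
    adL (magnusCoeff A T m) X
      = ((m : ℝ) + 1) • magnusTerm (fun s => adL (A s)) (fun s => adL (A s) X) T m := by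
  have hTT : T ∈ Icc 0 T := ⟨hT, le_rfl⟩
  have hAd := intervalIntegrable_adL hA
  have he : IntervalIntegrable (fun s => adL (A s) X) volume 0 T :=
    intervalIntegrable_clm_apply hT hAd continuousOn_const
  set R := magnusRate A T
  have hR : 0 < R := magnusRate_pos hT
  set L : M →L[ℝ] M := adL.flip X with hL
  have hLb : ∀ k, ‖L (magnusCoeff A T k)‖ ≤ ‖L‖ * (∫ s in (0 : ℝ)..T, ‖A s‖) * R ^ k := fun k => by
    rw [mul_assoc]
    exact (L.le_opNorm _).trans
      (mul_le_mul_of_nonneg_left (magnusCoeff_norm_le_rate hT hA k) (norm_nonneg _))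
  -- The identity is proved for generating functions at small ε > 0 and then read off
  -- coefficientwise.
  refine congrFun (coeff_eq_of_tsum_eq hR hLb (magnusTerm_norm_le_rate hT hA he) ?_) m
  obtain ⟨Y, -, hY⟩ := exists_log_eq_magnus hT hA
  filter_upwards [nhdsWithin_le_nhds hY, self_mem_nhdsWithin] with ε hε hpos
  obtain ⟨h1, h2, h3, -, -, h6⟩ := hε
  have hε0 : ε ≠ 0 := ne_of_gt hpos
  have hys := summable_pow_smul hR.le (magnusCoeff_norm_le_rate hT hA) h1
  set S := ∑' k : ℕ, ε ^ k • magnusCoeff A T k with hS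
  have hLS : ∑' k, ε ^ k • L (magnusCoeff A T k) = adL S X := by
    have := L.map_tsum hys.of_norm
    simp only [map_smul] at this
    exact this.symm
  rw [hLS]
  refine (tsum_magnusTerm_eq hT hA he h1 h2 h3 ?_).symm
  have hcs : Summable fun k => ‖ε ^ k • conjCoeff A X k T‖ :=
    picard_summable hT hAd continuousOn_const ε hTT
  have h7 := tsum_conjCoeff hT hA X (Y ε) h2
  rw [hcs.of_norm.tsum_eq_zero_add] at h7
  -- The source series is (U X U⁻¹ - X)/ε, since its coefficients are those of the conjugation
  -- shifted by one. With Y = εS this equals ∫ e^{sY}[S,X]e^{-sY} ds, which is the form needed with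
  -- v = [S,X].
  have h8 : ε • ∑' k, ε ^ k • sourceCoeff A (fun s => adL (A s) X) k T
      = ε • ∫ s in (0 : ℝ)..1, NormedSpace.exp (s • Y ε) * adL S X
        * NormedSpace.exp (-(s • Y ε)) := by
    rw [← intervalIntegral.integral_smul]
    have h9 := exp_conj_sub_eq_integral (Y ε) X
    rw [← h7] at h9
    have h10 : ∀ s : ℝ, ε • (NormedSpace.exp (s • Y ε) * adL S X * NormedSpace.exp (-(s • Y ε)))
        = NormedSpace.exp (s • Y ε) * adL (Y ε) X * NormedSpace.exp (-(s • Y ε)) := by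
      intro s
      have : adL (Y ε) X = ε • adL S X := by rw [h6, map_smul]; rfl
      rw [this, mul_smul_comm, smul_mul_assoc]
    simp_rw [h10]
    rw [← h9, ← tsum_const_smul'' ε]
    have h11 : conjCoeff A X 0 T = X := rfl
    rw [h11, pow_zero, one_smul, add_sub_cancel_left]
    exact tsum_congr fun k => by rw [sourceCoeff_adL_eq_conjCoeff, pow_succ', mul_smul]
  exact (smul_right_injective M hε0) h8

end MagnusCommutator

/-! ### Taylor polynomial and defect of the logarithmic derivative of e^K -/

section Nested

variable {M : Type*} [NormedRing M] [NormedAlgebra ℝ M] [CompleteSpace M]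

/-- The coefficient of `ε ^ d` in `(ad K) ^ j K'` for `K = ∑ ε ^ (m + 1) y m`. -/
def nestedCoeff (y : ℕ → M) : ℕ → ℕ → M
  | 0, d => ((d : ℝ) + 1) • y d
  | j + 1, d => ∑ p ∈ (Finset.range d ×ˢ Finset.range d).filter (fun p => p.1 + p.2 + 1 = d),
      adL (y p.2) (nestedCoeff y j p.1)

lemma nestedCoeff_eq_zero (y : ℕ → M) {j d : ℕ} (h : d < j) : nestedCoeff y j d = 0 := by
  induction j generalizing d with
  | zero => omega
  | succ j ih =>
    rw [nestedCoeff]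
    refine Finset.sum_eq_zero fun p hp => ?_
    simp only [Finset.mem_filter] at hp
    rw [ih (by omega), map_zero]

/-- The exponent `∑_{m ≤ n} ε ^ (m + 1) y m`. -/
def truncExponent (y : ℕ → M) (n : ℕ) (ε : ℝ) : M := ∑ m ∈ Finset.range (n + 1), ε ^ (m + 1) • y m

/-- The Taylor polynomial in `ε` and `s` of `e^{sK} K' e^{-sK}`, for `K = truncExponent y n ε`. -/
def conjPoly (y : ℕ → M) (n : ℕ) (ε s : ℝ) : M :=
  ∑ j ∈ Finset.range (n + 1), (s ^ j / (j.factorial : ℝ)) •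
    ∑ d ∈ Finset.range (n + 1), ε ^ d • nestedCoeff y j d

/-- The index pairs of the commutators dropped in `conjPoly`. -/
def defectIndex (n : ℕ) : Finset (ℕ × ℕ) :=
  (Finset.range (n + 1) ×ˢ Finset.range (n + 1)).filter fun p => n ≤ p.1 + p.2

/-- The defect of `conjPoly` in the differential equation of the conjugation. -/
def conjDefect (y : ℕ → M) (n : ℕ) (ε s : ℝ) : M :=
  ∑ j ∈ Finset.range (n + 1), (s ^ j / (j.factorial : ℝ)) •
    ∑ p ∈ defectIndex n, ε ^ (p.1 + p.2 + 1) • adL (y p.2) (nestedCoeff y j p.1)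

lemma conjPoly_zero (y : ℕ → M) (n : ℕ) (ε : ℝ) :
    conjPoly y n ε 0 = ∑ d ∈ Finset.range (n + 1), ε ^ d • (((d : ℝ) + 1) • y d) := by
  rw [conjPoly, Finset.sum_eq_single 0]
  · simp [nestedCoeff]
  · intro j _ hj
    simp [hj]
  · simp

lemma sum_nestedCoeff_succ (y : ℕ → M) (n j : ℕ) (ε : ℝ) :
    ∑ d ∈ Finset.range (n + 1), ε ^ d • nestedCoeff y (j + 1) d
      = ∑ p ∈ (Finset.range (n + 1) ×ˢ Finset.range (n + 1)).filter (fun p => ¬ n ≤ p.1 + p.2),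
        ε ^ (p.1 + p.2 + 1) • adL (y p.2) (nestedCoeff y j p.1) := by
  simp only [nestedCoeff, Finset.smul_sum]
  rw [Finset.sum_sigma']
  refine Finset.sum_bij (fun x _ => x.2) ?_ ?_ ?_ ?_
  · rintro ⟨d, p⟩ hp
    simp only [Finset.mem_sigma, Finset.mem_filter, Finset.mem_product, Finset.mem_range] at hp ⊢
    omega
  · rintro ⟨d, p⟩ hp ⟨d', p'⟩ hp' h
    simp only [Finset.mem_sigma, Finset.mem_filter] at hp hp' h
    subst h
    have : d = d' := by omega
    subst this
    rfl
  · intro p hp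
    simp only [Finset.mem_filter, Finset.mem_product, Finset.mem_range] at hp
    refine ⟨⟨p.1 + p.2 + 1, p⟩, ?_, rfl⟩
    simp only [Finset.mem_sigma, Finset.mem_filter, Finset.mem_product, Finset.mem_range]
    refine ⟨?_, ⟨?_, ?_⟩, trivial⟩ <;> omega
  · rintro ⟨d, p⟩ hp
    simp only [Finset.mem_sigma, Finset.mem_filter] at hp
    rw [hp.2.2]

/-- Cutting the power series in s at j ≤ n costs nothing: a j-fold commutator has degree at least j
in ε, so the term j = n + 1 is empty. The whole defect stems from products of degree above n in ε.
-/
lemma hasDerivAt_conjPoly (y : ℕ → M) (n : ℕ) (ε s : ℝ) :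
    HasDerivAt (conjPoly y n ε)
      (adL (truncExponent y n ε) (conjPoly y n ε s) - conjDefect y n ε s) s := by
  set Q : ℕ → M := fun j => ∑ d ∈ Finset.range (n + 1), ε ^ d • nestedCoeff y j d with hQ
  have hmon : ∀ j : ℕ, HasDerivAt (fun s : ℝ => s ^ (j + 1) / ((j + 1).factorial : ℝ))
      (s ^ j / (j.factorial : ℝ)) s := by
    intro j
    refine ((hasDerivAt_pow (j + 1) s).div_const _).congr_deriv ?_
    rw [Nat.factorial_succ]
    push_cast
    have : (j.factorial : ℝ) ≠ 0 := by positivity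
    field_simp
  have h1 : HasDerivAt (conjPoly y n ε)
      (∑ j ∈ Finset.range n, (s ^ j / (j.factorial : ℝ)) • Q (j + 1)) s := by
    have h2 : conjPoly y n ε = fun s => (∑ j ∈ Finset.range n,
        (s ^ (j + 1) / ((j + 1).factorial : ℝ)) • Q (j + 1)) + Q 0 := by
      funext s
      rw [conjPoly, Finset.sum_range_succ']
      simp [hQ]
    rw [h2]
    exact (HasDerivAt.fun_sum fun j _ => (hmon j).smul_const (Q (j + 1))).add_const _
  refine h1.congr_deriv ?_
  have h3 : ∑ j ∈ Finset.range n, (s ^ j / (j.factorial : ℝ)) • Q (j + 1)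
      = ∑ j ∈ Finset.range (n + 1), (s ^ j / (j.factorial : ℝ)) • Q (j + 1) := by
    rw [Finset.sum_range_succ]
    have : Q (n + 1) = 0 := Finset.sum_eq_zero fun d hd => by
      rw [nestedCoeff_eq_zero y (Finset.mem_range.1 hd), smul_zero]
    rw [this, smul_zero, add_zero]
  rw [h3, conjPoly, conjDefect, map_sum, ← Finset.sum_sub_distrib]
  refine Finset.sum_congr rfl fun j _ => ?_
  rw [map_smul, ← smul_sub]
  congr 1
  have h4 : adL (truncExponent y n ε) (Q j)
      = ∑ p ∈ Finset.range (n + 1) ×ˢ Finset.range (n + 1),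
        ε ^ (p.1 + p.2 + 1) • adL (y p.2) (nestedCoeff y j p.1) := by
    rw [Finset.sum_product, hQ, map_sum]
    refine Finset.sum_congr rfl fun d _ => ?_
    rw [truncExponent, map_sum, sum_apply]
    refine Finset.sum_congr rfl fun m _ => ?_
    rw [map_smul, map_smul, smul_apply, smul_smul]
    congr 1
    ring
  simp only [hQ]
  rw [sum_nestedCoeff_succ]
  refine eq_sub_of_add_eq ?_
  rw [add_comm, defectIndex, Finset.sum_filter_add_sum_filter_not]
  exact h4.symm

lemma hasDerivAt_truncExponent (y : ℕ → M) (n : ℕ) (ε : ℝ) :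
    HasDerivAt (truncExponent y n) (conjPoly y n ε 0) ε := by
  rw [conjPoly_zero]
  refine (HasDerivAt.fun_sum fun m _ => (hasDerivAt_pow (m + 1) ε).smul_const (y m)).congr_deriv ?_
  refine Finset.sum_congr rfl fun d _ => ?_
  rw [smul_smul]
  congr 1
  push_cast
  simp [mul_comm]

lemma continuous_conjPoly (y : ℕ → M) (n : ℕ) (ε : ℝ) : Continuous (conjPoly y n ε) :=
  continuous_iff_continuousAt.2 fun s => (hasDerivAt_conjPoly y n ε s).continuousAt

/-- The mean of `conjPoly` over `s ∈ [0, 1]`. -/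
lemma integral_conjPoly (y : ℕ → M) (n : ℕ) (ε : ℝ) :
    ∫ s in (0 : ℝ)..1, conjPoly y n ε s = ∑ d ∈ Finset.range (n + 1), ε ^ d •
      ∑ j ∈ Finset.range (n + 1), (1 / ((j + 1).factorial : ℝ)) • nestedCoeff y j d := by
  simp only [conjPoly]
  rw [intervalIntegral.integral_finsetSum]
  · simp only [intervalIntegral.integral_smul_const, intervalIntegral.integral_div, integral_pow]
    simp only [Finset.smul_sum]
    rw [Finset.sum_comm]
    refine Finset.sum_congr rfl fun d _ => Finset.sum_congr rfl fun j _ => ?_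
    rw [smul_comm, Nat.factorial_succ]
    congr 2
    push_cast
    simp
    ring
  · intro j _
    apply Continuous.intervalIntegrable
    fun_prop

lemma continuous_conj_exp (K D : M) :
    Continuous fun s : ℝ => NormedSpace.exp (s • K) * D * NormedSpace.exp (-(s • K)) := by
  have := continuous_exp_real (M := M)
  fun_prop

/-- Since `conjPoly` starts at K' itself, the initial mismatch in `norm_conj_exp_sub_le` is zero and
only the defect contributes. -/
lemma norm_logDeriv_exp_sub_le (y : ℕ → M) (n : ℕ) {ε c R : ℝ} (hc0 : 0 ≤ c)
    (hc : ∀ s ∈ Icc (-1 : ℝ) 1, ∀ X : M, ‖NormedSpace.exp (s • truncExponent y n ε) * X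
      * NormedSpace.exp (-(s • truncExponent y n ε))‖ ≤ c * ‖X‖)
    (hR : ∀ s ∈ Icc (0 : ℝ) 1, ‖conjDefect y n ε s‖ ≤ R) :
    ‖(∫ s in (0 : ℝ)..1, NormedSpace.exp (s • truncExponent y n ε) * conjPoly y n ε 0
        * NormedSpace.exp (-(s • truncExponent y n ε)))
      - ∑ d ∈ Finset.range (n + 1), ε ^ d •
        ∑ j ∈ Finset.range (n + 1), (1 / ((j + 1).factorial : ℝ)) • nestedCoeff y j d‖
      ≤ c * (c * R) := by
  rw [← integral_conjPoly, ← intervalIntegral.integral_sub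
    ((continuous_conj_exp _ _).intervalIntegrable 0 1)
    ((continuous_conjPoly y n ε).intervalIntegrable 0 1)]
  have h := intervalIntegral.norm_integral_le_of_norm_le_const (a := 0) (b := 1)
    (f := fun s => NormedSpace.exp (s • truncExponent y n ε) * conjPoly y n ε 0
        * NormedSpace.exp (-(s • truncExponent y n ε)) - conjPoly y n ε s)
    (C := c * (c * R)) fun s hs => by
      rw [uIoc_of_le zero_le_one] at hs
      have := norm_conj_exp_sub_le (D := conjPoly y n ε 0) hc0 hc (hasDerivAt_conjPoly y n ε)
        (R := R) (fun s hs => by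
          rw [sub_sub_cancel_left, norm_neg]
          exact hR s hs) (Ioc_subset_Icc_self hs)
      simpa using this
  simpa using h

lemma conjDefect_norm_le (y : ℕ → M) (n : ℕ) {ε s : ℝ} (hε : 0 ≤ ε) (hs : s ∈ Icc (0 : ℝ) 1) :
    ‖conjDefect y n ε s‖ ≤ ∑ p ∈ defectIndex n, ε ^ (p.1 + p.2 + 1) *
      ∑ j ∈ Finset.range (n + 1), ‖adL (y p.2) (nestedCoeff y j p.1)‖ := by
  rw [conjDefect]
  simp only [Finset.smul_sum, Finset.mul_sum]
  rw [Finset.sum_comm]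
  refine (norm_sum_le _ _).trans (Finset.sum_le_sum fun p _ => ?_)
  refine (norm_sum_le _ _).trans (Finset.sum_le_sum fun j _ => ?_)
  rw [norm_smul, norm_smul, Real.norm_eq_abs, Real.norm_eq_abs, abs_of_nonneg (pow_nonneg hε _),
    abs_of_nonneg (div_nonneg (pow_nonneg hs.1 _) (Nat.cast_nonneg _))]
  have h1 : s ^ j / (j.factorial : ℝ) ≤ 1 := by
    rw [div_le_one (by positivity)]
    exact (pow_le_one₀ hs.1 hs.2).trans (by exact_mod_cast j.factorial_pos)
  exact mul_le_of_le_one_left (by positivity) h1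

variable {T : ℝ} {A : ℝ → M}

lemma eventually_norm_conj_exp_le {Y : ℝ → M} (hY : Tendsto Y (𝓝 0) (𝓝 0)) :
    ∀ᶠ ε in 𝓝 (0 : ℝ), ∀ s ∈ Icc (-1 : ℝ) 1, ∀ X : M,
      ‖NormedSpace.exp (s • Y ε) * X * NormedSpace.exp (-(s • Y ε))‖
        ≤ (‖(1 : M)‖ + 1) * (‖(1 : M)‖ + 1) * ‖X‖ := by
  have h1 : Tendsto (fun z : M => ‖NormedSpace.exp z‖) (𝓝 0) (𝓝 ‖(1 : M)‖) := by
    simpa using (continuous_exp_real (M := M)).norm.tendsto 0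
  obtain ⟨δ, hδ, hball⟩ := Metric.eventually_nhds_iff_ball.1
    (h1.eventually (gt_mem_nhds (lt_add_one ‖(1 : M)‖)))
  filter_upwards [hY.eventually (Metric.ball_mem_nhds 0 hδ)] with ε hε s hs X
  have h2 : ‖s • Y ε‖ < δ := by
    rw [dist_zero_right] at hε
    rw [norm_smul]
    exact (mul_le_of_le_one_left (norm_nonneg _) (abs_le.2 hs)).trans_lt hε
  have h3 := (hball (s • Y ε) (by simpa using h2)).le
  have h4 := (hball (-(s • Y ε)) (by simpa using h2)).le
  calc _ ≤ ‖NormedSpace.exp (s • Y ε)‖ * ‖X‖ * ‖NormedSpace.exp (-(s • Y ε))‖ :=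
        (norm_mul_le _ _).trans (mul_le_mul_of_nonneg_right (norm_mul_le _ _) (norm_nonneg _))
    _ ≤ (‖(1 : M)‖ + 1) * ‖X‖ * (‖(1 : M)‖ + 1) := by gcongr
    _ = _ := by ring

lemma conjPoly_norm_le (y : ℕ → M) (n : ℕ) {ε s : ℝ} (hε : ε ∈ Icc (0 : ℝ) 1)
    (hs : s ∈ Icc (0 : ℝ) 1) : ‖conjPoly y n ε s‖
      ≤ ∑ j ∈ Finset.range (n + 1), ∑ d ∈ Finset.range (n + 1), ‖nestedCoeff y j d‖ := by
  refine (norm_sum_le _ _).trans (Finset.sum_le_sum fun j _ => ?_)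
  rw [norm_smul, Real.norm_eq_abs,
    abs_of_nonneg (div_nonneg (pow_nonneg hs.1 _) (Nat.cast_nonneg _))]
  have h1 : s ^ j / (j.factorial : ℝ) ≤ 1 := by
    rw [div_le_one (by positivity)]
    exact (pow_le_one₀ hs.1 hs.2).trans (by exact_mod_cast j.factorial_pos)
  refine (mul_le_of_le_one_left (norm_nonneg _) h1).trans
    ((norm_sum_le _ _).trans (Finset.sum_le_sum fun d _ => ?_))
  rw [norm_smul, Real.norm_eq_abs, abs_of_nonneg (pow_nonneg hε.1 _)]
  exact mul_le_of_le_one_left (norm_nonneg _) (pow_le_one₀ hε.1 hε.2)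

/-- The coefficients of the logarithmic derivative in terms of the Magnus coefficients. -/
theorem logDerivCoeff_eq_sum_nestedCoeff (hT : 0 ≤ T) (hA : IntervalIntegrable A volume 0 T)
    {n d : ℕ} (hd : d ≤ n) :
    logDerivCoeff A d T = ∑ j ∈ Finset.range (n + 1),
      (1 / ((j + 1).factorial : ℝ)) • nestedCoeff (magnusCoeff A T) j d := by
  set y := magnusCoeff A T with hy
  set w : ℕ → M := fun d => ∑ j ∈ Finset.range (n + 1),
      (1 / ((j + 1).factorial : ℝ)) • nestedCoeff y j d with hw
  rw [← sub_eq_zero]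
  refine coeff_eq_zero_of_isBigO (c := fun d => logDerivCoeff A d T - w d) (n := n + 1) ?_ d
    (by omega)
  have hR := magnusRate_pos (A := A) hT
  obtain ⟨C, -, hC⟩ := logDerivCoeff_geometric hT hA one_pos
  have hb1 := (tsum_sub_sum_isBigO one_pos (fun m => hC m T ⟨hT, le_rfl⟩) (n + 1)).mono
    (nhdsWithin_le_nhds (s := Ioi (0 : ℝ)))
  suffices hb2 : (fun ε => logDerivSum A ε T - ∑ d ∈ Finset.range (n + 1), ε ^ d • w d)
      -- It is enough that both polynomials approximate the logarithmic derivative to O(ε^{n+1}) as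
      -- ε → 0+, since a polynomial of degree at most n of that size is zero.
      =O[𝓝[>] 0] fun ε : ℝ => ε ^ (n + 1) by
    refine (hb2.sub hb1).congr_left fun ε => ?_
    simp only [smul_sub, Finset.sum_sub_distrib, logDerivSum]
    abel
  obtain ⟨Y, hY0, hY⟩ := exists_log_eq_magnus hT hA
  -- C1 controls Y - K and C2 controls Y' - K'; C3 and C4 below bound `conjPoly` and its defect.
  -- These are the errors of comparing conjugation by the full logarithm with `conjPoly`.
  obtain ⟨C1, hC1⟩ := ((tsum_sub_sum_isBigO hR (magnusCoeff_norm_le_rate hT hA) (n + 1)).mono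
    (nhdsWithin_le_nhds (s := Ioi (0 : ℝ)))).bound
  obtain ⟨C2, hC2⟩ := ((tsum_sub_sum_isBigO hR (magnusTerm_norm_le_rate hT hA hA) (n + 1)).mono
    (nhdsWithin_le_nhds (s := Ioi (0 : ℝ)))).bound
  set C3 := ∑ j ∈ Finset.range (n + 1), ∑ d ∈ Finset.range (n + 1), ‖nestedCoeff y j d‖
  set C4 := ∑ p ∈ defectIndex n, ∑ j ∈ Finset.range (n + 1), ‖adL (y p.2) (nestedCoeff y j p.1)‖
  set c := (‖(1 : M)‖ + 1) * (‖(1 : M)‖ + 1) with hcdef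
  have hc0 : 0 ≤ c := by positivity
  have hC3 : 0 ≤ C3 := by positivity
  refine IsBigO.of_bound (c * (C2 + c * (‖(adL : M →L[ℝ] M →L[ℝ] M)‖ * C1 * C3 + C4))) ?_
  filter_upwards [hC1, hC2, nhdsWithin_le_nhds hY,
    nhdsWithin_le_nhds (eventually_norm_conj_exp_le hY0), self_mem_nhdsWithin,
    nhdsWithin_le_nhds (gt_mem_nhds one_pos)] with ε h1 h2 h3 hconj hpos hlt
  have hε : ε ∈ Icc (0 : ℝ) 1 := ⟨le_of_lt hpos, hlt.le⟩
  obtain ⟨-, -, -, -, hlog, hYε⟩ := h3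
  rw [Real.norm_eq_abs, abs_of_nonneg (pow_nonneg hε.1 _)] at h1 h2 ⊢
  have hpow : 0 ≤ ε ^ (n + 1) := pow_nonneg hε.1 _
  have hYK : ‖Y ε - truncExponent y n ε‖ ≤ C1 * ε ^ (n + 1) := by
    have : truncExponent y n ε = ε • ∑ m ∈ Finset.range (n + 1), ε ^ m • y m := by
      rw [truncExponent, Finset.smul_sum]
      exact Finset.sum_congr rfl fun m _ => by rw [pow_succ', mul_smul]
    rw [this, hYε, ← smul_sub, norm_smul, Real.norm_eq_abs, abs_of_nonneg hε.1]
    exact (mul_le_of_le_one_left (norm_nonneg _) hε.2).trans h1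
  rw [hlog, hw, ← integral_conjPoly, ← intervalIntegral.integral_sub
    ((continuous_conj_exp _ _).intervalIntegrable 0 1)
    ((continuous_conjPoly y n ε).intervalIntegrable 0 1)]
  have hmain := intervalIntegral.norm_integral_le_of_norm_le_const (a := 0) (b := 1)
    (f := fun s => NormedSpace.exp (s • Y ε)
        * (∑' k : ℕ, ε ^ k • (((k : ℝ) + 1) • magnusCoeff A T k))
        * NormedSpace.exp (-(s • Y ε)) - conjPoly y n ε s)
    (C := c * (C2 * ε ^ (n + 1)
      + c * (‖(adL : M →L[ℝ] M →L[ℝ] M)‖ * (C1 * ε ^ (n + 1)) * C3 + C4 * ε ^ (n + 1))))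
      fun s hs => by
    rw [uIoc_of_le zero_le_one] at hs
    refine (norm_conj_exp_sub_le hc0 hconj (hasDerivAt_conjPoly y n ε)
      (R := ‖(adL : M →L[ℝ] M →L[ℝ] M)‖ * (C1 * ε ^ (n + 1)) * C3 + C4 * ε ^ (n + 1))
      (fun s hs => ?_) (Ioc_subset_Icc_self hs)).trans ?_
    · have h4 : adL (truncExponent y n ε) (conjPoly y n ε s) - conjDefect y n ε s
          - adL (Y ε) (conjPoly y n ε s)
          = -(adL (Y ε - truncExponent y n ε) (conjPoly y n ε s)) - conjDefect y n ε s := by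
        rw [map_sub, sub_apply]; abel
      rw [h4]
      refine (norm_sub_le _ _).trans (add_le_add ?_ ?_)
      · rw [norm_neg]
        refine ((adL (Y ε - truncExponent y n ε)).le_opNorm _).trans ?_
        refine mul_le_mul (((adL : M →L[ℝ] M →L[ℝ] M).le_opNorm _).trans
          (mul_le_mul_of_nonneg_left hYK (norm_nonneg _))) (conjPoly_norm_le y n hε hs)
          (norm_nonneg _) ?_
        exact mul_nonneg (ContinuousLinearMap.opNorm_nonneg _) ((norm_nonneg _).trans hYK)
      · refine (conjDefect_norm_le y n hε.1 hs).trans ?_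
        rw [Finset.sum_mul]
        refine Finset.sum_le_sum fun p hp => ?_
        rw [mul_comm]
        refine mul_le_mul_of_nonneg_left ?_ (Finset.sum_nonneg fun _ _ => norm_nonneg _)
        simp only [defectIndex, Finset.mem_filter] at hp
        exact pow_le_pow_of_le_one hε.1 hε.2 (by omega)
    · gcongr
      rw [conjPoly_zero]
      exact h2
  refine hmain.trans (le_of_eq ?_)
  simp
  ring

end Nested

/-! ### Skew-adjoint generators: unitarity and the abstract truncation error -/

section Unitary

variable {M : Type*} [NormedRing M] [StarRing M] [CStarRing M] [NormedAlgebra ℝ M]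
  [StarModule ℝ M] [CompleteSpace M] {T : ℝ} {A : ℝ → M}

lemma exp_mem_unitary {K : M} (hK : K ∈ skewAdjoint M) : NormedSpace.exp K ∈ unitary M := by
  let _ : NormedAlgebra ℚ M := NormedAlgebra.restrictScalars ℚ ℝ M
  exact NormedSpace.exp_mem_unitary_of_mem_skewAdjoint hK

lemma norm_unitary_conj {u v : M} (hu : u ∈ unitary M) (hv : v ∈ unitary M) (X : M) :
    ‖u * X * v‖ = ‖X‖ := by
  rw [CStarRing.norm_mul_mem_unitary _ hv, CStarRing.norm_mem_unitary_mul _ hu]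

/-- The exponential is nonexpansive on skew-adjoint elements. -/
lemma norm_exp_sub_exp_le {K L : M} (hK : K ∈ skewAdjoint M) (hL : L ∈ skewAdjoint M) :
    ‖NormedSpace.exp L - NormedSpace.exp K‖ ≤ ‖L - K‖ := by
  rw [exp_sub_exp_eq_integral]
  have h := intervalIntegral.norm_integral_le_of_norm_le_const (a := 0) (b := 1)
    (f := fun s : ℝ => NormedSpace.exp (s • L) * (L - K) * NormedSpace.exp ((1 - s) • K))
    (C := ‖L - K‖) fun s _ => (norm_unitary_conj (exp_mem_unitary (skewAdjoint.smul_mem s hL))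
      (exp_mem_unitary (skewAdjoint.smul_mem (1 - s) hK)) _).le
  simpa using h

/-- The left logarithmic derivative of e^{Y} reappears here to the right of e^{-Y}, with a minus
sign; the substitution s → 1 - s brings the formula for -Y to this form. It can then be subtracted
directly from the logarithmic derivative of U. -/
lemma hasDerivAt_exp_neg_path {Y : ℝ → M} {Y' : M} {t : ℝ} (hY : HasDerivAt Y Y' t) :
    HasDerivAt (fun r => NormedSpace.exp (-Y r))
      (-(NormedSpace.exp (-Y t)
        * ∫ s in (0 : ℝ)..1, NormedSpace.exp (s • Y t) * Y' * NormedSpace.exp (-(s • Y t)))) t := by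
  refine (hasDerivAt_exp_path hY.neg).congr_deriv ?_
  let _ : NormedAlgebra ℚ M := NormedAlgebra.restrictScalars ℚ ℝ M
  set K := Y t
  have hadd : ∀ a b : ℝ, NormedSpace.exp (a • K) * NormedSpace.exp (b • K)
      = NormedSpace.exp ((a + b) • K) := fun a b => by
    rw [add_smul, NormedSpace.exp_add_of_commute
      (((Commute.refl K).smul_left a).smul_right b)]
  have h1 : ∀ s : ℝ, NormedSpace.exp (s • -K) * -Y' * NormedSpace.exp (-(s • -K))
      * NormedSpace.exp (-K)
      = -(NormedSpace.exp (-K) * (NormedSpace.exp ((1 - s) • K) * Y'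
        * NormedSpace.exp (-((1 - s) • K)))) := by
    intro s
    have e1 : NormedSpace.exp (-(s • -K)) * NormedSpace.exp (-K)
        = NormedSpace.exp (-((1 - s) • K)) := by
      have := hadd s (-1)
      rw [show -(s • -K) = s • K by module, show -K = (-1 : ℝ) • K by module, this]
      congr 1; module
    have e2 : NormedSpace.exp (-K) * NormedSpace.exp ((1 - s) • K) = NormedSpace.exp (s • -K) := by
      have := hadd (-1) (1 - s)
      rw [show -K = (-1 : ℝ) • K by module, this]
      congr 1; module
    rw [mul_assoc, e1, ← e2]
    noncomm_ring
  have hc := fun D : M => (continuous_conj_exp (-K) D).intervalIntegrable (μ := volume) 0 1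
  have h2 := ((ContinuousLinearMap.mul ℝ M).flip (NormedSpace.exp (-K))).intervalIntegral_comp_comm
    (hc (-Y'))
  simp only [ContinuousLinearMap.flip_apply, ContinuousLinearMap.mul_apply'] at h2
  refine h2.symm.trans ?_
  simp_rw [h1]
  rw [intervalIntegral.integral_neg, intervalIntegral.integral_comp_sub_left
    (fun s => NormedSpace.exp (-K) * (NormedSpace.exp (s • K) * Y' * NormedSpace.exp (-(s • K))))]
  congr 1
  have h3 := (ContinuousLinearMap.mul ℝ M (NormedSpace.exp (-K))).intervalIntegral_comp_comm
    ((continuous_conj_exp K Y').intervalIntegrable (μ := volume) 0 1)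
  simpa using h3

lemma dysonSum_isPrimitive (hT : 0 ≤ T) (hA : IntervalIntegrable A volume 0 T) (ε : ℝ) :
    IsPrimitive T (dysonSum A ε) (fun s => ε • (A s * dysonSum A ε s)) :=
  (picardSum_isPrimitive hT (intervalIntegrable_mulL hA) (isPrimitive_const T (1 : M)) ε).congr hT
    (fun _ _ => rfl) fun _ _ => (zero_add _).symm

lemma dysonSum_time_zero (ε : ℝ) : dysonSum A ε 0 = 1 := by
  rw [dysonSum, tsum_eq_single 0]
  · simp [dysonCoeff, picard]
  · intro m hm
    obtain ⟨m, rfl⟩ := Nat.exists_eq_succ_of_ne_zero hm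
    simp [dysonCoeff, picard]

lemma star_dysonSum_isPrimitive (hskew : ∀ t, A t ∈ skewAdjoint M) (hT : 0 ≤ T) (hA : IntervalIntegrable A volume 0 T) (ε : ℝ) :
    IsPrimitive T (fun t => star (dysonSum A ε t)) (fun s => -(ε • (star (dysonSum A ε s) * A s))) :=
  ((dysonSum_isPrimitive hT hA ε).map ((starL' ℝ : M ≃L[ℝ] M) : M →L[ℝ] M)).congr hT
    (fun _ _ => rfl) fun s _ => by
      simp [skewAdjoint.mem_iff.1 (hskew s)]

/-- The product rule gives U*U zero derivative, hence U*U = 1. Dedekind finiteness turns this left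
inverse into a two-sided one. -/
lemma dysonSum_mem_unitary [IsDedekindFiniteMonoid M] (hskew : ∀ t, A t ∈ skewAdjoint M)
    (hT : 0 ≤ T) (hA : IntervalIntegrable A volume 0 T) (ε : ℝ) {t : ℝ} (ht : t ∈ Icc 0 T) :
    dysonSum A ε t ∈ unitary M := by
  have h1 := (star_dysonSum_isPrimitive hskew hT hA ε).mul hT (dysonSum_isPrimitive hT hA ε)
  have h2 := (h1.congr hT (fun _ _ => rfl) (f' := fun _ => 0) (fun s _ => by
    rw [neg_mul, smul_mul_assoc, mul_smul_comm, mul_assoc, neg_add_cancel])).eq_integral t ht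
  have h3 : star (dysonSum A ε t) * dysonSum A ε t = 1 := by
    simpa [dysonSum_time_zero] using h2
  exact Unitary.mem_iff.2 ⟨h3, mul_eq_one_symm h3⟩

lemma logDerivSum_isPrimitive (hT : 0 ≤ T) (hA : IntervalIntegrable A volume 0 T) (ε : ℝ) :
    IsPrimitive T (logDerivSum A ε) (fun s => A s + ε • adL (A s) (logDerivSum A ε s)) :=
  picardSum_isPrimitive hT (intervalIntegrable_adL hA) (isPrimitive_integral hA) ε

lemma logDerivSum_time_zero (ε : ℝ) : logDerivSum A ε 0 = 0 := by
  rw [logDerivSum, tsum_congr fun m => ?_, tsum_zero]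
  cases m <;> simp [logDerivCoeff, picard]

lemma sum_logDerivCoeff_isPrimitive (hT : 0 ≤ T) (hA : IntervalIntegrable A volume 0 T) (ε : ℝ)
    (n : ℕ) :
    IsPrimitive T (fun t => ∑ d ∈ Finset.range (n + 1), ε ^ d • logDerivCoeff A d t)
      (fun s => A s + ε • adL (A s) (∑ d ∈ Finset.range n, ε ^ d • logDerivCoeff A d s)) := by
  refine (IsPrimitive.sum _ fun d _ => (logDerivCoeff_isPrimitive hT hA d).const_smul
    (ε ^ d)).congr hT (fun _ _ => rfl) fun s _ => ?_
  rw [Finset.sum_range_succ', add_comm, map_sum, Finset.smul_sum]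
  simp only [pow_zero, one_smul, pow_succ', mul_smul, map_smul]

/-- The remainder of the series `∑ ε ^ d ζ_d` is controlled by its first dropped term. -/
lemma norm_logDerivSum_sub_le [IsDedekindFiniteMonoid M] (hskew : ∀ t, A t ∈ skewAdjoint M)
    (hT : 0 ≤ T) (hA : IntervalIntegrable A volume 0 T) {ε : ℝ} (hε : 0 ≤ ε) (n : ℕ) :
    ‖logDerivSum A ε T - ∑ d ∈ Finset.range (n + 1), ε ^ d • logDerivCoeff A d T‖
      ≤ ε ^ (n + 1) * ∫ s in (0 : ℝ)..T, ‖adL (A s) (logDerivCoeff A n s)‖ := by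
  set U := dysonSum A ε
  set G : ℝ → M := fun t => ∑ d ∈ Finset.range (n + 1), ε ^ d • logDerivCoeff A d t with hG
  set ρ : ℝ → M := fun t => logDerivSum A ε t + (-1 : ℝ) • G t with hρ
  -- The remainder solves ρ' = ε[A,ρ] + ε^{n+1}[A,ζ_n]. In U*ρU the homogeneous part cancels, and
  -- unitarity leaves the norm of the source unchanged.
  have hUmem : ∀ t ∈ Icc 0 T, U t ∈ unitary M := fun t ht =>
    dysonSum_mem_unitary hskew hT hA ε ht
  have hρp : IsPrimitive T ρ (fun s => ε • adL (A s) (ρ s)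
      + ε ^ (n + 1) • adL (A s) (logDerivCoeff A n s)) := by
    refine ((logDerivSum_isPrimitive hT hA ε).add
      ((sum_logDerivCoeff_isPrimitive hT hA ε n).const_smul (-1))).congr hT
      (fun _ _ => rfl) fun s _ => ?_
    simp only [hρ, hG, Finset.sum_range_succ]
    rw [map_add, map_smul, map_add, map_smul _ (ε ^ n), pow_succ']
    module
  have hp := (((star_dysonSum_isPrimitive hskew hT hA ε).mul hT hρp).mul hT
    (dysonSum_isPrimitive hT hA ε)).congr hT (fun _ _ => rfl)
    (f' := fun s => ε ^ (n + 1) • (star (U s) * adL (A s) (logDerivCoeff A n s) * U s))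
    (fun s _ => by
      simp only [adL_apply, neg_mul, smul_mul_assoc, mul_smul_comm, mul_add, add_mul, mul_sub,
        sub_mul, smul_sub, mul_assoc]
      abel)
  have hζ : ContinuousOn (logDerivCoeff A n) (Icc 0 T) :=
    (logDerivCoeff_isPrimitive hT hA n).continuousOn hT
  have hint := intervalIntegrable_clm_apply hT (intervalIntegrable_adL hA) hζ
  have h1 := hp.norm_sub_le (hint.norm.const_mul (ε ^ (n + 1))) (fun s hs => by
    rw [norm_smul, Real.norm_eq_abs, abs_of_nonneg (pow_nonneg hε _),
      norm_unitary_conj (Unitary.star_mem (hUmem s hs)) (hUmem s hs)]) ⟨hT, le_rfl⟩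
  have h0 : ρ 0 = 0 := by
    simp only [hρ, hG, logDerivSum_time_zero, logDerivCoeff_zero, smul_zero, Finset.sum_const_zero,
      add_zero]
  rw [h0, mul_zero, zero_mul, sub_zero, norm_unitary_conj (Unitary.star_mem (hUmem T ⟨hT, le_rfl⟩))
    (hUmem T ⟨hT, le_rfl⟩), intervalIntegral.integral_const_mul] at h1
  simpa only [hρ, neg_smul, one_smul, ← sub_eq_add_neg] using h1

lemma star_adL {a b : M} (ha : a ∈ skewAdjoint M) (hb : b ∈ skewAdjoint M) :
    adL a b ∈ skewAdjoint M := by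
  rw [skewAdjoint.mem_iff] at *
  simp [ha, hb]

lemma magnusCoeff_mem_skewAdjoint (hskew : ∀ t, A t ∈ skewAdjoint M) (n : ℕ) :
    magnusCoeff A T n ∈ skewAdjoint M := by
  have hw : ∀ n t, word (fun s => adL (A s)) A n t ∈ skewAdjoint M := by
    intro n
    induction n with
    | zero => exact fun t => hskew _
    | succ n ih => exact fun t => star_adL (hskew _) (ih _)
  have hi : ∀ σ : Equiv.Perm (Fin (n + 1)), ∫ t in orderedTimes (n + 1) T,
      word (fun s => adL (A s)) A n (fun i => t (σ i)) ∈ skewAdjoint M := by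
    intro σ
    rw [skewAdjoint.mem_iff]
    have h := ((starL' ℝ : M ≃L[ℝ] M)).integral_comp_comm (μ := volume.restrict
      (orderedTimes (n + 1) T)) (fun t => word (fun s => adL (A s)) A n (fun i => t (σ i)))
    change ∫ t in orderedTimes (n + 1) T, star (word (fun s => adL (A s)) A n (fun i => t (σ i)))
      = star _ at h
    rw [← h, ← integral_neg]
    exact integral_congr_ae (Eventually.of_forall fun t => skewAdjoint.mem_iff.1 (hw n _))
  exact skewAdjoint.smul_mem _ (sum_mem fun σ _ => skewAdjoint.smul_mem _ (hi σ))

/-- The distance between the time-ordered exponential and the exponential of the truncated Magnus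
series. -/
theorem norm_dysonSum_sub_exp_le [IsDedekindFiniteMonoid M] (hskew : ∀ t, A t ∈ skewAdjoint M)
    (hT : 0 ≤ T) (hA : IntervalIntegrable A volume 0 T) (n : ℕ) {C₁ C₂ : ℝ}
    (h₁ : ∫ s in (0 : ℝ)..T, ‖adL (A s) (logDerivCoeff A n s)‖ ≤ C₁)
    (h₂ : ∑ p ∈ defectIndex n, ∑ j ∈ Finset.range (n + 1),
      ‖adL (magnusCoeff A T p.2) (nestedCoeff (magnusCoeff A T) j p.1)‖ ≤ C₂) :
    ‖dysonSum A 1 T - NormedSpace.exp (∑ m ∈ Finset.range (n + 1), magnusCoeff A T m)‖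
      ≤ (C₁ + C₂) / (n + 2) := by
  set y := magnusCoeff A T with hy
  set K : ℝ → M := truncExponent y n with hK
  have hKs : ∀ ε, K ε ∈ skewAdjoint M := fun ε =>
    sum_mem fun m _ => skewAdjoint.smul_mem _ (magnusCoeff_mem_skewAdjoint hskew m)
  set β : ℝ → M := fun ε => ∫ s in (0 : ℝ)..1, NormedSpace.exp (s • K ε) * conjPoly y n ε 0
        * NormedSpace.exp (-(s • K ε)) with hβ
  -- Both sides are compared with their common Taylor polynomial. Conjugation is isometric, so c =
  -- 1; defect powers have exponent at least n + 1 and are reduced to ε^{n+1} using ε ≤ 1.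
  have hαβ : ∀ ε ∈ Icc (0 : ℝ) 1, ‖logDerivSum A ε T - β ε‖ ≤ (C₁ + C₂) * ε ^ (n + 1) := by
    intro ε hε
    have hpow : 0 ≤ ε ^ (n + 1) := pow_nonneg hε.1 _
    have h3 := norm_logDerivSum_sub_le hskew hT hA hε.1 n
    have h4 := norm_logDeriv_exp_sub_le y n (ε := ε) (c := 1) (R := C₂ * ε ^ (n + 1)) zero_le_one
      (fun s _ X => by
        rw [one_mul, norm_unitary_conj (exp_mem_unitary (skewAdjoint.smul_mem s (hKs ε)))]
        exact exp_mem_unitary (neg_mem (skewAdjoint.smul_mem s (hKs ε))))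
      (fun s hs => by
        refine (conjDefect_norm_le y n hε.1 hs).trans ?_
        refine le_trans ?_ (mul_le_mul_of_nonneg_right h₂ hpow)
        rw [Finset.sum_mul]
        refine Finset.sum_le_sum fun p hp => ?_
        rw [mul_comm]
        refine mul_le_mul_of_nonneg_left ?_ (Finset.sum_nonneg fun _ _ => norm_nonneg _)
        simp only [defectIndex, Finset.mem_filter] at hp
        exact pow_le_pow_of_le_one hε.1 hε.2 (by omega))
    have h5 : ∑ d ∈ Finset.range (n + 1), ε ^ d • ∑ j ∈ Finset.range (n + 1),
        (1 / ((j + 1).factorial : ℝ)) • nestedCoeff y j d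
        = ∑ d ∈ Finset.range (n + 1), ε ^ d • logDerivCoeff A d T :=
      Finset.sum_congr rfl fun d hd => by
        rw [logDerivCoeff_eq_sum_nestedCoeff hT hA (Nat.lt_succ_iff.1 (Finset.mem_range.1 hd))]
    rw [h5, one_mul, one_mul] at h4
    rw [norm_sub_rev] at h4
    have h6 := norm_sub_le_norm_sub_add_norm_sub (logDerivSum A ε T)
      (∑ d ∈ Finset.range (n + 1), ε ^ d • logDerivCoeff A d T) (β ε)
    have h7 := mul_le_mul_of_nonneg_left h₁ hpow
    linarith
  have hKd : ∀ ε, HasDerivAt K (conjPoly y n ε 0) ε := hasDerivAt_truncExponent y n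
  -- The error seen from e^{K}; integrating its derivative bound ε^{n+1} over [0,1] produces the
  -- denominator n + 2.
  set f : ℝ → M := fun ε => NormedSpace.exp (-K ε) * dysonSum A ε T - 1 with hf
  have hfd : ∀ ε, HasDerivAt f
      (NormedSpace.exp (-K ε) * (logDerivSum A ε T - β ε) * dysonSum A ε T) ε := by
    intro ε
    refine (((hasDerivAt_exp_neg_path (hKd ε)).mul (hasDerivAt_dysonSum hT hA ε)).sub_const
      1).congr_deriv ?_
    simp only [hβ]
    noncomm_ring
  have hB : ∀ ε : ℝ, HasDerivAt (fun ε : ℝ => (C₁ + C₂) / (n + 2) * ε ^ (n + 2))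
      ((C₁ + C₂) * ε ^ (n + 1)) ε := by
    intro ε
    refine ((hasDerivAt_pow (n + 2) ε).const_mul ((C₁ + C₂) / (n + 2))).congr_deriv ?_
    push_cast
    have : (n : ℝ) + 2 ≠ 0 := by positivity
    field_simp
  have hend := image_norm_le_of_norm_deriv_right_le_deriv_boundary (f := f) (a := 0) (b := 1)
    (fun ε _ => (hfd ε).continuousAt.continuousWithinAt)
    (fun ε _ => (hfd ε).hasDerivWithinAt) (by
      simp [hf, hK, truncExponent, dysonSum_zero]) hB (fun ε hε => by
      rw [norm_unitary_conj (exp_mem_unitary (neg_mem (hKs ε)))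
        (dysonSum_mem_unitary hskew hT hA ε ⟨hT, le_rfl⟩)]
      exact hαβ ε (Ico_subset_Icc_self hε)) (right_mem_Icc.2 zero_le_one)
  have hK1 : ∑ m ∈ Finset.range (n + 1), y m = K 1 := by simp [hK, truncExponent]
  have h8 : dysonSum A 1 T - NormedSpace.exp (K 1) = NormedSpace.exp (K 1) * f 1 := by
    simp only [hf]
    rw [mul_sub, ← mul_assoc, exp_mul_exp_neg, one_mul, mul_one]
  rw [hK1, h8, CStarRing.norm_mem_unitary_mul _ (exp_mem_unitary (hKs 1))]
  simpa using hend

end Unitary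

/-! ### Local operators, families indexed by spin subsets, and their commutators -/

section Locality

variable {N d : ℕ} {X Y : Finset (Fin N)} {A B : Op N d}

lemma ActsOn.mono (hA : ActsOn X A) (h : X ⊆ Y) : ActsOn Y A := by
  classical
  obtain ⟨a, ha⟩ := hA
  refine ⟨Matrix.of fun s t => if ∀ i : Y, (i : Fin N) ∉ X → s i = t i then
    a (fun i => s ⟨i, h i.2⟩) (fun i => t ⟨i, h i.2⟩) else 0,
    fun σ τ => ⟨fun hY => ?_, fun hY => ?_⟩⟩
  · by_cases hX : ∀ i, i ∉ X → σ i = τ i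
    · rw [(ha σ τ).1 hX, Matrix.of_apply]
      exact (if_pos fun (i : Y) hi => hX i.1 hi).symm
    · rw [(ha σ τ).2 hX, Matrix.of_apply, if_neg]
      intro h'
      refine hX fun i hi => ?_
      by_cases hiY : i ∈ Y
      · exact h' ⟨i, hiY⟩ hi
      · exact hY i hiY
  · exact (ha σ τ).2 fun h' => hY fun i hi => h' i fun hX => hi (h hX)

/-- The operator `a ⊗ 1`. -/
def localOp (X : Finset (Fin N)) (a : Matrix (X → Fin d) (X → Fin d) ℂ) : Op N d :=
  (Matrix.kroneckerMap (· * ·) a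
    (1 : Matrix ({i // i ∉ X} → Fin d) ({i // i ∉ X} → Fin d) ℂ)).submatrix
    (Equiv.piEquivPiSubtypeProd (fun i => i ∈ X) fun _ => Fin d)
    (Equiv.piEquivPiSubtypeProd (fun i => i ∈ X) fun _ => Fin d)

lemma actsOn_iff : ActsOn X A ↔ ∃ a, A = localOp X a := by
  refine exists_congr fun a => ⟨fun h => ?_, fun h => ?_⟩
  · ext σ τ
    simp only [localOp, Matrix.submatrix_apply, Matrix.kroneckerMap_apply, Matrix.one_apply,
      Equiv.piEquivPiSubtypeProd_apply]
    by_cases hX : ∀ i, i ∉ X → σ i = τ i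
    · rw [(h σ τ).1 hX, if_pos (funext fun i : {i // i ∉ X} => hX i.1 i.2), mul_one]
    · rw [(h σ τ).2 hX, if_neg fun h' => hX fun i hi => congrFun h' ⟨i, hi⟩, mul_zero]
  · subst h
    intro σ τ
    simp only [localOp, Matrix.submatrix_apply, Matrix.kroneckerMap_apply, Matrix.one_apply,
      Equiv.piEquivPiSubtypeProd_apply]
    refine ⟨fun hX => ?_, fun hX => ?_⟩
    · rw [if_pos (funext fun i : {i // i ∉ X} => hX i.1 i.2), mul_one]
    · rw [if_neg fun h' => hX fun i hi => congrFun h' ⟨i, hi⟩, mul_zero]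

lemma ActsOn.mul (hA : ActsOn X A) (hB : ActsOn X B) : ActsOn X (A * B) := by
  rw [actsOn_iff] at *
  obtain ⟨a, rfl⟩ := hA
  obtain ⟨b, rfl⟩ := hB
  refine ⟨a * b, ?_⟩
  have h := Matrix.mul_kronecker_mul a b
    (1 : Matrix ({i // i ∉ X} → Fin d) ({i // i ∉ X} → Fin d) ℂ)
    (1 : Matrix ({i // i ∉ X} → Fin d) ({i // i ∉ X} → Fin d) ℂ)
  rw [mul_one] at h
  simp only [localOp]
  rw [Matrix.submatrix_mul_equiv]
  exact congrArg (fun m => Matrix.submatrix m _ _) h.symm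

lemma ActsOn.add (hA : ActsOn X A) (hB : ActsOn X B) : ActsOn X (A + B) := by
  obtain ⟨a, ha⟩ := hA
  obtain ⟨b, hb⟩ := hB
  refine ⟨a + b, fun σ τ => ⟨fun h => ?_, fun h => ?_⟩⟩
  · rw [Matrix.add_apply, (ha σ τ).1 h, (hb σ τ).1 h]; rfl
  · rw [Matrix.add_apply, (ha σ τ).2 h, (hb σ τ).2 h, add_zero]

lemma ActsOn.smul {R : Type*} [SMulZeroClass R ℂ] (hA : ActsOn X A) (c : R) :
    ActsOn X (c • A) := by
  obtain ⟨a, ha⟩ := hA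
  refine ⟨c • a, fun σ τ => ⟨fun h => ?_, fun h => ?_⟩⟩
  · rw [Matrix.smul_apply, (ha σ τ).1 h]; rfl
  · rw [Matrix.smul_apply, (ha σ τ).2 h, smul_zero]

lemma actsOn_zero : ActsOn X (0 : Op N d) := ⟨0, fun _ _ => ⟨fun _ => rfl, fun _ => rfl⟩⟩

/-- The operators that act on `X` only, as a real subspace. -/
def actsOnSubmodule (X : Finset (Fin N)) : Submodule ℝ (Op N d) where
  carrier := {A | ActsOn X A}
  add_mem' := ActsOn.add
  zero_mem' := actsOn_zero
  smul_mem' c _ hA := hA.smul c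

/-- Only one intermediate configuration contributes: it agrees with σ off X and with τ off Y, hence
with τ on X. The resulting entry is symmetric in the two operators, which is why they commute. -/
lemma ActsOn.mul_apply_of_disjoint {a : Matrix (X → Fin d) (X → Fin d) ℂ}
    {b : Matrix (Y → Fin d) (Y → Fin d) ℂ} (hXY : Disjoint X Y)
    (ha : ∀ σ τ : Fin N → Fin d,
      ((∀ i, i ∉ X → σ i = τ i) → A σ τ = a (fun i => σ i) (fun i => τ i)) ∧
      ((¬ ∀ i, i ∉ X → σ i = τ i) → A σ τ = 0))
    (hb : ∀ σ τ : Fin N → Fin d,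
      ((∀ i, i ∉ Y → σ i = τ i) → B σ τ = b (fun i => σ i) (fun i => τ i)) ∧
      ((¬ ∀ i, i ∉ Y → σ i = τ i) → B σ τ = 0)) (σ τ : Fin N → Fin d) :
    (A * B) σ τ = open Classical in if ∀ i, i ∉ X → i ∉ Y → σ i = τ i then
      a (fun i => σ i) (fun i => τ i) * b (fun i => σ i) (fun i => τ i) else 0 := by
  classical
  rw [Matrix.mul_apply, Finset.sum_eq_single (X.piecewise τ σ)]
  · have h1 : ∀ i, i ∉ X → σ i = X.piecewise τ σ i := fun i hi => by
      rw [Finset.piecewise_eq_of_notMem _ _ _ hi]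
    rw [(ha _ _).1 h1]
    by_cases h2 : ∀ i, i ∉ X → i ∉ Y → σ i = τ i
    · rw [if_pos h2, (hb _ _).1 fun i hi => ?_]
      · congr 2
        · funext i
          exact Finset.piecewise_eq_of_mem _ _ _ i.2
        · funext i
          exact Finset.piecewise_eq_of_notMem _ _ _ (Finset.disjoint_right.1 hXY i.2)
      · by_cases hX : i ∈ X
        · exact Finset.piecewise_eq_of_mem _ _ _ hX
        · rw [Finset.piecewise_eq_of_notMem _ _ _ hX]; exact h2 i hX hi
    · rw [if_neg h2, (hb _ _).2 fun h3 => h2 fun i hX hY => ?_, mul_zero]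
      rw [← h3 i hY, Finset.piecewise_eq_of_notMem _ _ _ hX]
  · intro ρ _ hρ
    by_contra hne
    have h1 : ∀ i, i ∉ X → σ i = ρ i := by
      by_contra h; exact hne (by rw [(ha _ _).2 h, zero_mul])
    have h2 : ∀ i, i ∉ Y → ρ i = τ i := by
      by_contra h; exact hne (by rw [(hb _ _).2 h, mul_zero])
    refine hρ (funext fun i => ?_)
    by_cases hX : i ∈ X
    · rw [Finset.piecewise_eq_of_mem _ _ _ hX]; exact h2 i (Finset.disjoint_left.1 hXY hX)
    · rw [Finset.piecewise_eq_of_notMem _ _ _ hX]; exact (h1 i hX).symm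
  · simp

lemma ActsOn.adL_eq_zero (hA : ActsOn X A) (hB : ActsOn Y B) (hXY : Disjoint X Y) :
    adL A B = 0 := by
  obtain ⟨a, ha⟩ := hA
  obtain ⟨b, hb⟩ := hB
  rw [adL_apply, sub_eq_zero]
  ext σ τ
  rw [ActsOn.mul_apply_of_disjoint hXY ha hb, ActsOn.mul_apply_of_disjoint hXY.symm hb ha]
  refine if_congr ⟨fun h i h1 h2 => h i h2 h1, fun h i h1 h2 => h i h2 h1⟩ (mul_comm _ _) rfl

lemma ActsOn.adL (hA : ActsOn X A) (hB : ActsOn Y B) : ActsOn (X ∪ Y) (adL A B) := by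
  have hA' := hA.mono (Finset.subset_union_left (s₂ := Y))
  have hB' := hB.mono (Finset.subset_union_right (s₁ := X))
  rw [adL_apply]
  exact (actsOnSubmodule (X ∪ Y)).sub_mem (hA'.mul hB') (hB'.mul hA')

lemma norm_adL_le (A B : Op N d) : ‖FloquetMagnus.adL A B‖ ≤ 2 * ‖A‖ * ‖B‖ := by
  rw [adL_apply]
  have h1 := norm_mul_le A B
  have h2 := norm_mul_le B A
  linarith [norm_sub_le (A * B) (B * A)]

/-- Families of operators indexed by the spin subsets, with the norm `∑_X ‖x_X‖`. -/
def Family (N d : ℕ) : Type := PiLp 1 fun _ : Finset (Fin N) => Op N d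

instance : NormedAddCommGroup (Family N d) :=
  inferInstanceAs (NormedAddCommGroup (PiLp 1 fun _ : Finset (Fin N) => Op N d))

instance : NormedSpace ℝ (Family N d) :=
  inferInstanceAs (NormedSpace ℝ (PiLp 1 fun _ : Finset (Fin N) => Op N d))

instance : FiniteDimensional ℝ (Family N d) := by
  have : FiniteDimensional ℝ (Op N d) := FiniteDimensional.complexToReal _
  exact inferInstanceAs (FiniteDimensional ℝ (PiLp 1 fun _ : Finset (Fin N) => Op N d))

instance : CoeFun (Family N d) fun _ => Finset (Fin N) → Op N d := ⟨fun x => x.ofLp⟩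

/-- The family with the given members. -/
def Family.of (x : Finset (Fin N) → Op N d) : Family N d := WithLp.toLp 1 x

@[simp] lemma Family.of_apply (x : Finset (Fin N) → Op N d) (X : Finset (Fin N)) :
    Family.of x X = x X := rfl

@[simp] lemma Family.add_apply (x y : Family N d) (X : Finset (Fin N)) :
    (x + y) X = x X + y X := rfl

@[simp] lemma Family.smul_apply (c : ℝ) (x : Family N d) (X : Finset (Fin N)) :
    (c • x) X = c • x X := rfl

@[simp] lemma Family.zero_apply (X : Finset (Fin N)) : (0 : Family N d) X = 0 := rfl

lemma Family.ext {x y : Family N d} (h : ∀ X, x X = y X) : x = y :=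
  PiLp.ext h

lemma Family.norm_eq (x : Family N d) : ‖x‖ = ∑ X, ‖x X‖ :=
  PiLp.norm_eq_of_L1 (β := fun _ : Finset (Fin N) => Op N d) x

/-- The sum of a family. -/
def familySum : Family N d →L[ℝ] Op N d :=
  LinearMap.mkContinuous
    { toFun := fun x => ∑ X, x X
      map_add' := fun x y => by simp [Finset.sum_add_distrib]
      map_smul' := fun c x => by simp [Finset.smul_sum] } 1
    fun x => by
      rw [one_mul, Family.norm_eq]
      exact norm_sum_le Finset.univ fun X => x X

lemma familySum_apply (x : Family N d) : familySum x = ∑ X, x X := rfl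

lemma norm_familySum_le (x : Family N d) : ‖familySum x‖ ≤ ‖x‖ := by
  rw [Family.norm_eq]
  exact norm_sum_le Finset.univ fun X => x X

/-- The overlapping pairs of spin subsets with union `Z`. -/
def overlapping (Z : Finset (Fin N)) : Finset (Finset (Fin N) × Finset (Fin N)) :=
  Finset.univ.filter fun p => p.1 ∪ p.2 = Z ∧ ¬ Disjoint p.1 p.2

lemma sum_overlapping {E : Type*} [AddCommMonoid E] (g : Finset (Fin N) × Finset (Fin N) → E) :
    ∑ Z, ∑ p ∈ overlapping Z, g p
      = ∑ Y, ∑ X ∈ Finset.univ.filter (fun X => ¬ Disjoint X Y), g (X, Y) := by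
  have h1 : ∀ Z : Finset (Fin N), ∑ p ∈ overlapping Z, g p
      = ∑ p ∈ (Finset.univ.filter fun p : Finset (Fin N) × Finset (Fin N) => ¬ Disjoint p.1 p.2)
        with p.1 ∪ p.2 = Z, g p := fun Z => by
    rw [Finset.filter_filter]
    refine Finset.sum_congr (Finset.filter_congr fun p _ => and_comm) fun _ _ => rfl
  simp_rw [h1]
  rw [Finset.sum_fiberwise (Finset.univ.filter fun p : Finset (Fin N) × Finset (Fin N) =>
    ¬ Disjoint p.1 p.2) (fun p => p.1 ∪ p.2) g, Finset.sum_filter, Fintype.sum_prod_type_right]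
  refine Finset.sum_congr rfl fun Y _ => ?_
  rw [Finset.sum_filter]

/-- The family of commutators `∑_{X ∪ Y = Z, X ∩ Y ≠ ∅} [a_X, x_Y]`. -/
def familyAd (a x : Family N d) : Family N d :=
  Family.of fun Z => ∑ p ∈ overlapping Z, adL (a p.1) (x p.2)

lemma norm_familyAd_le (a x : Family N d) :
    ‖familyAd a x‖ ≤ ∑ Y, 2 * (∑ X ∈ Finset.univ.filter (fun X => ¬ Disjoint X Y), ‖a X‖) * ‖x Y‖ := by
  rw [Family.norm_eq]
  calc ∑ Z, ‖familyAd a x Z‖ ≤ ∑ Z, ∑ p ∈ overlapping Z, ‖adL (a p.1) (x p.2)‖ :=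
        Finset.sum_le_sum fun Z _ => norm_sum_le _ _
    _ = ∑ Y, ∑ X ∈ Finset.univ.filter (fun X => ¬ Disjoint X Y), ‖adL (a X) (x Y)‖ :=
        sum_overlapping fun p => ‖adL (a p.1) (x p.2)‖
    _ ≤ _ := Finset.sum_le_sum fun Y _ => by
        rw [Finset.mul_sum, Finset.sum_mul]
        exact Finset.sum_le_sum fun X _ => norm_adL_le _ _

/-- `familyAd` as a continuous bilinear map. -/
def familyAdL : Family N d →L[ℝ] Family N d →L[ℝ] Family N d :=
  LinearMap.mkContinuous₂
    (LinearMap.mk₂ ℝ familyAd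
      (fun a b x => Family.ext fun Z => by
        simp [familyAd, -adL_apply, Finset.sum_add_distrib])
      (fun c a x => Family.ext fun Z => by
        simp [familyAd, -adL_apply, Finset.smul_sum])
      (fun a x y => Family.ext fun Z => by
        simp [familyAd, -adL_apply, Finset.sum_add_distrib])
      (fun c a x => Family.ext fun Z => by
        simp [familyAd, -adL_apply, Finset.smul_sum])) 2
    fun a x => by
      refine (norm_familyAd_le a x).trans ?_
      rw [Family.norm_eq x, Finset.mul_sum]
      refine Finset.sum_le_sum fun Y _ => ?_
      rw [Family.norm_eq a]
      gcongr
      exact Finset.filter_subset _ _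

/-- The families `x` of operators `x_X` acting on `X`, with `x_X = 0` unless `|X| ≤ q`. -/
def localFamilies (q : ℕ) : Submodule ℝ (Family N d) where
  carrier := {x | ∀ X, ActsOn X (x X) ∧ (q < X.card → x X = 0)}
  add_mem' hx hy X := ⟨(hx X).1.add (hy X).1, fun h => by
    simp [(hx X).2 h, (hy X).2 h]⟩
  zero_mem' X := ⟨actsOn_zero, fun _ => rfl⟩
  smul_mem' c x hx X := ⟨(hx X).1.smul c, fun h => by simp [(hx X).2 h]⟩

lemma localFamilies_mono {p q : ℕ} (h : p ≤ q) :
    (localFamilies p : Submodule ℝ (Family N d)) ≤ localFamilies q :=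
  fun _ hx X => ⟨(hx X).1, fun hX => (hx X).2 (h.trans_lt hX)⟩

lemma familyAd_mem {p q : ℕ} {a x : Family N d} (ha : a ∈ localFamilies p)
    (hx : x ∈ localFamilies q) : familyAdL a x ∈ localFamilies (q + p) := by
  intro Z
  change ActsOn Z (∑ p ∈ overlapping Z, adL (a p.1) (x p.2)) ∧
    (_ → ∑ p ∈ overlapping Z, adL (a p.1) (x p.2) = 0)
  refine ⟨(actsOnSubmodule Z).sum_mem fun r hr => ?_, fun hZ => Finset.sum_eq_zero fun r hr => ?_⟩
  · simp only [overlapping, Finset.mem_filter] at hr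
    rw [← hr.2.1]
    exact (ha r.1).1.adL (hx r.2).1
  · simp only [overlapping, Finset.mem_filter] at hr
    rw [← hr.2.1] at hZ
    have := Finset.card_union_le r.1 r.2
    by_cases h1 : p < r.1.card
    · rw [(ha r.1).2 h1, map_zero]; rfl
    · rw [(hx r.2).2 (by omega), map_zero]

/-- Pairs with disjoint supports commute, so leaving them out of `familyAd` does not change the
operator. Leaving them out is what makes the family bound independent of N. -/
lemma familySum_familyAd {p q : ℕ} {a x : Family N d} (ha : a ∈ localFamilies p)
    (hx : x ∈ localFamilies q) : familySum (familyAdL a x) = adL (familySum a) (familySum x) := by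
  have h1 : familySum (familyAdL a x) = ∑ Z, ∑ p ∈ overlapping Z, adL (a p.1) (x p.2) := rfl
  rw [h1, sum_overlapping fun p => adL (a p.1) (x p.2), familySum_apply, familySum_apply, map_sum]
  refine Finset.sum_congr rfl fun Y _ => ?_
  rw [map_sum, sum_apply, Finset.sum_filter]
  refine Finset.sum_congr rfl fun X _ => ?_
  split_ifs with h
  · exact ((ha X).1.adL_eq_zero (hx Y).1 h).symm
  · rfl

/-- The commutator with an interaction of strength `J` on families of operators on at most `q`
spins. -/
lemma norm_familyAdL_le {q : ℕ} {J : ℝ} {a x : Family N d}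
    (ha : ∀ i : Fin N, ∑ X ∈ Finset.univ.filter (fun X => i ∈ X), ‖a X‖ ≤ J) (hJ : 0 ≤ J)
    (hx : x ∈ localFamilies q) : ‖familyAdL a x‖ ≤ 2 * q * J * ‖x‖ := by
  refine (norm_familyAd_le a x).trans ?_
  rw [Family.norm_eq x, Finset.mul_sum]
  refine Finset.sum_le_sum fun Y _ => ?_
  by_cases hY : q < Y.card
  · rw [(hx Y).2 hY]; simp
  -- A set X meeting Y contains some i ∈ Y; a union bound over the at most q sites of Y uses the
  -- local strength at each of them.
  have h1 : ∑ X ∈ Finset.univ.filter (fun X => ¬ Disjoint X Y), ‖a X‖ ≤ q * J := by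
    calc _ ≤ ∑ X, ∑ i ∈ Y, if i ∈ X then ‖a X‖ else 0 := by
          rw [Finset.sum_filter]
          refine Finset.sum_le_sum fun X _ => ?_
          have h0 : ∀ i ∈ Y, 0 ≤ if i ∈ X then ‖a X‖ else 0 := fun i _ => by
            split_ifs <;> positivity
          split_ifs with hX
          · exact Finset.sum_nonneg h0
          · obtain ⟨i, hiX, hiY⟩ := Finset.not_disjoint_iff.1 hX
            have := Finset.single_le_sum h0 hiY
            rwa [if_pos hiX] at this
      _ = ∑ i ∈ Y, ∑ X ∈ Finset.univ.filter (fun X => i ∈ X), ‖a X‖ := by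
          rw [Finset.sum_comm]
          exact Finset.sum_congr rfl fun i _ => (Finset.sum_filter _ _).symm
      _ ≤ ∑ i ∈ Y, J := Finset.sum_le_sum fun i _ => ha i
      _ = Y.card * J := by simp
      _ ≤ q * J := by gcongr; omega
  calc _ ≤ 2 * (q * J) * ‖x Y‖ := by gcongr
    _ = _ := by ring

/-- In finite dimension a linear projection onto the subspace is continuous and commutes with the
integral. A non-integrable function has integral 0, which also lies in the subspace. -/
lemma integral_mem_submodule {E α : Type*} [NormedAddCommGroup E] [NormedSpace ℝ E]
    [FiniteDimensional ℝ E] [MeasurableSpace α] {μ : Measure α} (p : Submodule ℝ E) {f : α → E}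
    (hf : ∀ t, f t ∈ p) : ∫ t, f t ∂μ ∈ p := by
  by_cases hi : Integrable f μ
  · obtain ⟨g, hg⟩ := p.subtype.exists_leftInverse_of_injective p.ker_subtype
    have h1 : ∀ t, LinearMap.toContinuousLinearMap (p.subtype ∘ₗ g) (f t) = f t := fun t => by
      have := LinearMap.congr_fun hg ⟨f t, hf t⟩
      simp only [LinearMap.comp_apply, Submodule.subtype_apply, LinearMap.id_apply] at this
      simp [this]
    have h2 := (LinearMap.toContinuousLinearMap (p.subtype ∘ₗ g)).integral_comp_comm hi
    simp_rw [h1] at h2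
    rw [h2]
    exact (g (∫ t, f t ∂μ)).2
  · rw [integral_undef hi]; exact p.zero_mem

end Locality

/-! ### Bounds for weighted averages over permutations -/

section PermAverage

variable {E : Type*} [NormedAddCommGroup E] [NormedSpace ℝ E] {T : ℝ} {n : ℕ}

/-- The weight of a permutation in the Magnus expansion. -/
def magnusWeight (σ : Equiv.Perm (Fin (n + 1))) : ℝ :=
  (-1) ^ (n - ascents σ) *
    (((ascents σ).factorial : ℝ) * ((n - ascents σ).factorial : ℝ) / (n.factorial : ℝ))

/-- The weighted average over the permutations of the integrals over the ordered times. -/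
def permAverage (T : ℝ) (n : ℕ) (G : (Fin (n + 1) → ℝ) → E) : E :=
  (1 / ((n : ℝ) + 1) ^ 2) • ∑ σ : Equiv.Perm (Fin (n + 1)),
    magnusWeight σ • ∫ t in orderedTimes (n + 1) T, G (fun i => t (σ i))

lemma magnusTerm_eq_permAverage (a : ℝ → E →L[ℝ] E) (e : ℝ → E) :
    magnusTerm a e T n = permAverage T n (word a e n) := rfl

lemma integrableOn_orderedTimes_comp {m : ℕ} {G : (Fin m → ℝ) → E}
    (hG : Integrable G (cubeMeasure m T)) (σ : Equiv.Perm (Fin m)) :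
    IntegrableOn (fun t => G (fun i => t (σ i))) (orderedTimes m T) := by
  rw [cubeMeasure_eq] at hG
  have hcube : MeasurableSet (univ.pi fun _ : Fin m => Icc (0 : ℝ) T) :=
    MeasurableSet.univ_pi fun _ => measurableSet_Icc
  have h1 := (measurePreserving_comp_perm σ.symm).integrable_comp_of_integrable
    ((integrable_indicator_iff hcube).2 hG)
  have h2 : IntegrableOn _ (orderedTimes m T) := h1.integrableOn
  refine h2.congr_fun (fun t ht => ?_) (measurableSet_orderedTimes m T)
  simp only [Function.comp_apply, piCongrLeft_eq_comp, Equiv.symm_symm]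
  exact indicator_of_mem (show (fun i => t (σ i)) ∈ univ.pi fun _ : Fin m => Icc (0 : ℝ) T from
    fun i _ => ht.1 (σ i)) G

lemma permAverage_map [CompleteSpace E] {E' : Type*} [NormedAddCommGroup E'] [NormedSpace ℝ E']
    [CompleteSpace E'] (L : E →L[ℝ] E') {G : (Fin (n + 1) → ℝ) → E}
    (hG : Integrable G (cubeMeasure (n + 1) T)) :
    L (permAverage T n G) = permAverage T n fun t => L (G t) := by
  simp only [permAverage, map_smul, map_sum]
  congr 1
  refine Finset.sum_congr rfl fun σ _ => ?_
  rw [L.integral_comp_comm (integrableOn_orderedTimes_comp hG σ)]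

lemma permAverage_mem [FiniteDimensional ℝ E] (p : Submodule ℝ E) {G : (Fin (n + 1) → ℝ) → E}
    (hG : ∀ t, G t ∈ p) : permAverage T n G ∈ p :=
  p.smul_mem _ (p.sum_mem fun _ _ => p.smul_mem _ (integral_mem_submodule p fun _ => hG _))

lemma abs_magnusWeight (σ : Equiv.Perm (Fin (n + 1))) :
    |magnusWeight σ| = 1 / (n.choose (ascents σ) : ℝ) := by
  have h := Nat.choose_mul_factorial_mul_factorial (ascents_le σ)
  have h1 : (0 : ℝ) < n.choose (ascents σ) := by exact_mod_cast Nat.choose_pos (ascents_le σ)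
  have h2 : (0 : ℝ) < n.factorial := by positivity
  rw [magnusWeight, abs_mul, abs_pow, abs_neg, abs_one, one_pow, one_mul,
    abs_of_nonneg (by positivity), div_eq_div_iff h2.ne' h1.ne', one_mul]
  rw [← h]
  push_cast
  ring

lemma abs_magnusWeight_le (σ : Equiv.Perm (Fin (n + 1))) : |magnusWeight σ| ≤ 1 := by
  rw [abs_magnusWeight, div_le_one (by exact_mod_cast Nat.choose_pos (ascents_le σ))]
  exact_mod_cast Nat.choose_pos (ascents_le σ)

lemma eq_one_of_ascents_eq (σ : Equiv.Perm (Fin (n + 1))) (h : ascents σ = n) : σ = 1 := by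
  have h1 : ∀ i : Fin n, σ i.castSucc < σ i.succ := by
    have h2 : (Finset.univ.filter fun i : Fin n => σ i.castSucc < σ i.succ) = Finset.univ :=
      Finset.eq_univ_of_card _ (by rw [Fintype.card_fin]; exact h)
    intro i
    have := Finset.mem_univ i
    rw [← h2] at this
    exact (Finset.mem_filter.1 this).2
  have h3 : StrictMono σ := Fin.strictMono_iff_lt_succ.2 h1
  refine Equiv.coe_fn_injective ((StrictMono.range_inj h3 strictMono_id).1 ?_)
  rw [σ.surjective.range_eq, range_id]

lemma eq_revPerm_of_ascents_eq_zero (σ : Equiv.Perm (Fin (n + 1))) (h : ascents σ = 0) :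
    σ = Fin.revPerm := by
  have h1 : ∀ i : Fin n, σ i.succ < σ i.castSucc := by
    intro i
    have h2 : i ∉ Finset.univ.filter fun i : Fin n => σ i.castSucc < σ i.succ := by
      rw [Finset.card_eq_zero.1 h]; simp
    simp only [Finset.mem_filter, Finset.mem_univ, true_and, not_lt] at h2
    exact lt_of_le_of_ne h2 fun h' => absurd (σ.injective h') (Fin.castSucc_lt_succ (i := i)).ne'
  have h3 : StrictAnti σ := Fin.strictAnti_iff_succ_lt.2 h1
  have h4 : StrictMono fun i => Fin.rev (σ i) := fun i j hij => Fin.rev_lt_rev.2 (h3 hij)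
  have h5 : (fun i => Fin.rev (σ i)) = id := (StrictMono.range_inj h4 strictMono_id).1 (by
    have : Function.Surjective fun i => Fin.rev (σ i) := Fin.rev_surjective.comp σ.surjective
    rw [this.range_eq, range_id])
  ext1 i
  have := congrFun h5 i
  simp only [id] at this
  rw [Fin.revPerm_apply, Fin.rev_eq_iff.1 this]

/-- All weights but those of the identity and the reversal are at most `1 / 2`. -/
lemma abs_magnusWeight_le_half (hn : 2 ≤ n) (σ : Equiv.Perm (Fin (n + 1))) :
    |magnusWeight σ| ≤ 1 / 2 + ((if σ = 1 then 1 / 2 else 0)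
      + if σ = Fin.revPerm then 1 / 2 else 0) := by
  have hp1 : (0 : ℝ) ≤ if σ = 1 then 1 / 2 else 0 := by split_ifs <;> norm_num
  have hp2 : (0 : ℝ) ≤ if σ = Fin.revPerm then 1 / 2 else 0 := by split_ifs <;> norm_num
  have h1 := abs_magnusWeight_le σ
  by_cases ht : ascents σ = n
  · rw [if_pos (eq_one_of_ascents_eq σ ht)]; linarith
  by_cases h0 : ascents σ = 0
  · rw [if_pos (eq_revPerm_of_ascents_eq_zero σ h0)]; linarith
  have hle := ascents_le σ
  have hc : 2 ≤ n.choose (ascents σ) := by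
    obtain ⟨m, rfl⟩ : ∃ m, n = m + 1 := ⟨n - 1, by omega⟩
    obtain ⟨j, hj⟩ : ∃ j, ascents σ = j + 1 := ⟨ascents σ - 1, by omega⟩
    rw [hj, Nat.choose_succ_succ']
    have h2 := Nat.choose_pos (n := m) (k := j) (by omega)
    have h3 := Nat.choose_pos (n := m) (k := j + 1) (by omega)
    omega
  rw [abs_magnusWeight]
  have : 1 / (n.choose (ascents σ) : ℝ) ≤ 1 / 2 :=
    one_div_le_one_div_of_le two_pos (by exact_mod_cast hc)
  linarith

lemma norm_permAverage_le_sum (G : (Fin (n + 1) → ℝ) → E) :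
    ‖permAverage T n G‖ ≤ (1 / ((n : ℝ) + 1) ^ 2) * ∑ σ : Equiv.Perm (Fin (n + 1)),
      |magnusWeight σ| * ∫ t in orderedTimes (n + 1) T, ‖G (fun i => t (σ i))‖ := by
  rw [permAverage, norm_smul, Real.norm_eq_abs, abs_of_nonneg (by positivity)]
  refine mul_le_mul_of_nonneg_left ((norm_sum_le _ _).trans (Finset.sum_le_sum fun σ _ => ?_))
    (by positivity)
  rw [norm_smul, Real.norm_eq_abs]
  exact mul_le_mul_of_nonneg_left (norm_integral_le_integral_norm _) (abs_nonneg _)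

/-- With every weight at most 1, the permuted simplices reassemble into the cube, so the (n+1)!
summands cost no factorial. -/
lemma norm_permAverage_le {G : (Fin (n + 1) → ℝ) → E} {g : (Fin (n + 1) → ℝ) → ℝ}
    (hG : Integrable G (cubeMeasure (n + 1) T)) (hg : Integrable g (cubeMeasure (n + 1) T))
    (hGg : ∀ t, ‖G t‖ ≤ g t) :
    ‖permAverage T n G‖ ≤ (1 / ((n : ℝ) + 1) ^ 2) * ∫ t, g t ∂(cubeMeasure (n + 1) T) := by
  refine (norm_permAverage_le_sum G).trans (mul_le_mul_of_nonneg_left ?_ (by positivity))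
  rw [← sum_setIntegral_orderedTimes hg]
  refine Finset.sum_le_sum fun σ _ => ?_
  refine (mul_le_of_le_one_left (integral_nonneg fun _ => norm_nonneg _)
    (abs_magnusWeight_le σ)).trans ?_
  exact integral_mono (integrableOn_orderedTimes_comp hG.norm σ)
    (integrableOn_orderedTimes_comp hg σ) fun t => hGg _

lemma integrable_cube_apply (n : ℕ) {f : ℝ → ℝ} (hf : IntegrableOn f (Icc 0 T)) (i : Fin n) :
    Integrable (fun t => f (t i)) (cubeMeasure n T) := by
  have h := Integrable.fintype_prod (μ := fun _ : Fin n => volume.restrict (Icc (0 : ℝ) T))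
    (f := fun j => if j = i then f else fun _ => 1) fun j => by
      by_cases h : j = i
      · simp only [h, if_true]; exact hf
      · simp only [h, if_false]; exact integrable_const _
  refine h.congr (Eventually.of_forall fun t => ?_)
  beta_reduce
  rw [Finset.prod_eq_single i (fun j _ hj => by simp [hj]) (by simp)]
  simp

lemma integral_cube_apply (hT : 0 ≤ T) (n : ℕ) (f : ℝ → ℝ) (i : Fin (n + 1)) :
    ∫ t, f (t i) ∂(cubeMeasure (n + 1) T) = T ^ n * ∫ s in Icc 0 T, f s := by
  have h := integral_fintype_prod_eq_prod
    (μ := fun _ : Fin (n + 1) => volume.restrict (Icc (0 : ℝ) T)) (𝕜 := ℝ)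
    (fun j => if j = i then f else fun _ => 1)
  have h1 : ∀ t : Fin (n + 1) → ℝ, ∏ j, (if j = i then f else fun _ => 1) (t j) = f (t i) :=
    fun t => by
      rw [Finset.prod_eq_single i (fun j _ hj => by simp [hj]) (by simp)]
      simp
  simp_rw [h1] at h
  rw [h, ← Finset.mul_prod_erase _ _ (Finset.mem_univ i), mul_comm]
  congr 1
  · rw [Finset.prod_congr rfl (g := fun _ => T) fun j hj => by
      rw [if_neg (Finset.ne_of_mem_erase hj)]
      simp [hT], Finset.prod_const, Finset.card_erase_of_mem (Finset.mem_univ i)]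
    simp
  · simp

/-- The average of a function dominated by `f(t_0) + f(t_1)`. -/
lemma norm_permAverage_le_pair (hT : 0 ≤ T) (hn : 2 ≤ n) {G : (Fin (n + 1) → ℝ) → E} {f : ℝ → ℝ}
    {c : ℝ} (hc : 0 ≤ c) (hG : Integrable G (cubeMeasure (n + 1) T))
    (hf : IntegrableOn f (Icc 0 T)) (hf0 : ∀ s, 0 ≤ f s)
    (hGf : ∀ t, ‖G t‖ ≤ c * (f (t 0) + f (t 1))) :
    ‖permAverage T n G‖ ≤ (1 / ((n : ℝ) + 1) ^ 2) *
      (3 / 2 * (c * (T ^ n * ∫ s in Icc 0 T, f s))) := by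
  refine (norm_permAverage_le_sum G).trans (mul_le_mul_of_nonneg_left ?_ (by positivity))
  set F := T ^ n * ∫ s in Icc 0 T, f s with hF
  have hF0 : 0 ≤ F := mul_nonneg (by positivity) (integral_nonneg hf0)
  set I : Equiv.Perm (Fin (n + 1)) → ℝ := fun σ =>
    ∫ t in orderedTimes (n + 1) T, ‖G (fun i => t (σ i))‖ with hI
  have hI0 : ∀ σ, 0 ≤ I σ := fun σ => integral_nonneg fun _ => norm_nonneg _
  set g : (Fin (n + 1) → ℝ) → ℝ := fun t => c * (f (t 0) + f (t 1)) with hg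
  set s : (Fin (n + 1) → ℝ) → ℝ := fun t => c * ∑ i, f (t i) with hs
  have hfi := fun i => integrable_cube_apply (T := T) (n + 1) hf i
  have hgi : Integrable g (cubeMeasure (n + 1) T) := ((hfi 0).add (hfi 1)).const_mul c
  have hsi : Integrable s (cubeMeasure (n + 1) T) :=
    (integrable_finsetSum _ fun i _ => hfi i).const_mul c
  have hgint : ∫ t, g t ∂(cubeMeasure (n + 1) T) = 2 * (c * F) := by
    simp only [hg]
    rw [integral_const_mul, integral_add (hfi 0) (hfi 1), integral_cube_apply hT,
      integral_cube_apply hT]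
    ring
  have hsint : ∫ t, s t ∂(cubeMeasure (n + 1) T) = (n + 1) * (c * F) := by
    simp only [hs]
    rw [integral_const_mul, integral_finsetSum _ fun i _ => hfi i]
    simp only [integral_cube_apply hT, Finset.sum_const, Finset.card_univ, Fintype.card_fin,
      nsmul_eq_mul]
    push_cast
    ring
  have hIsum : ∑ σ, I σ ≤ 2 * (c * F) := by
    rw [← hgint, ← sum_setIntegral_orderedTimes hgi]
    exact Finset.sum_le_sum fun σ _ => integral_mono (integrableOn_orderedTimes_comp hG.norm σ)
      (integrableOn_orderedTimes_comp hgi σ) fun t => hGf _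
  have hssym : ∀ (σ : Equiv.Perm (Fin (n + 1))) (t : Fin (n + 1) → ℝ),
      s (fun i => t (σ i)) = s t := fun σ t => by
    simp only [hs]
    rw [Equiv.sum_comp σ fun i => f (t i)]
  have hsord : ((n + 1).factorial : ℝ) * ∫ t in orderedTimes (n + 1) T, s t
      = (n + 1) * (c * F) := by
    rw [← hsint, ← sum_setIntegral_orderedTimes hsi]
    simp only [hssym, Finset.sum_const, Finset.card_univ, Fintype.card_perm, Fintype.card_fin,
      nsmul_eq_mul]
  -- The symmetric majorant s has the same integral over all (n+1)! simplices. Its cube integral is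
  -- (n+1)cF, so each simplex carries cF/n!, and n! ≥ 2.
  have hsle : ∫ t in orderedTimes (n + 1) T, s t ≤ 1 / 2 * (c * F) := by
    have h2 : (2 : ℝ) ≤ n.factorial := by
      exact_mod_cast (Nat.factorial_le hn : Nat.factorial 2 ≤ n.factorial)
    have h3 : (n.factorial : ℝ) * ∫ t in orderedTimes (n + 1) T, s t = c * F := by
      rw [Nat.factorial_succ] at hsord
      push_cast at hsord
      rw [mul_assoc] at hsord
      exact mul_left_cancel₀ (by positivity) hsord
    have h4 : 0 ≤ ∫ t in orderedTimes (n + 1) T, s t :=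
      integral_nonneg fun t => mul_nonneg hc (Finset.sum_nonneg fun i _ => hf0 _)
    nlinarith
  have h01 : (0 : Fin (n + 1)) ≠ 1 := by
    have : NeZero n := ⟨by omega⟩
    exact (Fin.one_pos' ).ne
  have hIle : ∀ σ, I σ ≤ 1 / 2 * (c * F) := by
    intro σ
    refine le_trans ?_ hsle
    refine (integral_mono (integrableOn_orderedTimes_comp hG.norm σ)
      (integrableOn_orderedTimes_comp hsi σ) fun t => (hGf _).trans ?_).trans
      (le_of_eq (by simp only [hssym]))
    refine mul_le_mul_of_nonneg_left ?_ hc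
    have h5 := Finset.sum_le_sum_of_subset_of_nonneg (Finset.subset_univ {(0 : Fin (n + 1)), 1})
      (f := fun i => f (t (σ i))) fun i _ _ => hf0 _
    rwa [Finset.sum_pair h01] at h5
  -- The weight 1/2 on everything costs cF. The identity and the reversal, whose weights may reach
  -- 1, add at most another half of cF/2 each. The total is 3/2 instead of 2.
  calc ∑ σ, |magnusWeight σ| * I σ
      ≤ ∑ σ, (1 / 2 + ((if σ = 1 then 1 / 2 else 0)
        + if σ = Fin.revPerm then 1 / 2 else 0)) * I σ :=
        Finset.sum_le_sum fun σ _ =>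
          mul_le_mul_of_nonneg_right (abs_magnusWeight_le_half hn σ) (hI0 σ)
    _ = 1 / 2 * ∑ σ, I σ + 1 / 2 * (I 1 + I Fin.revPerm) := by
        simp only [add_mul, Finset.sum_add_distrib, ite_mul, zero_mul, Finset.sum_ite_eq',
          Finset.mem_univ, if_true, ← Finset.mul_sum]
        ring
    _ ≤ 3 / 2 * (c * F) := by
        have := hIle 1
        have := hIle Fin.revPerm
        linarith

end PermAverage

/-! ### Nested commutators of a driven few-body Hamiltonian -/

section DrivenFamily

variable {N d k : ℕ} {J T : ℝ} {h : Family N d} {v : ℝ → Family N d}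

/-- A static and a driving interaction of at most `k` spins with total strength `J`. -/
structure IsDrivenFamily (k : ℕ) (J T : ℝ) (h : Family N d) (v : ℝ → Family N d) : Prop where
  static_mem : h ∈ localFamilies k
  drive_mem : ∀ t, v t ∈ localFamilies k
  integrable : IntervalIntegrable v volume 0 T
  strength : ∀ (i : Fin N) (t : ℝ),
    ∑ X ∈ Finset.univ.filter (fun X => i ∈ X), (‖h X‖ + ‖v t X‖) ≤ J

/-- The operator `∑_X (h_X + v_X(t))`. -/
def totalOp (h : Family N d) (v : ℝ → Family N d) (t : ℝ) : Op N d := familySum (h + v t)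

/-- The commutator with `∑_X (h_X + v_X(t))` on families. -/
def totalAd (h : Family N d) (v : ℝ → Family N d) (t : ℝ) : Family N d →L[ℝ] Family N d :=
  familyAdL (h + v t)

namespace IsDrivenFamily

variable (hs : IsDrivenFamily k J T h v) (hJ : 0 ≤ J) (hT : 0 ≤ T)

include hs

lemma total_mem (t : ℝ) : h + v t ∈ localFamilies k :=
  Submodule.add_mem _ hs.static_mem (hs.drive_mem t)

lemma total_integrable : IntervalIntegrable (fun t => h + v t) volume 0 T :=
  intervalIntegrable_const.add hs.integrable

lemma totalOp_integrable : IntervalIntegrable (totalOp h v) volume 0 T :=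
  ⟨familySum.integrable_comp hs.total_integrable.1, familySum.integrable_comp hs.total_integrable.2⟩

lemma totalAd_integrable : IntervalIntegrable (totalAd h v) volume 0 T :=
  ⟨familyAdL.integrable_comp hs.total_integrable.1, familyAdL.integrable_comp hs.total_integrable.2⟩

lemma strength_total (t : ℝ) (i : Fin N) :
    ∑ X ∈ Finset.univ.filter (fun X => i ∈ X), ‖(h + v t) X‖ ≤ J :=
  (Finset.sum_le_sum fun _ _ => norm_add_le _ _).trans (hs.strength i t)

lemma strength_static (i : Fin N) :
    ∑ X ∈ Finset.univ.filter (fun X => i ∈ X), ‖h X‖ ≤ J :=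
  (Finset.sum_le_sum fun _ _ => le_add_of_nonneg_right (norm_nonneg _)).trans (hs.strength i 0)

include hJ

/-- Supports are measured in blocks of k spins: 2·(kr)·J = λr. Each further commutator adds one
block, so repeated use yields rising factorials. -/
lemma norm_totalAd_le (t : ℝ) {r : ℕ} {x : Family N d} (hx : x ∈ localFamilies (k * r)) :
    ‖totalAd h v t x‖ ≤ lam k J * r * ‖x‖ := by
  refine (norm_familyAdL_le (hs.strength_total t) hJ hx).trans (le_of_eq ?_)
  rw [lam]; push_cast; ring

lemma norm_staticAd_le {r : ℕ} {x : Family N d} (hx : x ∈ localFamilies (k * r)) :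
    ‖familyAdL h x‖ ≤ lam k J * r * ‖x‖ := by
  refine (norm_familyAdL_le hs.strength_static hJ hx).trans (le_of_eq ?_)
  rw [lam]; push_cast; ring

omit hJ

lemma totalAd_mem (t : ℝ) {r : ℕ} {x : Family N d} (hx : x ∈ localFamilies (k * r)) :
    totalAd h v t x ∈ localFamilies (k * (r + 1)) :=
  familyAd_mem (hs.total_mem t) hx

lemma familySum_totalAd (t : ℝ) {r : ℕ} {x : Family N d} (hx : x ∈ localFamilies r) :
    familySum (totalAd h v t x) = adL (totalOp h v t) (familySum x) :=
  familySum_familyAd (hs.total_mem t) hx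

lemma word_mem {r : ℕ} {e : ℝ → Family N d} (he : ∀ s, e s ∈ localFamilies (k * r)) (n : ℕ)
    (t : Fin (n + 1) → ℝ) : word (totalAd h v) e n t ∈ localFamilies (k * (r + n)) := by
  induction n with
  | zero => exact he _
  | succ n ih => exact hs.totalAd_mem _ (ih _)

lemma familySum_word {r : ℕ} {e : ℝ → Family N d} (he : ∀ s, e s ∈ localFamilies (k * r)) (n : ℕ)
    (t : Fin (n + 1) → ℝ) : familySum (word (totalAd h v) e n t)
      = word (fun s => adL (totalOp h v s)) (fun s => familySum (e s)) n t := by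
  induction n with
  | zero => rfl
  | succ n ih =>
    rw [word, hs.familySum_totalAd _ (hs.word_mem he n _), ih]
    rfl

include hJ

lemma norm_word_le {r : ℕ} {e : ℝ → Family N d} (he : ∀ s, e s ∈ localFamilies (k * r)) (n : ℕ)
    (t : Fin (n + 1) → ℝ) : ‖word (totalAd h v) e n t‖
      ≤ lam k J ^ n * (r.ascFactorial n : ℝ) * ‖e (t 0)‖ := by
  have hl : 0 ≤ lam k J := by unfold lam; positivity
  induction n with
  | zero => simp [word]
  | succ n ih =>
    refine (hs.norm_totalAd_le hJ _ (hs.word_mem he n _)).trans ?_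
    refine (mul_le_mul_of_nonneg_left (ih _) (by positivity)).trans (le_of_eq ?_)
    rw [Nat.ascFactorial_succ, Fin.castSucc_zero]
    push_cast
    ring

include hT

/-- The commutator of a Magnus coefficient with a local family. -/
lemma exists_adL_magnusCoeff (m : ℕ) {r : ℕ} {x : Family N d} (hx : x ∈ localFamilies (k * r)) :
    ∃ z ∈ localFamilies (k * (r + 1 + m)),
      familySum z = adL (magnusCoeff (totalOp h v) T m) (familySum x) ∧
      ‖z‖ ≤ 1 / ((m : ℝ) + 1) * (lam k J * T) ^ (m + 1) * (r.ascFactorial (m + 1) : ℝ) * ‖x‖ := by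
  have hl : 0 ≤ lam k J := by unfold lam; positivity
  have hai := (intervalIntegrable_iff_integrableOn_Icc_of_le hT).1 hs.totalAd_integrable
  set e : ℝ → Family N d := fun s => totalAd h v s x with he
  have hem : ∀ s, e s ∈ localFamilies (k * (r + 1)) := fun s => hs.totalAd_mem s hx
  have hei : IntegrableOn e (Icc 0 T) := (intervalIntegrable_iff_integrableOn_Icc_of_le hT).1
    (intervalIntegrable_clm_apply hT hs.totalAd_integrable continuousOn_const)
  have hwi := word_integrable hai hei m
  -- By `adL_magnusCoeff` the commutator is expanded in m + 1 commutators of the Hamiltonian with x,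
  -- each local. The initial one costs r and the others (r+1)⋯(r+m). The prefactor is (m+1)/(m+1)².
  refine ⟨((m : ℝ) + 1) • permAverage T m (word (totalAd h v) e m), Submodule.smul_mem _ _
    (permAverage_mem _ (hs.word_mem hem m)), ?_, ?_⟩
  · rw [map_smul, permAverage_map _ hwi, adL_magnusCoeff hT hs.totalOp_integrable]
    congr 1
    rw [magnusTerm_eq_permAverage]
    congr 1
    funext t
    rw [hs.familySum_word hem]
    congr 1
    funext s
    exact hs.familySum_totalAd s hx
  · set c : ℝ := lam k J ^ m * ((r + 1).ascFactorial m : ℝ) * (lam k J * r * ‖x‖) with hc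
    have hgi : Integrable (fun t : Fin (m + 1) → ℝ => c * (fun _ : ℝ => (1 : ℝ)) (t 0))
        (cubeMeasure (m + 1) T) :=
      (integrable_cube_apply (m + 1) (integrable_const _) 0).const_mul c
    have h1 := norm_permAverage_le hwi hgi fun t => by
      refine (hs.norm_word_le hJ hem m t).trans ?_
      rw [mul_one, hc]
      exact mul_le_mul_of_nonneg_left (hs.norm_totalAd_le hJ _ hx) (by positivity)
    rw [integral_const_mul, integral_cube_apply hT m (fun _ => (1 : ℝ)) 0] at h1
    rw [norm_smul, Real.norm_eq_abs, abs_of_nonneg (by positivity)]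
    refine (mul_le_mul_of_nonneg_left h1 (by positivity)).trans (le_of_eq ?_)
    have h2 : (r : ℝ) * ((r + 1).ascFactorial m : ℝ) = (r.ascFactorial (m + 1) : ℝ) := by
      rw [Nat.ascFactorial_succ]
      exact_mod_cast Nat.succ_ascFactorial r m
    rw [← h2, hc]
    have hm : (m : ℝ) + 1 ≠ 0 := by positivity
    simp only [integral_const, MeasurableSet.univ, measureReal_restrict_apply, univ_inter,
      Real.volume_real_Icc_of_le hT, sub_zero, smul_eq_mul, mul_one]
    field_simp
    ring

end IsDrivenFamily

/-- The nested commutators `a(t_{n+1}) ⋯ a(t_2) (a(t_1) v(t_0) - [h, v(t_1)])`. -/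
def pairWord (h : Family N d) (v : ℝ → Family N d) : (n : ℕ) → (Fin (n + 2) → ℝ) → Family N d
  | 0, t => totalAd h v (t 1) (v (t 0)) - familyAdL h (v (t 1))
  | n + 1, t => totalAd h v (t (Fin.last (n + 2))) (pairWord h v n fun i => t i.castSucc)

namespace IsDrivenFamily

variable (hs : IsDrivenFamily k J T h v) (hJ : 0 ≤ J) (hT : 0 ≤ T)

include hs

lemma pairWord_mem (n : ℕ) (t : Fin (n + 2) → ℝ) :
    pairWord h v n t ∈ localFamilies (k * (n + 2)) := by
  have hv : ∀ s, v s ∈ localFamilies (k * 1) := fun s => by simpa using hs.drive_mem s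
  induction n with
  | zero =>
    refine Submodule.sub_mem _ (hs.totalAd_mem _ (hv _)) ?_
    exact localFamilies_mono (by omega) (familyAd_mem hs.static_mem (hs.drive_mem _))
  | succ n ih => exact hs.totalAd_mem _ (ih _)

/-- Because [h,h] = 0, the innermost commutator [h + v₁, h + v₀] equals [h + v₁, v₀] - [h, v₁].
Every term then contains the drive, so the bounds carry ∫‖v‖ instead of the norm of the full
Hamiltonian. -/
lemma familySum_pairWord (n : ℕ) (t : Fin (n + 2) → ℝ) : familySum (pairWord h v n t)
      = word (fun s => adL (totalOp h v s)) (totalOp h v) (n + 1) t := by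
  induction n with
  | zero =>
    rw [pairWord, map_sub, hs.familySum_totalAd _ (hs.drive_mem _),
      familySum_familyAd hs.static_mem (hs.drive_mem _)]
    change _ = adL (totalOp h v (t 1)) (totalOp h v (t 0))
    simp only [totalOp, map_add, adL_apply, _root_.add_apply]
    noncomm_ring
  | succ n ih =>
    rw [pairWord, hs.familySum_totalAd _ (hs.pairWord_mem n _), ih]
    rfl

include hJ in
lemma norm_pairWord_le (n : ℕ) (t : Fin (n + 2) → ℝ) : ‖pairWord h v n t‖
      ≤ lam k J ^ (n + 1) * ((n + 1).factorial : ℝ) * (‖v (t 0)‖ + ‖v (t 1)‖) := by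
  have hl : 0 ≤ lam k J := by unfold lam; positivity
  have hv : ∀ s, v s ∈ localFamilies (k * 1) := fun s => by simpa using hs.drive_mem s
  induction n with
  | zero =>
    have h1 := hs.norm_totalAd_le hJ (t 1) (hv (t 0))
    have h2 := hs.norm_staticAd_le hJ (hv (t 1))
    simp only [zero_add, pow_one, Nat.factorial_one, Nat.cast_one, mul_one] at h1 h2 ⊢
    rw [mul_add]
    exact (norm_sub_le _ _).trans (add_le_add h1 h2)
  | succ n ih =>
    refine (hs.norm_totalAd_le hJ _ (hs.pairWord_mem n _)).trans ?_
    refine (mul_le_mul_of_nonneg_left (ih _) (by positivity)).trans (le_of_eq ?_)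
    rw [Nat.factorial_succ (n + 1), Fin.castSucc_zero]
    have : (Fin.castSucc 1 : Fin (n + 3)) = 1 := rfl
    rw [this]
    push_cast
    ring

include hT

lemma pairWord_integrable (n : ℕ) : Integrable (pairWord h v n) (cubeMeasure (n + 2) T) := by
  have hai := (intervalIntegrable_iff_integrableOn_Icc_of_le hT).1 hs.totalAd_integrable
  have hvi := (intervalIntegrable_iff_integrableOn_Icc_of_le hT).1 hs.integrable
  induction n with
  | zero =>
    refine Integrable.sub (word_integrable hai hvi 1) ?_
    refine integrable_cube_succ 1 T (g := fun s _ => familyAdL h (v s)) ?_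
    exact ((familyAdL h).integrable_comp hvi).comp_fst (ν := cubeMeasure 1 T)
  | succ n ih =>
    exact integrable_cube_succ (n + 2) T (g := fun s t => totalAd h v s (pairWord h v n t))
      (integrable_clm_apply_prod hai ih)

include hJ

/-- The Magnus coefficients of positive order as sums of local families. -/
lemma exists_magnusCoeff (n : ℕ) :
    ∃ z ∈ localFamilies (k * (n + 2)),
      familySum z = magnusCoeff (totalOp h v) T (n + 1) ∧
      ‖z‖ ≤ 2 / ((n : ℝ) + 2) ^ 2 * ((∫ s in (0 : ℝ)..T, ‖v s‖) * (lam k J * T) ^ (n + 1)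
        * ((n + 1).factorial : ℝ)) ∧
      (1 ≤ n → ‖z‖ ≤ 3 / 2 / ((n : ℝ) + 2) ^ 2 * ((∫ s in (0 : ℝ)..T, ‖v s‖)
        * (lam k J * T) ^ (n + 1) * ((n + 1).factorial : ℝ))) := by
  have hl : 0 ≤ lam k J := by unfold lam; positivity
  have hvi := (intervalIntegrable_iff_integrableOn_Icc_of_le hT).1 hs.integrable
  have hwi := hs.pairWord_integrable hT n
  have hV : ∫ s in (0 : ℝ)..T, ‖v s‖ = ∫ s in Icc 0 T, ‖v s‖ := by
    rw [intervalIntegral.integral_of_le hT, integral_Icc_eq_integral_Ioc]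
  refine ⟨permAverage T (n + 1) (pairWord h v n), permAverage_mem _ (hs.pairWord_mem n), ?_, ?_,
    fun hn => ?_⟩
  · rw [permAverage_map _ hwi, magnusCoeff, magnusTerm_eq_permAverage]
    congr 1
    funext t
    exact hs.familySum_pairWord n t
  · have h0 := integrable_cube_apply (n + 2) hvi.norm (0 : Fin (n + 2))
    have h1 := integrable_cube_apply (n + 2) hvi.norm (1 : Fin (n + 2))
    have h2 := norm_permAverage_le hwi ((h0.add h1).const_mul
      (lam k J ^ (n + 1) * ((n + 1).factorial : ℝ))) (hs.norm_pairWord_le hJ n)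
    refine h2.trans (le_of_eq ?_)
    rw [integral_const_mul]
    simp only [Pi.add_apply]
    rw [integral_add h0 h1, integral_cube_apply hT (n + 1) (fun s => ‖v s‖),
      integral_cube_apply hT (n + 1) (fun s => ‖v s‖), hV]
    push_cast
    ring
  -- The norm depends on the times only through t_0 and t_1, as the sharper average requires; its
  -- order n + 1 is at least 2 here.
  · have h2 := norm_permAverage_le_pair hT (by omega) (f := fun s => ‖v s‖)
      (c := lam k J ^ (n + 1) * ((n + 1).factorial : ℝ)) (by positivity) hwi hvi.norm
      (fun _ => norm_nonneg _) (hs.norm_pairWord_le hJ n)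
    refine h2.trans (le_of_eq ?_)
    rw [hV]
    push_cast
    ring

end IsDrivenFamily
end DrivenFamily

/-! ### Bounds for the nested Magnus coefficients -/

section NestedBounds

variable {N d k : ℕ} {J T : ℝ} {h : Family N d} {v : ℝ → Family N d}

lemma sum_range_choose_eq (n j : ℕ) : ∑ i ∈ Finset.range n, i.choose j = n.choose (j + 1) := by
  induction n with
  | zero => simp
  | succ n ih => rw [Finset.sum_range_succ, ih, Nat.choose_succ_succ', add_comm]

namespace IsDrivenFamily

variable (hs : IsDrivenFamily k J T h v) (hJ : 0 ≤ J) (hT : 0 ≤ T)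

include hs hJ hT

/-- The commutator of a Magnus coefficient with a nested coefficient, given the bound on the
latter. -/
lemma exists_adL_nestedCoeff (j p m : ℕ)
    (hp : 1 ≤ p → ∃ z ∈ localFamilies (k * (p + 1)),
      familySum z = nestedCoeff (magnusCoeff (totalOp h v) T) j p ∧
      ‖z‖ ≤ (∫ s in (0 : ℝ)..T, ‖v s‖) * (lam k J * T) ^ p * (p.factorial : ℝ) * (p.choose j : ℝ)) :
    ∃ z ∈ localFamilies (k * (p + m + 2)), familySum z = adL (magnusCoeff (totalOp h v) T m)
        (nestedCoeff (magnusCoeff (totalOp h v) T) j p) ∧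
      ‖z‖ ≤ (∫ s in (0 : ℝ)..T, ‖v s‖) * (lam k J * T) ^ (p + m + 1)
        * ((p + m + 1).factorial : ℝ) * (p.choose j : ℝ) := by
  have hl : 0 ≤ lam k J := by unfold lam; positivity
  set V := ∫ s in (0 : ℝ)..T, ‖v s‖ with hV
  have hV0 : 0 ≤ V := intervalIntegral.integral_nonneg hT fun _ _ => norm_nonneg _
  set μ := lam k J * T with hμ
  have hμ0 : 0 ≤ μ := by positivity
  set y := magnusCoeff (totalOp h v) T with hy
  -- Degree 0 is special: y_0 contains the static part and has no bound by the drive. Either the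
  -- commutator is [y_0,y_0] = 0, or antisymmetry turns it into -[y_0,y_m] with m ≥ 1, where y_m is
  -- the drive-bounded family.
  rcases Nat.eq_zero_or_pos p with rfl | hp1
  · have hzero : ∀ w : Op N d, w = 0 → ∃ z ∈ localFamilies (k * (0 + m + 2)), familySum z = w ∧
        ‖z‖ ≤ V * μ ^ (0 + m + 1) * ((0 + m + 1).factorial : ℝ) * ((0 : ℕ).choose j : ℝ) :=
      fun w hw => ⟨0, Submodule.zero_mem _, by rw [map_zero, hw], by rw [norm_zero]; positivity⟩
    rcases Nat.eq_zero_or_pos j with rfl | hj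
    · rcases Nat.eq_zero_or_pos m with rfl | hm
      · exact hzero _ (by simp [nestedCoeff])
      · obtain ⟨n, rfl⟩ : ∃ n, m = n + 1 := ⟨m - 1, by omega⟩
        obtain ⟨z, hz, hzs, hzn, -⟩ := hs.exists_magnusCoeff hJ hT n
        obtain ⟨w, hw, hws, hwn⟩ := hs.exists_adL_magnusCoeff hJ hT 0 hz
        refine ⟨-w, Submodule.neg_mem _ (localFamilies_mono ?_ hw), ?_, ?_⟩
        · exact Nat.mul_le_mul_left k (by omega)
        · rw [map_neg, hws, hzs]
          simp [nestedCoeff, hy]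
        · rw [norm_neg]
          refine hwn.trans ((mul_le_mul_of_nonneg_left hzn (by positivity)).trans ?_)
          simp only [Nat.cast_zero, zero_add, div_one, one_mul, pow_one,
            Nat.choose_self, Nat.cast_one, mul_one, Nat.ascFactorial_succ, Nat.ascFactorial_zero,
            add_zero]
          rw [Nat.factorial_succ (n + 1)]
          push_cast
          have h1 : (2 : ℝ) / ((n : ℝ) + 2) ^ 2 ≤ 1 := by
            rw [div_le_one (by positivity)]
            nlinarith [(Nat.cast_nonneg n : (0 : ℝ) ≤ n)]
          calc μ * ((n : ℝ) + 2) * (2 / ((n : ℝ) + 2) ^ 2 * (V * μ ^ (n + 1)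
                * ((n + 1).factorial : ℝ)))
              = 2 / ((n : ℝ) + 2) ^ 2 * (V * μ ^ (n + 1 + 1) * (((n : ℝ) + 2)
                * ((n + 1).factorial : ℝ))) := by ring
            _ ≤ V * μ ^ (n + 1 + 1) * (((n : ℝ) + 2) * ((n + 1).factorial : ℝ)) :=
                mul_le_of_le_one_left (by positivity) h1
            _ = _ := by ring
    · exact hzero _ (by rw [nestedCoeff_eq_zero _ hj, map_zero])
  · obtain ⟨z, hz, hzs, hzn⟩ := hp hp1
    obtain ⟨w, hw, hws, hwn⟩ := hs.exists_adL_magnusCoeff hJ hT m hz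
    refine ⟨w, localFamilies_mono (Nat.mul_le_mul_left k (by omega)) hw, by rw [hws, hzs], ?_⟩
    refine hwn.trans ((mul_le_mul_of_nonneg_left hzn (by positivity)).trans ?_)
    -- The factorial already paid for degree p and the rising factorial of the new commutators merge
    -- into a single factorial of the total degree.
    have h1 : ((p.factorial : ℝ)) * ((p + 1).ascFactorial (m + 1) : ℝ)
        = ((p + m + 1).factorial : ℝ) := by
      exact_mod_cast Nat.factorial_mul_ascFactorial p (m + 1)
    have h2 : 1 / ((m : ℝ) + 1) ≤ 1 := by
      rw [div_le_one (by positivity)]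
      linarith [(Nat.cast_nonneg m : (0 : ℝ) ≤ m)]
    rw [← h1]
    calc 1 / ((m : ℝ) + 1) * μ ^ (m + 1) * ((p + 1).ascFactorial (m + 1) : ℝ)
          * (V * μ ^ p * (p.factorial : ℝ) * (p.choose j : ℝ))
        = 1 / ((m : ℝ) + 1) * (V * μ ^ (p + m + 1)
          * ((p.factorial : ℝ) * ((p + 1).ascFactorial (m + 1) : ℝ)) * (p.choose j : ℝ)) := by ring
      _ ≤ _ := mul_le_of_le_one_left (by positivity) h2

/-- The nested coefficients as sums of local families. -/
lemma exists_nestedCoeff (j p : ℕ) (hp : 1 ≤ p) : ∃ z ∈ localFamilies (k * (p + 1)),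
      familySum z = nestedCoeff (magnusCoeff (totalOp h v) T) j p ∧
      ‖z‖ ≤ (∫ s in (0 : ℝ)..T, ‖v s‖) * (lam k J * T) ^ p * (p.factorial : ℝ)
        * (p.choose j : ℝ) := by
  have hl : 0 ≤ lam k J := by unfold lam; positivity
  have hV0 : 0 ≤ ∫ s in (0 : ℝ)..T, ‖v s‖ :=
    intervalIntegral.integral_nonneg hT fun _ _ => norm_nonneg _
  induction j generalizing p with
  | zero =>
    obtain ⟨n, rfl⟩ : ∃ n, p = n + 1 := ⟨p - 1, by omega⟩
    obtain ⟨z, hz, hzs, hzn, -⟩ := hs.exists_magnusCoeff hJ hT n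
    refine ⟨(((n + 1 : ℕ) : ℝ) + 1) • z, Submodule.smul_mem _ _ hz, ?_, ?_⟩
    · rw [map_smul, hzs, nestedCoeff]
    · rw [norm_smul, Real.norm_eq_abs, abs_of_nonneg (by positivity), Nat.choose_zero_right,
        Nat.cast_one, mul_one]
      refine (mul_le_mul_of_nonneg_left hzn (by positivity)).trans ?_
      rw [← mul_assoc]
      refine mul_le_of_le_one_left (by positivity) ?_
      push_cast
      have : (n : ℝ) + 1 + 1 = n + 2 := by ring
      rw [this, mul_div_assoc', div_le_one (by positivity)]
      nlinarith [(Nat.cast_nonneg n : (0 : ℝ) ≤ n)]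
  | succ j ih =>
    choose z hz hzs hzn using fun r : ℕ × ℕ => hs.exists_adL_nestedCoeff hJ hT j r.1 r.2 (ih r.1)
    set I := (Finset.range p ×ˢ Finset.range p).filter fun r => r.1 + r.2 + 1 = p with hI
    refine ⟨∑ r ∈ I, z r, Submodule.sum_mem _ fun r hr => ?_, ?_, ?_⟩
    · have := (Finset.mem_filter.1 hr).2
      exact localFamilies_mono (Nat.mul_le_mul_left k (by omega)) (hz r)
    · rw [map_sum, nestedCoeff]
      exact Finset.sum_congr rfl fun r _ => hzs r
    · refine (norm_sum_le _ _).trans ((Finset.sum_le_sum fun r hr => hzn r).trans ?_)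
      have h1 : ∀ r ∈ I, (∫ s in (0 : ℝ)..T, ‖v s‖) * (lam k J * T) ^ (r.1 + r.2 + 1)
          * ((r.1 + r.2 + 1).factorial : ℝ) * (r.1.choose j : ℝ)
          = (∫ s in (0 : ℝ)..T, ‖v s‖) * (lam k J * T) ^ p * (p.factorial : ℝ)
            * (r.1.choose j : ℝ) := fun r hr => by rw [(Finset.mem_filter.1 hr).2]
      rw [Finset.sum_congr rfl h1, ← Finset.mul_sum]
      refine mul_le_mul_of_nonneg_left ?_ (by positivity)
      -- At fixed total degree p the pair is determined by its first entry, which is below p. The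
      -- hockey-stick identity then sums the binomials to the coefficient for j + 1.
      rw [← sum_range_choose_eq]
      push_cast
      rw [← Finset.sum_image (s := I) (g := Prod.fst) (f := fun i => (i.choose j : ℝ))]
      · refine Finset.sum_le_sum_of_subset_of_nonneg (fun i hi => ?_) fun _ _ _ => by positivity
        obtain ⟨r, hr, rfl⟩ := Finset.mem_image.1 hi
        exact (Finset.mem_product.1 (Finset.mem_filter.1 hr).1).1
      · intro r hr r' hr' hrr
        have h2 := (Finset.mem_filter.1 hr).2
        have h3 := (Finset.mem_filter.1 hr').2
        exact Prod.ext hrr (by change r.1 = r'.1 at hrr; omega)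

lemma norm_adL_nestedCoeff_le (j p m : ℕ) :
    ‖adL (magnusCoeff (totalOp h v) T m) (nestedCoeff (magnusCoeff (totalOp h v) T) j p)‖
      ≤ (∫ s in (0 : ℝ)..T, ‖v s‖) * (lam k J * T) ^ (p + m + 1)
        * ((p + m + 1).factorial : ℝ) * (p.choose j : ℝ) := by
  obtain ⟨z, -, hzs, hzn⟩ := hs.exists_adL_nestedCoeff hJ hT j p m (hs.exists_nestedCoeff hJ hT j p)
  rw [← hzs]
  exact (norm_familySum_le z).trans hzn

/-- Summing over the commutator depth j replaces the binomial coefficients by 2^{p.1}, so all depths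
together cost only an exponential factor. -/
lemma sum_defect_le (n : ℕ) : ∑ p ∈ defectIndex n, ∑ j ∈ Finset.range (n + 1),
      ‖adL (magnusCoeff (totalOp h v) T p.2) (nestedCoeff (magnusCoeff (totalOp h v) T) j p.1)‖
      ≤ (∫ s in (0 : ℝ)..T, ‖v s‖) * ∑ p ∈ defectIndex n, (lam k J * T) ^ (p.1 + p.2 + 1)
        * ((p.1 + p.2 + 1).factorial : ℝ) * 2 ^ p.1 := by
  have hl : 0 ≤ lam k J := by unfold lam; positivity
  have hV0 : 0 ≤ ∫ s in (0 : ℝ)..T, ‖v s‖ :=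
    intervalIntegral.integral_nonneg hT fun _ _ => norm_nonneg _
  rw [Finset.mul_sum]
  refine Finset.sum_le_sum fun p hp => ?_
  refine (Finset.sum_le_sum fun j _ => hs.norm_adL_nestedCoeff_le hJ hT j p.1 p.2).trans ?_
  rw [← Finset.mul_sum, ← mul_assoc, ← mul_assoc]
  refine mul_le_mul_of_nonneg_left ?_ (by positivity)
  have h1 : p.1 ≤ n := by
    have := (Finset.mem_product.1 (Finset.mem_filter.1 hp).1).1
    exact Nat.lt_succ_iff.1 (Finset.mem_range.1 this)
  have h2 : ∑ j ∈ Finset.range (n + 1), p.1.choose j = 2 ^ p.1 := by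
    rw [← Nat.sum_range_choose p.1]
    refine (Finset.sum_subset (Finset.range_mono (by omega)) fun j _ hj => ?_).symm
    exact Nat.choose_eq_zero_of_lt (by simpa using hj)
  exact_mod_cast h2.le

-- At order 0 the only dropped commutator is [y_0,y_0]. This gives order zero its sharp constant.
omit hs hJ hT in
lemma sum_defect_zero (y : ℕ → Op N d) : ∑ p ∈ defectIndex 0, ∑ j ∈ Finset.range (0 + 1),
    ‖adL (y p.2) (nestedCoeff y j p.1)‖ = 0 := by
  refine Finset.sum_eq_zero fun p hp => Finset.sum_eq_zero fun j hj => ?_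
  simp only [defectIndex, Finset.mem_filter, Finset.mem_product, Finset.mem_range] at hp hj
  have h1 : p.1 = 0 := by omega
  have h2 : p.2 = 0 := by omega
  have h3 : j = 0 := by omega
  simp [h1, h2, h3, nestedCoeff]

end IsDrivenFamily
end NestedBounds

/-! ### Bounds for the coefficients ζ_n of the logarithmic derivative of U -/

section LogDerivBounds

variable {N d k : ℕ} {J T : ℝ} {h : Family N d} {v : ℝ → Family N d}

/-- `[A(s), ∫_0^s A]` as a family, for `A = ∑_X (h_X + v_X)`. -/
def pairSource (h : Family N d) (v : ℝ → Family N d) (s : ℝ) : Family N d :=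
  totalAd h v s (∫ r in (0 : ℝ)..s, v r) - s • familyAdL h (v s)

/-- The coefficients of the logarithmic derivative as families. -/
def logDerivFamily (h : Family N d) (v : ℝ → Family N d) : ℕ → ℝ → Family N d :=
  picard (totalAd h v) (fun t => ∫ s in (0 : ℝ)..t, pairSource h v s)

/-- A bound for `‖[A(s), ζ_n(s)]‖`. -/
def logDerivBound (l : ℝ) (v : ℝ → Family N d) : ℕ → ℝ → ℝ
  | 0, s => l * ((∫ r in (0 : ℝ)..s, ‖v r‖) + s * ‖v s‖)
  | n + 1, s => (n + 2) * l ^ (n + 2) * s ^ (n + 1) * ∫ r in (0 : ℝ)..s, ‖v r‖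

namespace IsDrivenFamily

variable (hs : IsDrivenFamily k J T h v) (hJ : 0 ≤ J) (hT : 0 ≤ T)

include hs

lemma integral_drive_mem (t : ℝ) : ∫ r in (0 : ℝ)..t, v r ∈ localFamilies (k * 1) := by
  have hv : ∀ s, v s ∈ localFamilies (k * 1) := fun s => by simpa using hs.drive_mem s
  rw [intervalIntegral]
  exact Submodule.sub_mem _ (integral_mem_submodule _ hv) (integral_mem_submodule _ hv)

lemma pairSource_mem (s : ℝ) : pairSource h v s ∈ localFamilies (k * 2) := by
  refine Submodule.sub_mem _ (hs.totalAd_mem _ (hs.integral_drive_mem s)) (Submodule.smul_mem _ _ ?_)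
  exact localFamilies_mono (by omega) (familyAd_mem hs.static_mem (hs.drive_mem _))

lemma logDerivFamily_mem (n : ℕ) (t : ℝ) :
    logDerivFamily h v n t ∈ localFamilies (k * (n + 2)) := by
  induction n generalizing t with
  | zero =>
    change ∫ s in (0 : ℝ)..t, pairSource h v s ∈ _
    rw [intervalIntegral]
    exact Submodule.sub_mem _ (integral_mem_submodule _ hs.pairSource_mem)
      (integral_mem_submodule _ hs.pairSource_mem)
  | succ n ih =>
    change ∫ s in (0 : ℝ)..t, totalAd h v s (logDerivFamily h v n s) ∈ _
    rw [intervalIntegral]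
    exact Submodule.sub_mem _ (integral_mem_submodule _ fun s => hs.totalAd_mem s (ih s))
      (integral_mem_submodule _ fun s => hs.totalAd_mem s (ih s))

lemma logDerivCoeff_zero_eq {s : ℝ} (hsT : s ∈ Icc 0 T) : logDerivCoeff (totalOp h v) 0 s
    = familySum (s • h + ∫ r in (0 : ℝ)..s, v r) := by
  have hvi := intervalIntegrable_sub hs.integrable hsT
  have h1 := familySum.intervalIntegral_comp_comm (intervalIntegrable_sub hs.total_integrable hsT)
  change ∫ r in (0 : ℝ)..s, familySum (h + v r) = _
  rw [h1, intervalIntegral.integral_add intervalIntegrable_const hvi,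
    intervalIntegral.integral_const, sub_zero]

/-- With ∫_0^s A = s h + ∫_0^s v, the purely static part cancels in [h + v(s), s h + ∫v], leaving [h
+ v(s), ∫v] - s[h, v(s)]. Again each term contains the drive. -/
lemma familySum_pairSource {s : ℝ} (hsT : s ∈ Icc 0 T) :
    familySum (pairSource h v s) = adL (totalOp h v s) (logDerivCoeff (totalOp h v) 0 s) := by
  rw [hs.logDerivCoeff_zero_eq hsT, pairSource, map_sub, map_smul,
    hs.familySum_totalAd s (hs.integral_drive_mem s),
    familySum_familyAd hs.static_mem (hs.drive_mem s)]
  simp only [totalOp, map_add, map_smul, adL_apply, _root_.add_apply]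
  module

include hT

lemma pairSource_integrable : IntervalIntegrable (pairSource h v) volume 0 T := by
  have h1 := intervalIntegrable_clm_apply hT hs.totalAd_integrable
    ((isPrimitive_integral hs.integrable).continuousOn hT)
  refine h1.sub ?_
  rw [intervalIntegrable_iff_integrableOn_Icc_of_le hT]
  have h2 : IntegrableOn (fun s => familyAdL h (v s)) (Icc 0 T) :=
    (familyAdL h).integrable_comp ((intervalIntegrable_iff_integrableOn_Icc_of_le hT).1
      hs.integrable)
  exact h2.continuousOn_smul continuousOn_id isCompact_Icc

lemma logDerivFamily_isPrimitive (n : ℕ) : IsPrimitive T (logDerivFamily h v n)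
    (fun s => match n with
      | 0 => pairSource h v s | n + 1 => totalAd h v s (logDerivFamily h v n s)) := by
  cases n with
  | zero => exact isPrimitive_integral (hs.pairSource_integrable hT)
  | succ n =>
    exact picard_succ_isPrimitive hT hs.totalAd_integrable
      ((isPrimitive_integral (hs.pairSource_integrable hT)).continuousOn hT) n

lemma familySum_logDerivFamily (n : ℕ) {t : ℝ} (ht : t ∈ Icc 0 T) :
    familySum (logDerivFamily h v n t) = logDerivCoeff (totalOp h v) (n + 1) t := by
  have hstep := fun m => logDerivCoeff_succ_isPrimitive hT hs.totalOp_integrable m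
  induction n generalizing t with
  | zero =>
    refine (((hs.logDerivFamily_isPrimitive hT 0).map familySum).congr hT (fun _ _ => rfl)
      fun s hsT => (hs.familySum_pairSource hsT).symm).eq_of_zero (hstep 0) ?_ ht
    simp [logDerivFamily, picard, logDerivCoeff]
  | succ n ih =>
    refine (((hs.logDerivFamily_isPrimitive hT (n + 1)).map familySum).congr hT (fun _ _ => rfl)
      fun s hsT => ?_).eq_of_zero (hstep (n + 1)) ?_ ht
    · rw [hs.familySum_totalAd s (hs.logDerivFamily_mem n s), ih hsT]
    · simp [logDerivFamily, picard, logDerivCoeff]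

lemma drive_norm_integral_mono {s t : ℝ} (hs0 : 0 ≤ s) (hst : s ≤ t) (ht : t ≤ T) :
    ∫ r in (0 : ℝ)..s, ‖v r‖ ≤ ∫ r in (0 : ℝ)..t, ‖v r‖ :=
  intervalIntegral.integral_mono_interval le_rfl hs0 hst
    (Eventually.of_forall fun _ => norm_nonneg _)
    (intervalIntegrable_sub hs.integrable.norm ⟨hs0.trans hst, ht⟩)

lemma logDerivBound_integrable (l : ℝ) (n : ℕ) :
    IntervalIntegrable (logDerivBound l v n) volume 0 T := by
  have hg := (isPrimitive_integral hs.integrable.norm).continuousOn hT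
  have hgi : ∀ f : ℝ → ℝ, Continuous f → ContinuousOn
      (fun s => f s * ∫ r in (0 : ℝ)..s, ‖v r‖) (uIcc 0 T) := fun f hf => by
    rw [uIcc_of_le hT]
    exact hf.continuousOn.mul hg
  cases n with
  | zero =>
    refine IntervalIntegrable.const_mul (IntervalIntegrable.add ?_ ?_) l
    · simpa using (hgi (fun _ => 1) continuous_const).intervalIntegrable
    · exact hs.integrable.norm.continuousOn_mul continuousOn_id
  | succ n => exact (hgi (fun s => (n + 2) * l ^ (n + 2) * s ^ (n + 1)) (by fun_prop)).intervalIntegrable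

/-- For n = 0 the integrand is l times the derivative of s∫_0^s‖v‖. In the other cases the locality
factor n + 2 is cancelled by integrating s^{n+1}. Hence ζ_n obeys a geometric bound with no
factorial. -/
lemma integral_logDerivBound_le {l : ℝ} (hl : 0 ≤ l) (n : ℕ) {t : ℝ} (ht : t ∈ Icc 0 T) :
    ∫ s in (0 : ℝ)..t, logDerivBound l v n s
      ≤ l ^ (n + 1) * t ^ (n + 1) * ∫ r in (0 : ℝ)..t, ‖v r‖ := by
  cases n with
  | zero =>
    simp only [logDerivBound, zero_add, pow_one]
    rw [intervalIntegral.integral_const_mul]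
    have h1 : IsPrimitive T (fun s : ℝ => s) (fun _ => (1 : ℝ)) :=
      ⟨intervalIntegrable_const, fun t _ => by simp⟩
    have h2 := (h1.mul hT (isPrimitive_integral hs.integrable.norm)).eq_integral t ht
    simp only [one_mul, zero_mul, zero_add] at h2
    rw [← h2, mul_assoc]
  | succ n =>
    have hm : ∫ s in (0 : ℝ)..t, logDerivBound l v (n + 1) s
        ≤ ∫ s in (0 : ℝ)..t, (n + 2) * l ^ (n + 2) * s ^ (n + 1) * ∫ r in (0 : ℝ)..t, ‖v r‖ := by
      refine intervalIntegral.integral_mono_on ht.1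
        (intervalIntegrable_sub (hs.logDerivBound_integrable hT l (n + 1)) ht)
        (Continuous.intervalIntegrable (by fun_prop) _ _) fun s hst => ?_
      have := hst.1
      refine mul_le_mul_of_nonneg_left (hs.drive_norm_integral_mono hT hst.1 hst.2 ht.2)
        (by positivity)
    refine hm.trans (le_of_eq ?_)
    rw [intervalIntegral.integral_mul_const, intervalIntegral.integral_const_mul, integral_pow]
    push_cast
    have : (n : ℝ) + 1 + 1 ≠ 0 := by positivity
    field_simp
    ring

include hJ

lemma norm_pairSource_le {s : ℝ} (hsT : s ∈ Icc 0 T) :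
    ‖pairSource h v s‖ ≤ logDerivBound (lam k J) v 0 s := by
  have hl : 0 ≤ lam k J := by unfold lam; positivity
  have hv : ∀ s, v s ∈ localFamilies (k * 1) := fun s => by simpa using hs.drive_mem s
  have h1 := hs.norm_totalAd_le hJ s (hs.integral_drive_mem s)
  have h2 := hs.norm_staticAd_le hJ (hv s)
  have h3 := intervalIntegral.norm_integral_le_integral_norm (f := v) (μ := volume) hsT.1
  simp only [Nat.cast_one, mul_one] at h1 h2
  have h4 : ‖s • familyAdL h (v s)‖ ≤ s * (lam k J * ‖v s‖) := by
    rw [norm_smul, Real.norm_eq_abs, abs_of_nonneg hsT.1]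
    exact mul_le_mul_of_nonneg_left h2 hsT.1
  have h5 := mul_le_mul_of_nonneg_left h3 hl
  simp only [logDerivBound]
  refine (norm_sub_le _ _).trans ?_
  rw [mul_add]
  linarith

lemma norm_totalAd_logDerivFamily_le (n : ℕ) {s : ℝ}
    (hn : ‖logDerivFamily h v n s‖
      ≤ lam k J ^ (n + 1) * s ^ (n + 1) * ∫ r in (0 : ℝ)..s, ‖v r‖) :
    ‖totalAd h v s (logDerivFamily h v n s)‖ ≤ logDerivBound (lam k J) v (n + 1) s := by
  have hl : 0 ≤ lam k J := by unfold lam; positivity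
  refine (hs.norm_totalAd_le hJ s (hs.logDerivFamily_mem n s)).trans
    ((mul_le_mul_of_nonneg_left hn (by positivity)).trans (le_of_eq ?_))
  simp only [logDerivBound]
  push_cast
  ring

lemma norm_logDerivFamily_le (n : ℕ) {t : ℝ} (ht : t ∈ Icc 0 T) :
    ‖logDerivFamily h v n t‖ ≤ lam k J ^ (n + 1) * t ^ (n + 1) * ∫ r in (0 : ℝ)..t, ‖v r‖ := by
  have hl : 0 ≤ lam k J := by unfold lam; positivity
  induction n generalizing t with
  | zero =>
    have h1 := (hs.logDerivFamily_isPrimitive hT 0).norm_sub_le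
      (hs.logDerivBound_integrable hT (lam k J) 0)
      (fun s hsT => hs.norm_pairSource_le hJ hT hsT) ht
    have h0 : logDerivFamily h v 0 0 = 0 := by simp [logDerivFamily, picard]
    rw [h0, sub_zero] at h1
    exact h1.trans (hs.integral_logDerivBound_le hT hl 0 ht)
  | succ n ih =>
    have h1 := (hs.logDerivFamily_isPrimitive hT (n + 1)).norm_sub_le
      (hs.logDerivBound_integrable hT (lam k J) (n + 1))
      (fun s hsT => hs.norm_totalAd_logDerivFamily_le hJ hT n (ih hsT)) ht
    have h0 : logDerivFamily h v (n + 1) 0 = 0 := by simp [logDerivFamily, picard]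
    rw [h0, sub_zero] at h1
    exact h1.trans (hs.integral_logDerivBound_le hT hl (n + 1) ht)

lemma integral_norm_adL_logDerivCoeff_le (n : ℕ) :
    ∫ s in (0 : ℝ)..T, ‖adL (totalOp h v s) (logDerivCoeff (totalOp h v) n s)‖
      ≤ (∫ s in (0 : ℝ)..T, ‖v s‖) * (lam k J * T) ^ (n + 1) := by
  have hl : 0 ≤ lam k J := by unfold lam; positivity
  have hTT : T ∈ Icc 0 T := ⟨hT, le_rfl⟩
  have hint := intervalIntegrable_clm_apply hT (intervalIntegrable_adL hs.totalOp_integrable)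
    ((logDerivCoeff_isPrimitive hT hs.totalOp_integrable n).continuousOn hT)
  have hle : ∀ s ∈ Icc 0 T, ‖adL (totalOp h v s) (logDerivCoeff (totalOp h v) n s)‖
      ≤ logDerivBound (lam k J) v n s := by
    intro s hsT
    cases n with
    | zero =>
      rw [← hs.familySum_pairSource hsT]
      exact (norm_familySum_le _).trans (hs.norm_pairSource_le hJ hT hsT)
    | succ n =>
      rw [← hs.familySum_logDerivFamily hT n hsT,
        ← hs.familySum_totalAd s (hs.logDerivFamily_mem n s)]
      exact (norm_familySum_le _).trans (hs.norm_totalAd_logDerivFamily_le hJ hT n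
        (hs.norm_logDerivFamily_le hJ hT n hsT))
  refine (intervalIntegral.integral_mono_on hT hint.norm
    (hs.logDerivBound_integrable hT (lam k J) n) hle).trans
    ((hs.integral_logDerivBound_le hT hl n hTT).trans (le_of_eq ?_))
  rw [mul_pow]
  ring

end IsDrivenFamily
end LogDerivBounds

/-! ### Numerical estimates up to the optimal order -/

section TruncationError

/-- The total degree P is at most 2n + 1 ≤ 3n, so μP ≤ 3/16 and P! ≤ P^P is beaten by μ^P. The power
of 2 doubles the ratio to 3/8, and P - 1 ≥ n. -/
lemma defect_term_le {μ : ℝ} {n : ℕ} (hμ : 0 ≤ μ) (hn : 1 ≤ n) (hμn : μ * n ≤ 1 / 16)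
    {p : ℕ × ℕ} (hp : p ∈ defectIndex n) :
    μ ^ (p.1 + p.2 + 1) * ((p.1 + p.2 + 1).factorial : ℝ) * 2 ^ p.1
      ≤ 3 / 16 * (3 / 8 : ℝ) ^ n := by
  simp only [defectIndex, Finset.mem_filter, Finset.mem_product, Finset.mem_range] at hp
  set P := p.1 + p.2 + 1 with hP
  have hn' : (1 : ℝ) ≤ n := by exact_mod_cast hn
  have hPn : (P : ℝ) ≤ 2 * n + 1 := by exact_mod_cast (by omega : P ≤ 2 * n + 1)
  have h1 : μ ^ P * (P.factorial : ℝ) ≤ (3 / 16 : ℝ) ^ P := by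
    have h2 : (P.factorial : ℝ) ≤ (P : ℝ) ^ P := by exact_mod_cast Nat.factorial_le_pow P
    calc μ ^ P * (P.factorial : ℝ) ≤ μ ^ P * (P : ℝ) ^ P := by gcongr
      _ = (μ * P) ^ P := (mul_pow _ _ _).symm
      _ ≤ (3 / 16 : ℝ) ^ P := pow_le_pow_left₀ (by positivity) (by nlinarith) _
  have h3 : (2 : ℝ) ^ p.1 ≤ 2 ^ (p.1 + p.2) := pow_le_pow_right₀ one_le_two (by omega)
  calc μ ^ P * (P.factorial : ℝ) * 2 ^ p.1 ≤ (3 / 16 : ℝ) ^ P * 2 ^ (p.1 + p.2) := by gcongr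
    _ = 3 / 16 * (3 / 8 : ℝ) ^ (p.1 + p.2) := by
        rw [hP, pow_succ, show (3 / 8 : ℝ) = 3 / 16 * 2 by norm_num, mul_pow]; ring
    _ ≤ 3 / 16 * (3 / 8 : ℝ) ^ n := by
        gcongr ?_ * ?_
        exact pow_le_pow_of_le_one (by norm_num) (by norm_num) hp.2

/-- There are at most (n+1)² pairs. Writing 3/8 = 3/4·1/2, Bernoulli's inequality lets (3/4)^n
absorb one factor n + 1; the other is left for the denominator n + 2 of the error. -/
lemma sum_defect_term_le {μ : ℝ} {n : ℕ} (hμ : 0 ≤ μ) (hn : 1 ≤ n) (hμn : μ * n ≤ 1 / 16) :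
    ∑ p ∈ defectIndex n, μ ^ (p.1 + p.2 + 1) * ((p.1 + p.2 + 1).factorial : ℝ) * 2 ^ p.1
      ≤ ((n : ℝ) + 1) * (9 / 16) * (1 / 2 : ℝ) ^ n := by
  refine (Finset.sum_le_card_nsmul _ _ _ fun p hp => defect_term_le hμ hn hμn hp).trans ?_
  have hcard : ((defectIndex n).card : ℝ) ≤ ((n : ℝ) + 1) * (n + 1) := by
    have : (defectIndex n).card ≤ (n + 1) * (n + 1) := (Finset.card_filter_le _ _).trans (by simp)
    exact_mod_cast this
  have hb : ((n : ℝ) + 1) * (3 / 4 : ℝ) ^ n ≤ 3 := by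
    have h1 := one_add_mul_le_pow (a := (1 / 3 : ℝ)) (by norm_num) n
    have h2 : (3 / 4 : ℝ) ^ n * (1 + 1 / 3) ^ n = 1 := by
      rw [← mul_pow]; norm_num
    have h3 : (0 : ℝ) < (3 / 4 : ℝ) ^ n := by positivity
    nlinarith
  rw [nsmul_eq_mul]
  calc ((defectIndex n).card : ℝ) * (3 / 16 * (3 / 8 : ℝ) ^ n)
      ≤ ((n : ℝ) + 1) * (n + 1) * (3 / 16 * (3 / 8 : ℝ) ^ n) := by gcongr
    _ = ((n : ℝ) + 1) * (3 / 16) * (((n : ℝ) + 1) * (3 / 4 : ℝ) ^ n) * (1 / 2 : ℝ) ^ n := by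
        rw [show (3 / 8 : ℝ) = 3 / 4 * (1 / 2) by norm_num, mul_pow]; ring
    _ ≤ ((n : ℝ) + 1) * (3 / 16) * 3 * (1 / 2 : ℝ) ^ n := by gcongr
    _ = _ := by ring

/-- A geometric sum with ratio 1/16, hence 16/15. The subtracted last term is what closes the
induction. -/
lemma sum_Ico_le_of_ratio {b : ℕ → ℝ} {p q : ℕ} (hpq : p ≤ q)
    (hb : ∀ m, p ≤ m → m < q → 16 * b (m + 1) ≤ b m) :
    ∑ m ∈ Finset.Ico p (q + 1), b m ≤ 16 / 15 * b p - 1 / 15 * b q := by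
  induction q, hpq using Nat.le_induction with
  | base => rw [Finset.sum_Ico_succ_top le_rfl]; simp; linarith
  | succ q hpq ih =>
    rw [Finset.sum_Ico_succ_top (by omega)]
    have h1 := ih fun m h1 h2 => hb m h1 (by omega)
    have h2 := hb q hpq (by omega)
    linarith

variable {N d k : ℕ} {J T : ℝ} {h : Family N d} {v : ℝ → Family N d}

namespace IsDrivenFamily

/-- The truncation error at a fixed order. -/
theorem norm_sub_le_sum_defect (hs : IsDrivenFamily k J T h v) (hJ : 0 ≤ J) (hT : 0 ≤ T)
    (hskew : ∀ t, totalOp h v t ∈ skewAdjoint (Op N d)) (n : ℕ) :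
    ‖dysonSum (totalOp h v) 1 T
        - NormedSpace.exp (∑ m ∈ Finset.range (n + 1), magnusCoeff (totalOp h v) T m)‖
      ≤ (∫ s in (0 : ℝ)..T, ‖v s‖) * ((lam k J * T) ^ (n + 1)
        + ∑ p ∈ defectIndex n, (lam k J * T) ^ (p.1 + p.2 + 1)
          * ((p.1 + p.2 + 1).factorial : ℝ) * 2 ^ p.1) / (n + 2) := by
  rw [mul_add]
  exact norm_dysonSum_sub_exp_le hskew hT hs.totalOp_integrable n
    (hs.integral_norm_adL_logDerivCoeff_le hJ hT n) (hs.sum_defect_le hJ hT n)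

/-- The truncation error at order zero. -/
theorem norm_sub_le_zero (hs : IsDrivenFamily k J T h v) (hJ : 0 ≤ J) (hT : 0 ≤ T)
    (hskew : ∀ t, totalOp h v t ∈ skewAdjoint (Op N d)) :
    ‖dysonSum (totalOp h v) 1 T
        - NormedSpace.exp (∑ m ∈ Finset.range (0 + 1), magnusCoeff (totalOp h v) T m)‖
      ≤ (∫ s in (0 : ℝ)..T, ‖v s‖) * (lam k J * T) / 2 := by
  have h1 := norm_dysonSum_sub_exp_le hskew hT hs.totalOp_integrable 0
    (hs.integral_norm_adL_logDerivCoeff_le hJ hT 0) (sum_defect_zero _).le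
  simpa using h1

/-- The truncation error at orders `n` with `λ T n ≤ 1 / 16`. -/
theorem norm_sub_le_two_pow (hs : IsDrivenFamily k J T h v) (hJ : 0 ≤ J) (hT : 0 ≤ T)
    (hskew : ∀ t, totalOp h v t ∈ skewAdjoint (Op N d)) {n : ℕ} (hn : 1 ≤ n)
    (hμn : lam k J * T * n ≤ 1 / 16) :
    ‖dysonSum (totalOp h v) 1 T
        - NormedSpace.exp (∑ m ∈ Finset.range (n + 1), magnusCoeff (totalOp h v) T m)‖
      ≤ (∫ s in (0 : ℝ)..T, ‖v s‖) * (1 / 2 : ℝ) ^ n := by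
  have hl : 0 ≤ lam k J := by unfold lam; positivity
  set V := ∫ s in (0 : ℝ)..T, ‖v s‖ with hV
  have hV0 : 0 ≤ V := intervalIntegral.integral_nonneg hT fun _ _ => norm_nonneg _
  set μ := lam k J * T with hμ
  have hμ0 : 0 ≤ μ := by positivity
  have hn' : (1 : ℝ) ≤ n := by exact_mod_cast hn
  have hμ1 : μ ≤ 1 / 16 := by nlinarith
  refine (hs.norm_sub_le_sum_defect hJ hT hskew n).trans ?_
  rw [div_le_iff₀ (by positivity), mul_assoc]
  refine mul_le_mul_of_nonneg_left ?_ hV0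
  have h1 := sum_defect_term_le hμ0 hn hμn
  have h2 : μ ^ (n + 1) ≤ (1 / 2 : ℝ) ^ n := by
    calc μ ^ (n + 1) ≤ (1 / 2 : ℝ) ^ (n + 1) := pow_le_pow_left₀ hμ0 (by linarith) _
      _ ≤ (1 / 2 : ℝ) ^ n := pow_le_pow_of_le_one (by norm_num) (by norm_num) (by omega)
  have h3 : (0 : ℝ) < (1 / 2 : ℝ) ^ n := by positivity
  nlinarith

/-- The truncation error at all orders `n` below the optimal one. -/
theorem norm_sub_le_optimal (hs : IsDrivenFamily k J T h v) (hJ : 0 ≤ J) (hT : 0 ≤ T)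
    (hskew : ∀ t, totalOp h v t ∈ skewAdjoint (Op N d)) {n n₀ : ℕ} (hn : n ≤ n₀)
    (hμn : lam k J * T * n₀ ≤ 1 / 16) :
    ‖dysonSum (totalOp h v) 1 T
        - NormedSpace.exp (∑ m ∈ Finset.range (n + 1), magnusCoeff (totalOp h v) T m)‖
      ≤ (∫ s in (0 : ℝ)..T, ‖v s‖) * (1 / 2 : ℝ) ^ n₀
        + 2 / ((n : ℝ) + 2) ^ 2 * ((∫ s in (0 : ℝ)..T, ‖v s‖) * (lam k J * T) ^ (n + 1)
          * ((n + 1).factorial : ℝ)) := by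
  have hl : 0 ≤ lam k J := by unfold lam; positivity
  set V := ∫ s in (0 : ℝ)..T, ‖v s‖ with hV
  have hV0 : 0 ≤ V := intervalIntegral.integral_nonneg hT fun _ _ => norm_nonneg _
  set μ := lam k J * T with hμ
  have hμ0 : 0 ≤ μ := by positivity
  -- At n = 0 the first omitted coefficient is y_1, for which the constant 3/2 is not available. The
  -- direct bound Vμ/2 is already exactly the last term claimed.
  rcases Nat.eq_zero_or_pos n with rfl | hn1
  · refine (hs.norm_sub_le_zero hJ hT hskew).trans ?_
    have h1 : 0 ≤ V * (1 / 2 : ℝ) ^ n₀ := by positivity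
    have h2 : 2 / (((0 : ℕ) : ℝ) + 2) ^ 2 * (V * μ ^ (0 + 1) * ((0 + 1).factorial : ℝ))
        = V * μ / 2 := by norm_num; ring
    rw [h2]
    linarith
  set y := magnusCoeff (totalOp h v) T with hy
  set b : ℕ → ℝ := fun m => 3 / 2 / ((m : ℝ) + 1) ^ 2 * (V * μ ^ m * (m.factorial : ℝ)) with hb
  have hyb : ∀ m, 2 ≤ m → ‖y m‖ ≤ b m := by
    intro m hm
    obtain ⟨i, rfl⟩ : ∃ i, m = i + 1 := ⟨m - 1, by omega⟩
    obtain ⟨z, -, hzs, -, hzn⟩ := hs.exists_magnusCoeff hJ hT i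
    rw [hy, ← hzs]
    refine (norm_familySum_le z).trans ((hzn (by omega)).trans (le_of_eq ?_))
    simp only [hb]
    push_cast
    ring
  have hsk : ∀ n, ∑ m ∈ Finset.range (n + 1), y m ∈ skewAdjoint (Op N d) := fun n =>
    sum_mem fun m _ => magnusCoeff_mem_skewAdjoint hskew m
  -- The triangle inequality passes through the optimal order n₀; exponentials of skew-adjoint
  -- elements differ by at most their exponents, so the second part is ∑‖y_m‖ over n < m ≤ n₀.
  have h1 := hs.norm_sub_le_two_pow hJ hT hskew (le_trans hn1 hn) hμn
  have h2 := norm_exp_sub_exp_le (hsk n) (hsk n₀)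
  have h3 : (∑ m ∈ Finset.range (n₀ + 1), y m) - ∑ m ∈ Finset.range (n + 1), y m
      = ∑ m ∈ Finset.Ico (n + 1) (n₀ + 1), y m := by
    rw [Finset.sum_Ico_eq_sub _ (by omega)]
  rw [h3] at h2
  have h4 : ‖∑ m ∈ Finset.Ico (n + 1) (n₀ + 1), y m‖ ≤ 16 / 15 * b (n + 1) := by
    rcases hn.eq_or_lt with rfl | hlt
    · simp only [Finset.Ico_self, Finset.sum_empty, norm_zero]; positivity
    · have h5 : ∑ m ∈ Finset.Ico (n + 1) (n₀ + 1), ‖y m‖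
          ≤ ∑ m ∈ Finset.Ico (n + 1) (n₀ + 1), b m :=
        Finset.sum_le_sum fun m hm => hyb m (by have := (Finset.mem_Ico.1 hm).1; omega)
      have h6 := sum_Ico_le_of_ratio (b := b) (p := n + 1) (q := n₀) hlt fun m _ hm => by
        have hmn : ((m : ℝ) + 1) ≤ n₀ := by exact_mod_cast hm
        have hμm : 16 * (μ * ((m : ℝ) + 1)) ≤ 1 := by nlinarith
        simp only [hb]
        rw [Nat.factorial_succ]
        push_cast
        have h7 : 3 / 2 / ((m : ℝ) + 1 + 1) ^ 2 ≤ 3 / 2 / ((m : ℝ) + 1) ^ 2 := by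
          gcongr
          linarith
        calc 16 * (3 / 2 / ((m : ℝ) + 1 + 1) ^ 2 * (V * μ ^ (m + 1)
              * (((m : ℝ) + 1) * (m.factorial : ℝ))))
            = 16 * (μ * ((m : ℝ) + 1)) * (3 / 2 / ((m : ℝ) + 1 + 1) ^ 2
              * (V * μ ^ m * (m.factorial : ℝ))) := by ring
          _ ≤ 3 / 2 / ((m : ℝ) + 1 + 1) ^ 2 * (V * μ ^ m * (m.factorial : ℝ)) :=
              mul_le_of_le_one_left (by positivity) hμm
          _ ≤ _ := mul_le_mul_of_nonneg_right h7 (by positivity)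
      have h8 : 0 ≤ b n₀ := by positivity
      linarith [norm_sum_le (Finset.Ico (n + 1) (n₀ + 1)) y]
  -- Here 16/15·3/2 = 8/5 ≤ 2: the gain from 2 to 3/2 pays for the geometric tail.
  have h9 : 16 / 15 * b (n + 1) ≤ 2 / ((n : ℝ) + 2) ^ 2 * (V * μ ^ (n + 1)
      * ((n + 1).factorial : ℝ)) := by
    simp only [hb]
    push_cast
    rw [show (n : ℝ) + 1 + 1 = n + 2 by ring, ← mul_assoc]
    refine mul_le_mul_of_nonneg_right ?_ (by positivity)
    rw [← mul_div_assoc]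
    gcongr
    norm_num
  have h10 := norm_sub_le_norm_sub_add_norm_sub (dysonSum (totalOp h v) 1 T)
    (NormedSpace.exp (∑ m ∈ Finset.range (n₀ + 1), y m))
    (NormedSpace.exp (∑ m ∈ Finset.range (n + 1), y m))
  linarith

end IsDrivenFamily
end TruncationError

/-! ### Identification with the Dyson series and the terms Ω_n of the statement -/

section Link

variable {N d : ℕ} {T : ℝ} {H : ℝ → Op N d}

/-- The generator `-i H(t)`. -/
def generator (H : ℝ → Op N d) (t : ℝ) : Op N d := (-Complex.I) • H t

/-- At x = 1 a descent has weight 0, so the cube integral of chains specializes to the ordered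
integral of the Dyson series. -/
lemma chainWeight_one (n : ℕ) (t : Fin (n + 1) → ℝ) :
    chainWeight 1 n t = open Classical in if Monotone t then 1 else 0 := by
  classical
  simp only [chainWeight, stepWeight, sub_self]
  split_ifs with ht
  · exact Finset.prod_eq_one fun i _ => if_pos (ht (Fin.castSucc_lt_succ (i := i)).le)
  · rw [Fin.monotone_iff_le_succ] at ht
    push Not at ht
    obtain ⟨i, hi⟩ := ht
    exact Finset.prod_eq_zero (Finset.mem_univ i) (if_neg (not_le.2 hi))

lemma setIntegral_orderedTimes_word {E : Type*} [NormedAddCommGroup E] [NormedSpace ℝ E]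
    [CompleteSpace E] {a : ℝ → E →L[ℝ] E} {e : ℝ → E} (hT : 0 ≤ T)
    (ha : IntervalIntegrable a volume 0 T) (he : IntervalIntegrable e volume 0 T) (n : ℕ) :
    ∫ t in orderedTimes (n + 1) T, word a e n t
      = picard a (fun t => ∫ s in (0 : ℝ)..t, e s) n T := by
  classical
  have h1 := integral_chainWeight_smul_word hT ha he (x := 1) (by simp) n (h := fun _ => 1)
    measurable_const (by simp)
  simp only [one_mul, one_smul] at h1
  rw [integral_Icc_eq_integral_Ioc, ← intervalIntegral.integral_of_le hT,
    ← chain_eq_integral] at h1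
  have h2 : ∀ m, chain a e 1 T m = picard a (fun t => ∫ s in (0 : ℝ)..t, e s) m := by
    intro m
    induction m with
    | zero => rfl
    | succ m ih =>
      funext t
      simp only [chain, picard, ih, sub_self, zero_smul, zero_add]
  rw [h2] at h1
  rw [← h1, cubeMeasure_eq, ← integral_indicator (measurableSet_orderedTimes _ _),
    ← integral_indicator (MeasurableSet.univ_pi fun _ => measurableSet_Icc)]
  refine integral_congr_ae (Eventually.of_forall fun t => ?_)
  rw [indicator, indicator]
  by_cases hc : t ∈ univ.pi fun _ : Fin (n + 1) => Icc 0 T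
  · rw [if_pos hc, chainWeight_one]
    by_cases hm : Monotone t
    · rw [if_pos (show t ∈ orderedTimes (n + 1) T from ⟨fun i => hc i (mem_univ i), hm⟩),
        if_pos hm, one_smul]
    · rw [if_neg fun h : t ∈ orderedTimes (n + 1) T => hm h.2, if_neg hm, zero_smul]
  · rw [if_neg hc, if_neg fun h : t ∈ orderedTimes (n + 1) T => hc fun i _ => h.1 i]

lemma word_mul_generator (H : ℝ → Op N d) (n : ℕ) (t : Fin (n + 1) → ℝ) :
    word (fun s => ContinuousLinearMap.mul ℝ (Op N d) (generator H s)) (generator H) n t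
      = (-Complex.I) ^ (n + 1) • (List.ofFn fun i : Fin (n + 1) => H (t i.rev)).prod := by
  induction n with
  | zero => simp [word, generator]
  | succ n ih =>
    rw [word, ih, List.ofFn_succ (f := fun i : Fin (n + 1 + 1) => H (t i.rev)), List.prod_cons]
    simp only [ContinuousLinearMap.mul_apply', generator, Fin.rev_zero, Fin.rev_succ]
    rw [smul_mul_smul_comm, ← pow_succ']

lemma dysonTerm_eq (hT : 0 ≤ T) (hH : IntervalIntegrable (generator H) volume 0 T) (m : ℕ) :
    dysonTerm H T m = dysonCoeff (generator H) m T := by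
  cases m with
  | zero =>
    have h1 : orderedTimes 0 T = univ := by
      ext t
      simp [orderedTimes, Subsingleton.monotone]
    rw [dysonTerm, h1, volume_pi, Measure.pi_of_empty]
    simp [dysonCoeff, picard]
  | succ n =>
    rw [dysonTerm, ← integral_smul]
    simp_rw [← word_mul_generator]
    rw [setIntegral_orderedTimes_word hT (intervalIntegrable_mulL hH) hH]
    have h2 : ∀ m, picard (fun s => ContinuousLinearMap.mul ℝ (Op N d) (generator H s))
        (fun t => ∫ s in (0 : ℝ)..t, generator H s) m = dysonCoeff (generator H) (m + 1) := by
      intro m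
      induction m with
      | zero => funext t; simp [dysonCoeff, picard]
      | succ m ih =>
        funext t
        rw [picard, ih]
        rfl
    rw [h2]

lemma timeOrderedExp_eq (hT : 0 ≤ T) (hH : IntervalIntegrable (generator H) volume 0 T) :
    timeOrderedExp H T = dysonSum (generator H) 1 T := by
  rw [timeOrderedExp, dysonSum]
  exact tsum_congr fun m => by rw [dysonTerm_eq hT hH, one_pow, one_smul]

lemma word_adL_generator (H : ℝ → Op N d) (n : ℕ) (t : Fin (n + 1) → ℝ) :
    word (fun s => adL (generator H s)) (generator H) n t
      = (-Complex.I) ^ (n + 1) • multiCommutator n fun i => H (t i) := by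
  induction n with
  | zero => simp [word, generator, multiCommutator]
  | succ n ih =>
    rw [word, ih, multiCommutator, Ring.lie_def]
    simp only [adL_apply, generator]
    rw [smul_mul_smul_comm, smul_mul_smul_comm, ← pow_succ', ← pow_succ, smul_sub]

/-- The n + 1 generators contribute (-i)^{n+1}, and i^{-n} = (-i)^n, so the normalization 1/(i^n
T^{n+1}) of Ω_n is exactly undone by -iT^{n+1}. -/
lemma smul_fmTerm_eq (hT : T ≠ 0) (H : ℝ → Op N d) (n : ℕ) :
    ((-Complex.I * (T : ℂ)) * (T : ℂ) ^ n) • fmTerm H T n = magnusCoeff (generator H) T n := by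
  have hTc : (T : ℂ) ≠ 0 := by exact_mod_cast hT
  rw [fmTerm, magnusCoeff, magnusTerm, smul_smul, Finset.smul_sum, Finset.smul_sum]
  refine Finset.sum_congr rfl fun σ _ => ?_
  simp_rw [word_adL_generator]
  rw [integral_smul, ← Complex.coe_smul, ← Complex.coe_smul, smul_smul, smul_smul, smul_smul]
  congr 1
  have hI : Complex.I ^ n * (-Complex.I) ^ n = 1 := by rw [← mul_pow]; simp
  have hI0 : Complex.I ^ n ≠ 0 := pow_ne_zero _ Complex.I_ne_zero
  have hn : (n.factorial : ℂ) ≠ 0 := by exact_mod_cast n.factorial_ne_zero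
  have hn1 : (n : ℂ) + 1 ≠ 0 := by exact_mod_cast n.succ_ne_zero
  have hI' : (-Complex.I) ^ n = 1 / Complex.I ^ n := by
    rw [eq_div_iff hI0, mul_comm]; exact hI
  push_cast
  rw [pow_succ (-Complex.I) n, hI']
  field_simp
  ring

lemma evolution_fmTruncated_eq (hT : T ≠ 0) (H : ℝ → Op N d) (n : ℕ) :
    evolution (fmTruncated H T n) T
      = NormedSpace.exp (∑ m ∈ Finset.range (n + 1), magnusCoeff (generator H) T m) := by
  rw [evolution, fmTruncated, Finset.smul_sum]
  congr 1
  exact Finset.sum_congr rfl fun m _ => by rw [smul_smul, smul_fmTerm_eq hT]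

lemma generator_mem_skewAdjoint (hH : ∀ t, (H t).IsHermitian) (t : ℝ) :
    generator H t ∈ skewAdjoint (Op N d) := by
  rw [skewAdjoint.mem_iff, generator, star_smul, Matrix.star_eq_conjTranspose, (hH t).eq]
  simp

end Link

/-! ### From the physical few-body data to families of generators -/

section FewBody

variable {N d k : ℕ} {J T : ℝ} {h : Finset (Fin N) → Op N d} {v : Finset (Fin N) → ℝ → Op N d}

/-- The family `-i a_X`, `|X| ≤ k`. -/
def fewBodyFamily (k : ℕ) (a : Finset (Fin N) → Op N d) : Family N d :=
  Family.of fun X => if X ∈ fewBody N k then (-Complex.I) • a X else 0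

lemma familySum_fewBodyFamily (a : Finset (Fin N) → Op N d) :
    familySum (fewBodyFamily k a) = (-Complex.I) • fewBodySum k a := by
  rw [familySum_apply, fewBodySum, Finset.smul_sum]
  simp only [fewBodyFamily, Family.of_apply]
  rw [← Finset.sum_filter]
  simp

lemma fewBodyFamily_mem {a : Finset (Fin N) → Op N d} (ha : ∀ X ∈ fewBody N k, ActsOn X (a X)) :
    fewBodyFamily k a ∈ localFamilies k := by
  intro X
  change ActsOn X (if X ∈ fewBody N k then (-Complex.I) • a X else 0) ∧
    (k < X.card → (if X ∈ fewBody N k then (-Complex.I) • a X else 0) = 0)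
  refine ⟨?_, fun hX => if_neg fun h => ?_⟩
  · split_ifs with hX
    · exact (ha X hX).smul _
    · exact actsOn_zero
  · have := (Finset.mem_filter.1 h).2
    omega

lemma norm_fewBodyFamily_apply (a : Finset (Fin N) → Op N d) (X : Finset (Fin N)) :
    ‖fewBodyFamily k a X‖ = if X ∈ fewBody N k then ‖a X‖ else 0 := by
  simp only [fewBodyFamily, Family.of_apply]
  split_ifs
  · rw [norm_smul]; simp
  · exact norm_zero

/-- The family with the single member `a` at `X`. -/
def Family.single (X : Finset (Fin N)) : Op N d →L[ℝ] Family N d :=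
  LinearMap.mkContinuous
    { toFun := fun a => Family.of (Pi.single X a)
      map_add' := fun a b => Family.ext fun Y => by simp [Pi.single_add]
      map_smul' := fun c a => Family.ext fun Y => by simp [Pi.single_smul] } 1
    fun a => by
      rw [Family.norm_eq, Finset.sum_eq_single X]
      · simp
      · intro Y _ hY; simp [Pi.single_eq_of_ne hY]
      · simp

lemma fewBodyFamily_integrable
    (hv : ∀ X ∈ fewBody N k, IntervalIntegrable (v X) volume 0 T) :
    IntervalIntegrable (fun t => fewBodyFamily k fun X => v X t) volume 0 T := by
  have h1 : (fun t => fewBodyFamily k fun X => v X t)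
      = fun t => ∑ X ∈ fewBody N k, Family.single X ((-Complex.I) • v X t) := by
    funext t
    refine Family.ext fun Y => ?_
    have h2 : ∀ (s : Finset (Finset (Fin N))) (g : Finset (Fin N) → Op N d),
        (∑ X ∈ s, Family.single X (g X)) Y = if Y ∈ s then g Y else 0 := by
      intro s g
      induction s using Finset.induction_on with
      | empty => simp
      | insert X s hX ih =>
        rw [Finset.sum_insert hX, Family.add_apply, ih]
        change (Pi.single X (g X) : Finset (Fin N) → Op N d) Y + _ = _
        by_cases hY : Y = X
        · subst hY; simp [hX]
        · simp [hY]
    rw [h2]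
    rfl
  rw [h1]
  have h3 : ∀ X ∈ fewBody N k, IntervalIntegrable
      (fun t => Family.single X ((-Complex.I) • v X t)) volume 0 T := fun X hX =>
    ⟨(Family.single X).integrable_comp ((hv X hX).1.smul (-Complex.I)),
      (Family.single X).integrable_comp ((hv X hX).2.smul (-Complex.I))⟩
  exact ⟨integrable_finsetSum _ fun X hX => (h3 X hX).1,
    integrable_finsetSum _ fun X hX => (h3 X hX).2⟩

namespace IsDrivenFewBody

variable (hs : IsDrivenFewBody k J T h v)

include hs

lemma isDrivenFamily : IsDrivenFamily k J T (fewBodyFamily k h)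
    (fun t => fewBodyFamily k fun X => v X t) where
  static_mem := fewBodyFamily_mem hs.static_actsOn
  drive_mem t := fewBodyFamily_mem fun X hX => hs.drive_actsOn X hX t
  integrable := fewBodyFamily_integrable hs.drive_integrable
  strength i t := by
    refine le_trans (le_of_eq ?_) (hs.strength i t)
    simp only [norm_fewBodyFamily_apply]
    rw [Finset.sum_filter, Finset.sum_filter, ← Finset.sum_filter_add_sum_filter_not Finset.univ
      (fun X => X ∈ fewBody N k)]
    rw [Finset.sum_eq_zero (s := Finset.univ.filter fun X => X ∉ fewBody N k) fun X hX => by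
      simp [(Finset.mem_filter.1 hX).2], add_zero]
    refine Finset.sum_congr (by ext; simp) fun X hX => ?_
    simp [hX]

omit hs in
lemma totalOp_eq : totalOp (fewBodyFamily k h) (fun t => fewBodyFamily k fun X => v X t)
    = generator (hamiltonian k h v) := by
  funext t
  rw [totalOp, map_add, familySum_fewBodyFamily, familySum_fewBodyFamily, ← smul_add]
  rfl

lemma generator_skew (t : ℝ) : generator (hamiltonian k h v) t ∈ skewAdjoint (Op N d) :=
  generator_mem_skewAdjoint (fun t => hs.static_hermitian.add (hs.drive_hermitian t)) t

lemma integral_norm_drive (hT : 0 < T) :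
    ∫ t in (0 : ℝ)..T, ‖fewBodyFamily k fun X => v X t‖ = driveStrength k T v * T := by
  have h1 : ∀ t, ‖fewBodyFamily k fun X => v X t‖ = ∑ X ∈ fewBody N k, ‖v X t‖ := fun t => by
    rw [Family.norm_eq]
    simp only [norm_fewBodyFamily_apply]
    rw [← Finset.sum_filter]
    simp
  simp_rw [h1]
  rw [intervalIntegral.integral_finsetSum fun X hX => (hs.drive_integrable X hX).norm,
    driveStrength, Finset.sum_mul]
  exact Finset.sum_congr rfl fun X _ => by field_simp

end IsDrivenFewBody
end FewBody

/-! ### The error bound and the asymptotic statement -/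

section Conclusion

variable {N d k : ℕ} {J T : ℝ} {h : Finset (Fin N) → Op N d} {v : Finset (Fin N) → ℝ → Op N d}

lemma driveStrength_nonneg (hT : 0 < T) : 0 ≤ driveStrength k T v :=
  Finset.sum_nonneg fun _ _ => mul_nonneg (by positivity)
    (intervalIntegral.integral_nonneg hT.le fun _ _ => norm_nonneg _)

namespace IsDrivenFewBody

lemma generator_integrable (hs : IsDrivenFewBody k J T h v) :
    IntervalIntegrable (generator (hamiltonian k h v)) volume 0 T := by
  have := hs.isDrivenFamily.totalOp_integrable
  rwa [totalOp_eq] at this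

/-- The error of the truncated expansion up to the optimal order. -/
theorem norm_timeOrderedExp_sub_le (hs : IsDrivenFewBody k J T h v) (hk : 1 ≤ k) (hJ : 0 < J)
    (hT : 0 < T) {n : ℕ} (hn : n ≤ optimalOrder k J T) :
    ‖timeOrderedExp (hamiltonian k h v) T - evolution (fmTruncated (hamiltonian k h v) T n) T‖
      ≤ 6 * driveStrength k T v * T * (2 : ℝ) ^ (-(optimalOrder k J T : ℤ))
        + fmBound (driveStrength k T v) (lam k J) (n + 1) * T ^ (n + 2) := by
  have hk' : (0 : ℝ) < k := by exact_mod_cast hk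
  have hl : 0 < lam k J := by unfold lam; positivity
  have hV0 := driveStrength_nonneg (k := k) (v := v) hT
  -- The floor defining n₀ enters only through this inequality.
  have hopt : lam k J * T * optimalOrder k J T ≤ 1 / 16 := by
    have h1 : (optimalOrder k J T : ℝ) ≤ 1 / (16 * lam k J * T) := Nat.floor_le (by positivity)
    calc lam k J * T * optimalOrder k J T ≤ lam k J * T * (1 / (16 * lam k J * T)) := by gcongr
      _ = 1 / 16 := by field_simp
  have h2 := hs.isDrivenFamily.norm_sub_le_optimal hJ.le hT.le
    (fun t => by rw [totalOp_eq]; exact hs.generator_skew t) hn hopt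
  rw [hs.integral_norm_drive hT, totalOp_eq] at h2
  rw [timeOrderedExp_eq hT.le hs.generator_integrable, evolution_fmTruncated_eq hT.ne']
  refine h2.trans (add_le_add ?_ (le_of_eq ?_))
  · rw [zpow_neg, zpow_natCast, one_div, inv_pow]
    refine mul_le_mul_of_nonneg_right ?_ (by positivity)
    nlinarith [mul_nonneg hV0 hT.le]
  · rw [fmBound]
    push_cast
    ring

/-- The error of the truncated expansion at a fixed order. -/
theorem norm_timeOrderedExp_sub_le_pow (hs : IsDrivenFewBody k J T h v) (hJ : 0 ≤ J)
    (hT : 0 < T) (hμ : lam k J * T ≤ 1) (n : ℕ) :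
    ‖timeOrderedExp (hamiltonian k h v) T - evolution (fmTruncated (hamiltonian k h v) T n) T‖
      ≤ driveStrength k T v * (lam k J ^ (n + 1) * (1
        + ∑ p ∈ defectIndex n, ((p.1 + p.2 + 1).factorial : ℝ) * 2 ^ p.1)) * T ^ (n + 2) := by
  have hl : 0 ≤ lam k J := by unfold lam; positivity
  have hV0 := driveStrength_nonneg (k := k) (v := v) hT
  have h2 := hs.isDrivenFamily.norm_sub_le_sum_defect hJ hT.le
    (fun t => by rw [totalOp_eq]; exact hs.generator_skew t) n
  rw [hs.integral_norm_drive hT, totalOp_eq] at h2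
  rw [timeOrderedExp_eq hT.le hs.generator_integrable, evolution_fmTruncated_eq hT.ne']
  set μ := lam k J * T with hμdef
  have hμ0 : 0 ≤ μ := by positivity
  -- Dropped pairs have total degree at least n + 1, so μ ≤ 1 allows μ^{n+1} to be taken out. The
  -- remaining power of T comes from ∫‖v‖ = V_0T.
  have h3 : ∑ p ∈ defectIndex n, μ ^ (p.1 + p.2 + 1) * ((p.1 + p.2 + 1).factorial : ℝ) * 2 ^ p.1
      ≤ μ ^ (n + 1) * ∑ p ∈ defectIndex n, ((p.1 + p.2 + 1).factorial : ℝ) * 2 ^ p.1 := by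
    rw [Finset.mul_sum]
    refine Finset.sum_le_sum fun p hp => ?_
    rw [mul_assoc]
    have hp2 : n ≤ p.1 + p.2 := (Finset.mem_filter.1 hp).2
    exact mul_le_mul_of_nonneg_right (pow_le_pow_of_le_one hμ0 hμ (by omega)) (by positivity)
  refine h2.trans ((div_le_self (by positivity) ?_).trans ?_)
  · linarith [(Nat.cast_nonneg n : (0 : ℝ) ≤ n)]
  · refine (mul_le_mul_of_nonneg_left (add_le_add_right h3 (μ ^ (n + 1)))
      (by positivity)).trans (le_of_eq ?_)
    rw [hμdef, mul_pow]
    ring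

/-- The system with period `s T` and Hamiltonian `H(t / s)`. -/
lemma rescale (hs : IsDrivenFewBody k J T h v) {s : ℝ} (hs0 : 0 < s) :
    IsDrivenFewBody k J (s * T) h fun X t => v X (t / s) where
  static_actsOn := hs.static_actsOn
  drive_actsOn X hX t := hs.drive_actsOn X hX (t / s)
  static_hermitian := hs.static_hermitian
  drive_hermitian t := hs.drive_hermitian (t / s)
  drive_periodic t := by
    have h1 := hs.drive_periodic (t / s)
    have h2 : (t + s * T) / s = t / s + T := by field_simp
    change drive k v ((t + s * T) / s) = drive k v (t / s)
    rw [h2, h1]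
  drive_integrable X hX := by
    have h1 := (hs.drive_integrable X hX).comp_mul_right (c := s⁻¹)
    simpa [div_eq_mul_inv, mul_comm] using h1
  strength i t := hs.strength i (t / s)

end IsDrivenFewBody

/-- A mean over one period is invariant under dilation of time, so the constant in the asymptotic
bound does not depend on s. -/
lemma driveStrength_rescale {s : ℝ} (hs0 : 0 < s) :
    driveStrength k (s * T) (fun X t => v X (t / s)) = driveStrength k T v := by
  refine Finset.sum_congr rfl fun X _ => ?_
  have h1 := intervalIntegral.integral_comp_div (a := 0) (b := s * T) (fun t => ‖v X t‖) hs0.ne'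
  rw [h1, zero_div, mul_div_cancel_left₀ _ hs0.ne', smul_eq_mul]
  field_simp

/-- The truncated expansion is asymptotic in the period. -/
theorem IsDrivenFewBody.isBigO_rescale (hsys : IsDrivenFewBody k J T h v) (hJ : 0 ≤ J)
    (hT : 0 < T) (n : ℕ) :
    (fun s : ℝ => timeOrderedExp (fun t => hamiltonian k h v (t / s)) (s * T)
        - evolution (fmTruncated (fun t => hamiltonian k h v (t / s)) (s * T) n) (s * T))
      =O[𝓝[>] 0] fun s : ℝ => (s * T) ^ (n + 2) := by
  refine IsBigO.of_bound (driveStrength k T v * (lam k J ^ (n + 1) * (1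
    + ∑ p ∈ defectIndex n, ((p.1 + p.2 + 1).factorial : ℝ) * 2 ^ p.1))) ?_
  have hsmall : ∀ᶠ s : ℝ in 𝓝 0, lam k J * (s * T) ≤ 1 := by
    have hc : Continuous fun s : ℝ => lam k J * (s * T) := by fun_prop
    have := hc.tendsto 0
    simp only [zero_mul, mul_zero] at this
    exact this.eventually (ge_mem_nhds one_pos)
  filter_upwards [nhdsWithin_le_nhds hsmall, self_mem_nhdsWithin] with s hs1 hs0
  have hs0' : 0 < s := hs0
  have h1 := (hsys.rescale hs0').norm_timeOrderedExp_sub_le_pow hJ (mul_pos hs0' hT) hs1 n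
  rw [driveStrength_rescale hs0'] at h1
  rw [Real.norm_eq_abs, abs_of_nonneg (by positivity)]
  exact h1

end Conclusion

end FloquetMagnus

end

open FloquetMagnus Filter Topology Asymptotics in
theorem corollary1 (N d k : ℕ) (hd : 1 ≤ d) (hk : 1 ≤ k) (J T : ℝ) (hJ : 0 < J) (hT : 0 < T)
    (h : Finset (Fin N) → Op N d) (v : Finset (Fin N) → ℝ → Op N d)
    (hsys : IsDrivenFewBody k J T h v) (hTsmall : T ≤ 1 / (4 * lam k J)) :
    -- the error bound, for the one-period evolution operator and for every Floquet Hamiltonian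
    (∀ n : ℕ, n ≤ optimalOrder k J T →
      ‖timeOrderedExp (hamiltonian k h v) T - evolution (fmTruncated (hamiltonian k h v) T n) T‖
          ≤ 6 * driveStrength k T v * T * (2 : ℝ) ^ (-(optimalOrder k J T : ℤ))
            + fmBound (driveStrength k T v) (lam k J) (n + 1) * T ^ (n + 2) ∧
      ∀ HF : Op N d, IsFloquetHamiltonian (hamiltonian k h v) T HF →
        ‖evolution HF T - evolution (fmTruncated (hamiltonian k h v) T n) T‖
          ≤ 6 * driveStrength k T v * T * (2 : ℝ) ^ (-(optimalOrder k J T : ℤ))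
            + fmBound (driveStrength k T v) (lam k J) (n + 1) * T ^ (n + 2)) ∧
    -- the expansion is asymptotic: under the rescaling `T → s T`, `H(t) → H(t / s)` with `s → 0+`,
    -- the error of the truncation at any fixed order `n` is of the order `n + 2` in the period
    (∀ n : ℕ,
      (fun s : ℝ =>
        timeOrderedExp (fun t => hamiltonian k h v (t / s)) (s * T)
          - evolution (fmTruncated (fun t => hamiltonian k h v (t / s)) (s * T) n) (s * T))
        =O[𝓝[>] 0] fun s : ℝ => (s * T) ^ (n + 2)) := by
  refine ⟨fun n hn => ?_, fun n => hsys.isBigO_rescale hJ.le hT n⟩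
  have hbound := hsys.norm_timeOrderedExp_sub_le hk hJ hT hn
  exact ⟨hbound, fun HF hHF => by rwa [hHF.2]⟩
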